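/- Let $\mathbb K$ be a field of characteristic $0$, and let $A=\bigsqcup_{n\ge 1}A_n$ be a locally finite set (each $A_n$ is finite; $\deg a=n$ for $a\in A_n$) with a total order. Let $[\cdot,\cdot]$ be a Hoffman pairing on $A$, i.e. a commutative, associative operation on $A\cup\{0\}$ with $[a,0]=0$ and with $[a,b]=0$ or $\deg[a,b]=\deg a+\deg b$ for $a,b\in A$. Consider the following commutative Hopf algebras over $\mathbb K$. * $(\mathbb K\langle A\rangle,\star^-)$, the quasi-shuffle Hopf algebra: its basis is the set of words in $A$ (the empty word is the unit $1$), $aw_1\star^- bw_2=a(w_1\star^- bw_2)+b(aw_1\star^- w_2)+[a,b](w_1\star^- w_2)$, $\Delta(w)=\sum_{uv=w}u\otimes v$, and $\epsilon(w)=0$ for $w\ne 1$. (For $[\cdot,\cdot]=0$ it is the shuffle Hopf algebra.) * $\mathbb K[\mathbf T(A)]$: its basis is the set of (non-planar) rooted forests with vertices labelled by $A$, seen as labelled posets in which roots are minimal; the product is disjoint union, and $\Delta(u)=\sum v\otimes w$ over all partitions of the vertex set of $u$ into two parts, with induced forests $v$ and $w$, such that $w$ contains with each vertex all the vertices below it.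 Let $\pi:\mathbb K[\mathbf T(A)]\to\mathbb K\langle A\rangle$ be the linear map that sends a forest $u$ to $\sum a_1a_2\cdots a_n$, the sum over all linear extensions $x_1>x_2>\dots>x_n$ of the order of $u$, where $a_i$ is the label of $x_i$. Put $I:=\ker\pi$. * $H_{CK}(A)$, the Connes–Kreimer Hopf algebra of $A$-labelled rooted trees: the polynomial algebra in the labelled rooted trees with $\Delta(t)=t\otimes 1+1\otimes t+\sum_c P_c(t)\otimes R_c(t)$, the sum over the non-trivial admissible cuts $c$ of $t$, where $R_c(t)$ contains the root. * $H_{NAP}(A)$, the $A$-labelled incidence Hopf algebra of the set operad $NAP$. For a finite set $V$ let $\Pi_{NAP}(V)$ be the poset of forests of rooted trees with vertex set $V$ in which $y$ covers $x$ if $y$ is obtained from $x$ by grafting the root of one component of $x$ to the root of another. Given labels $V\to A$, colour each covering relation by the label of the root that is grafted. The basis of $H_{NAP}(A)$ consists of elements $F_{[i]}$ for the classes, under colour-preserving isomorphism of posets, of finite products of intervals of such posets (for all $V$ and all labels); $F_{[i]}F_{[j]}=F_{[i\times j]}$ and $\Delta(F_{[i]})=\sum_{x}F_{[\mathbf 0,x]}\otimes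 F_{[x,\mathbf 1]}$ over all elements $x$ of the interval $i=[\mathbf 0,\mathbf 1]$. Finally, let $H_U$, the universal Hopf algebra of renormalization, be the graded dual of the universal enveloping algebra of the free graded Lie algebra over $\mathbb K$ with one generator $e_{-n}$ in each degree $n>0$. (i) $I$ is a Hopf ideal, and there are Hopf ideals $J_1\subseteq H_{CK}(A)$ and $J_2\subseteq H_{NAP}(A)$ such that, as Hopf algebras, $$(\mathbb K\langle A\rangle,\star^-)\;\cong\;\mathbb K[\mathbf T(A)]/I\;\cong\;H_{CK}(A)/J_1\;\cong\;H_{NAP}(A)/J_2 .$$ (ii) For the set of labels $A=\{f_n : n\in\mathbb N_{>0}\}$, $H_U$ is isomorphic as a Hopf algebra to the quotient of $H_{NAP}(A)$ by some Hopf ideal. -/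

import Mathlib

open TensorProduct

namespace RenHopf

section Antipode

open WithConv

variable {K H : Type*} [CommRing K] [Ring H] [Bialgebra K H]

theorem exists_convInverse_of_nilpotent
    (hnil : ∀ x : H, ∃ N, ∀ n ≥ N,
      ((1 - toConv LinearMap.id : WithConv (H →ₗ[K] H)) ^ n).ofConv x = 0) :
    ∃ S : H →ₗ[K] H, toConv S * toConv LinearMap.id = 1 ∧ toConv LinearMap.id * toConv S = 1 := by
  set g : WithConv (H →ₗ[K] H) := 1 - toConv LinearMap.id with hg
  have hid : (toConv LinearMap.id : WithConv (H →ₗ[K] H)) = 1 - g := by rw [hg]; abel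
  choose N hN using hnil
  let P : ℕ → WithConv (H →ₗ[K] H) := fun M => ∑ i ∈ Finset.range M, g ^ i
  have hP : ∀ x M, N x ≤ M → (P M).ofConv x = (P (N x)).ofConv x := by
    intro x M hM
    induction M, hM using Nat.le_induction with
    | base => rfl
    | succ M hM ih =>
      simp only [P, Finset.sum_range_succ, ofConv_add, LinearMap.add_apply] at ih ⊢
      rw [ih, hN x M hM, add_zero]
  let S : H →ₗ[K] H :=
    { toFun := fun x => (P (N x)).ofConv x
      map_add' := fun x y => by
        let M := max (N (x + y)) (max (N x) (N y))
        rw [← hP (x + y) M (by simp [M]), ← hP x M (by simp [M]), ← hP y M (by simp [M]), map_add]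
      map_smul' := fun c x => by
        let M := max (N (c • x)) (N x)
        rw [← hP (c • x) M (by simp [M]), ← hP x M (by simp [M]), map_smul]; rfl }
  have hS : ∀ x M, N x ≤ M → (P M).ofConv x = S x := hP
  have hl : ∀ z : H ⊗[K] H, ∃ M₀, ∀ M ≥ M₀,
      TensorProduct.map (P M).ofConv LinearMap.id z = TensorProduct.map S LinearMap.id z := by
    intro z
    induction z with
    | zero => exact ⟨0, by simp⟩
    | tmul x y => exact ⟨N x, fun M hM => by simp [hS x M hM]⟩
    | add x y hx hy =>
      obtain ⟨a, ha⟩ := hx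
      obtain ⟨b, hb⟩ := hy
      exact ⟨max a b, fun M hM => by
        simp [ha M (le_trans (le_max_left _ _) hM), hb M (le_trans (le_max_right _ _) hM)]⟩
  have hr : ∀ z : H ⊗[K] H, ∃ M₀, ∀ M ≥ M₀,
      TensorProduct.map LinearMap.id (P M).ofConv z = TensorProduct.map LinearMap.id S z := by
    intro z
    induction z with
    | zero => exact ⟨0, by simp⟩
    | tmul x y => exact ⟨N y, fun M hM => by simp [hS y M hM]⟩
    | add x y hx hy =>
      obtain ⟨a, ha⟩ := hx
      obtain ⟨b, hb⟩ := hy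
      exact ⟨max a b, fun M hM => by
        simp [ha M (le_trans (le_max_left _ _) hM), hb M (le_trans (le_max_right _ _) hM)]⟩
  refine ⟨S, ?_, ?_⟩
  · ext x
    obtain ⟨M₀, hM⟩ := hl (Coalgebra.comul x)
    let M := max M₀ (N x)
    have h1 : (P M * toConv LinearMap.id).ofConv x = (1 : WithConv (H →ₗ[K] H)).ofConv x := by
      rw [hid, geom_sum_mul_neg, ofConv_sub, LinearMap.sub_apply, hN x M (by simp [M]), sub_zero]
    rw [← h1]
    simp only [LinearMap.convMul_apply]
    rw [hM M (by simp [M])]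
  · ext x
    obtain ⟨M₀, hM⟩ := hr (Coalgebra.comul x)
    let M := max M₀ (N x)
    have h1 : (toConv LinearMap.id * P M).ofConv x = (1 : WithConv (H →ₗ[K] H)).ofConv x := by
      rw [hid, mul_neg_geom_sum, ofConv_sub, LinearMap.sub_apply, hN x M (by simp [M]), sub_zero]
    rw [← h1]
    simp only [LinearMap.convMul_apply]
    rw [hM M (by simp [M])]

/-- A bialgebra spanned by weighted elements, in which the coproduct does not raise the weight
and the elements of weight zero are scalars, has an antipode. -/
theorem exists_antipode {ι : Type*} (b : ι → H) (wt : ι → ℕ)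
    (hb : Submodule.span K (Set.range b) = ⊤)
    (hΔ : ∀ i, Coalgebra.comul (R := K) (b i) ∈
      Submodule.span K {z | ∃ j k, wt j + wt k ≤ wt i ∧ z = b j ⊗ₜ[K] b k})
    (h0 : ∀ i, wt i = 0 → algebraMap K H (Coalgebra.counit (R := K) (b i)) = b i) :
    ∃ S : H →ₗ[K] H, toConv S * toConv LinearMap.id = 1 ∧ toConv LinearMap.id * toConv S = 1 := by
  apply exists_convInverse_of_nilpotent
  set g : WithConv (H →ₗ[K] H) := 1 - toConv LinearMap.id with hg
  have key : ∀ n i, wt i < n → (g ^ n).ofConv (b i) = 0 := by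
    intro n
    induction n with
    | zero => intro i h; omega
    | succ n ih =>
      intro i hi
      rw [pow_succ]
      change LinearMap.mul' K H (TensorProduct.map (g ^ n).ofConv g.ofConv (Coalgebra.comul (b i))) = 0
      have hle : Submodule.span K {z | ∃ j k, wt j + wt k ≤ wt i ∧ z = b j ⊗ₜ[K] b k} ≤
          LinearMap.ker (LinearMap.mul' K H ∘ₗ TensorProduct.map (g ^ n).ofConv g.ofConv) := by
        rw [Submodule.span_le]
        rintro _ ⟨j, k, hjk, rfl⟩
        simp only [SetLike.mem_coe, LinearMap.mem_ker, LinearMap.comp_apply,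
          TensorProduct.map_tmul, LinearMap.mul'_apply]
        rcases Nat.eq_zero_or_pos (wt k) with hk | hk
        · have : g.ofConv (b k) = 0 := by
            simp [hg, h0 k hk]
          rw [this, mul_zero]
        · rw [ih j (by omega), zero_mul]
      exact hle (hΔ i)
  intro x
  have hx : x ∈ Submodule.span K (Set.range b) := hb ▸ Submodule.mem_top
  induction hx using Submodule.span_induction with
  | mem x hx =>
    obtain ⟨i, rfl⟩ := hx
    exact ⟨wt i + 1, fun n hn => key n i (by omega)⟩
  | zero => exact ⟨0, by simp⟩
  | add x y _ _ hx hy =>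
    obtain ⟨a, ha⟩ := hx
    obtain ⟨c, hc⟩ := hy
    exact ⟨max a c, fun n hn => by
      rw [map_add, ha n (le_trans (le_max_left _ _) hn), hc n (le_trans (le_max_right _ _) hn),
        add_zero]⟩
  | smul c x _ hx =>
    obtain ⟨a, ha⟩ := hx
    exact ⟨a, fun n hn => by rw [map_smul, ha n hn, smul_zero]⟩

/-- The Hopf algebra structure on a bialgebra whose identity is invertible for convolution; the
antipode is the (unique) convolution inverse of the identity. -/
@[reducible] noncomputable def hopfOfExists
    (h : ∃ S : H →ₗ[K] H, toConv S * toConv LinearMap.id = 1 ∧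
      toConv LinearMap.id * toConv S = 1) : HopfAlgebra K H :=
  .ofConvInverse h.choose h.choose_spec.1 h.choose_spec.2

end Antipode

section SplitMonoid

theorem sum_map_product {α β M : Type*} [AddCommMonoid M] (s : Multiset α) (t : Multiset β)
    (f : α × β → M) :
    ((s ×ˢ t).map f).sum = (s.map fun i => (t.map fun j => f (i, j)).sum).sum := by
  induction s using Multiset.induction <;> simp_all

theorem tmul_multiset_sum {K M N : Type*} [CommRing K] [AddCommGroup M] [Module K M]
    [AddCommGroup N] [Module K N] (x : M) (s : Multiset N) :
    x ⊗ₜ[K] s.sum = (s.map fun y => x ⊗ₜ[K] y).sum :=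
  map_multiset_sum (TensorProduct.mk K M N x) s

theorem multiset_sum_tmul {K M N : Type*} [CommRing K] [AddCommGroup M] [Module K M]
    [AddCommGroup N] [Module K N] (s : Multiset M) (y : N) :
    s.sum ⊗ₜ[K] y = (s.map fun x => x ⊗ₜ[K] y).sum :=
  map_multiset_sum ((TensorProduct.mk K M N).flip y) s

/-- A commutative monoid in which every element has a finite multiset of decompositions into
ordered pairs ("left part", "right part"), subject to the combinatorial form of the axioms of a
connected bialgebra. -/
class SplitMonoid (M : Type*) [CommMonoid M] where
  split : M → Multiset (M × M)
  split_one : split 1 = {(1, 1)}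
  split_mul : ∀ x y : M, split (x * y) =
    (split x ×ˢ split y).map fun p => (p.1.1 * p.2.1, p.1.2 * p.2.2)
  split_coassoc : ∀ x : M,
    ((split x).bind fun p => (split p.1).map fun q => (q.1, q.2, p.2)) =
      (split x).bind fun p => (split p.2).map fun q => (p.1, q.1, q.2)
  split_left : ∀ x : M, ∃ s, split x = (1, x) ::ₘ s ∧ ∀ p ∈ s, p.1 ≠ 1
  split_right : ∀ x : M, ∃ s, split x = (x, 1) ::ₘ s ∧ ∀ p ∈ s, p.2 ≠ 1
  exists_deg : ∃ deg : M → ℕ, (∀ x, deg x = 0 → x = 1) ∧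
    ∀ x, ∀ p ∈ split x, deg p.1 + deg p.2 ≤ deg x

open SplitMonoid

/-- The vector space with basis `M`, with the product of `M` extended bilinearly. -/
def SplitAlgebra (K M : Type*) [CommRing K] [CommMonoid M] : Type _ := MonoidAlgebra K M

namespace SplitAlgebra

variable (K M : Type*) [CommRing K] [CommMonoid M]

noncomputable instance : CommRing (SplitAlgebra K M) := inferInstanceAs (CommRing (MonoidAlgebra K M))
noncomputable instance : Algebra K (SplitAlgebra K M) :=
  inferInstanceAs (Algebra K (MonoidAlgebra K M))

variable {M}

/-- The basis elements, as a monoid homomorphism. -/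
noncomputable def of : M →* SplitAlgebra K M := MonoidAlgebra.of K M

variable {K}

/-- The algebra homomorphism determined by its values on basis elements. -/
noncomputable def lift {B : Type*} [CommRing B] [Algebra K B] (f : M →* B) :
    SplitAlgebra K M →ₐ[K] B := MonoidAlgebra.lift K B M f

@[simp] theorem lift_of {B : Type*} [CommRing B] [Algebra K B] (f : M →* B) (m : M) :
    lift f (of K m) = f m := MonoidAlgebra.lift_of f m

theorem hom_ext {B : Type*} [CommRing B] [Algebra K B] {f g : SplitAlgebra K M →ₐ[K] B}
    (h : ∀ m, f (of K m) = g (of K m)) : f = g :=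
  MonoidAlgebra.algHom_ext h (by ext)

theorem span_of : Submodule.span K (Set.range (of K (M := M))) = ⊤ := by
  rw [eq_top_iff]
  intro x _
  induction x using MonoidAlgebra.induction_on with
  | of m => exact Submodule.subset_span ⟨m, rfl⟩
  | add x y hx hy => exact Submodule.add_mem _ (hx trivial) (hy trivial)
  | smul r x hx => exact Submodule.smul_mem _ _ (hx trivial)

/-- The linear map determined by its values on basis elements. -/
noncomputable def linLift {B : Type*} [AddCommGroup B] [Module K B] (f : M → B) :
    SplitAlgebra K M →ₗ[K] B :=
  Finsupp.linearCombination K f ∘ₗ (MonoidAlgebra.coeffLinearEquiv K).toLinearMap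

@[simp] theorem linLift_of {B : Type*} [AddCommGroup B] [Module K B] (f : M → B) (m : M) :
    linLift f (of K m) = f m := by
  change Finsupp.linearCombination K f (MonoidAlgebra.single m (1 : K)).coeff = f m
  simp

variable [SplitMonoid M] (K M)

/-- `Δ(m) = ∑ m' ⊗ m''`, the sum over the decompositions `(m', m'')` of `m`. -/
noncomputable def comulHom : M →* SplitAlgebra K M ⊗[K] SplitAlgebra K M where
  toFun m := ((split m).map fun p => of K p.1 ⊗ₜ[K] of K p.2).sum
  map_one' := by simp [split_one, Algebra.TensorProduct.one_def]
  map_mul' x y := by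
    rw [split_mul, Multiset.map_map, sum_map_product, ← Multiset.sum_map_mul_right]
    simp only [← Multiset.sum_map_mul_left, Function.comp_apply, map_mul,
      Algebra.TensorProduct.tmul_mul_tmul]

open Classical in
/-- `ε(1) = 1` and `ε(m) = 0` for the other basis elements. -/
noncomputable def counitHom : M →* K where
  toFun m := if m = 1 then 1 else 0
  map_one' := by simp
  map_mul' x y := by
    by_cases hx : x = 1
    · simp [hx]
    · have : x * y ≠ 1 := by
        intro h
        have h1 := congrArg Multiset.card (split_mul x y)
        rw [h, split_one, Multiset.card_map, Multiset.card_product] at h1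
        obtain ⟨s, hs, hs'⟩ := split_left x
        obtain ⟨t, ht, ht'⟩ := split_right x
        have hc : Multiset.card (split x) = 1 := Nat.eq_one_of_mul_eq_one_right h1.symm
        have hs0 : s = 0 := by
          rw [hs] at hc; simpa using hc
        have ht0 : t = 0 := by
          rw [ht] at hc; simpa using hc
        rw [hs, hs0, ht0] at ht
        simp at ht
        exact hx ht.1.symm
      simp [hx, this]

noncomputable instance : Bialgebra K (SplitAlgebra K M) :=
  .ofAlgHom (lift (comulHom K M)) (lift (counitHom K M))
    (by
      apply hom_ext
      intro m
      have h := congrArg (fun s => (s.map fun q : M × M × M =>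
        of K q.1 ⊗ₜ[K] (of K q.2.1 ⊗ₜ[K] of K q.2.2)).sum) (split_coassoc m)
      simp only [Multiset.map_bind, Multiset.map_map, Multiset.sum_bind, Function.comp_def] at h
      simp only [AlgHom.comp_apply, lift_of, comulHom, MonoidHom.coe_mk, OneHom.coe_mk,
        map_multiset_sum, Multiset.map_map, Function.comp_def, Algebra.TensorProduct.map_tmul,
        AlgHom.id_apply]
      convert h using 4 with p p
      · rw [multiset_sum_tmul, map_multiset_sum, Multiset.map_map, Multiset.map_map]
        rfl
      · rw [tmul_multiset_sum, Multiset.map_map]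
        rfl)
    (by
      apply hom_ext
      intro m
      obtain ⟨s, hs, hs'⟩ := split_left m
      simp only [AlgHom.comp_apply, lift_of, comulHom, MonoidHom.coe_mk, OneHom.coe_mk, hs,
        Multiset.map_cons, Multiset.sum_cons, map_add, map_multiset_sum, Multiset.map_map]
      rw [Multiset.sum_eq_zero]
      · simp
      · simp only [Multiset.mem_map]
        rintro _ ⟨p, hp, rfl⟩
        simp [counitHom, hs' p hp])
    (by
      apply hom_ext
      intro m
      obtain ⟨s, hs, hs'⟩ := split_right m
      simp only [AlgHom.comp_apply, lift_of, comulHom, MonoidHom.coe_mk, OneHom.coe_mk, hs,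
        Multiset.map_cons, Multiset.sum_cons, map_add, map_multiset_sum, Multiset.map_map]
      rw [Multiset.sum_eq_zero]
      · simp
      · simp only [Multiset.mem_map]
        rintro _ ⟨p, hp, rfl⟩
        simp [counitHom, hs' p hp])

variable {M}

theorem comul_of (m : M) : Coalgebra.comul (R := K) (of K m) =
    ((split m).map fun p => of K p.1 ⊗ₜ[K] of K p.2).sum := lift_of (comulHom K M) m

open Classical in
theorem counit_of (m : M) : Coalgebra.counit (R := K) (of K m) = if m = 1 then 1 else 0 :=
  lift_of (counitHom K M) m

variable (M)

noncomputable instance : HopfAlgebra K (SplitAlgebra K M) :=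
  hopfOfExists (by
    obtain ⟨deg, h1, h2⟩ := exists_deg (M := M)
    refine exists_antipode (of K) deg span_of (fun m => ?_) (fun m hm => ?_)
    · rw [comul_of]
      refine multiset_sum_mem _ fun z hz => ?_
      obtain ⟨p, hp, rfl⟩ := Multiset.mem_map.1 hz
      exact Submodule.subset_span ⟨p.1, p.2, h2 m p hp, rfl⟩
    · simp [h1 m hm])

end SplitAlgebra
end SplitMonoid

section Family

/-- The multiset of the values of a function on a finite type. -/
noncomputable def family {α β : Type*} [Finite α] (f : α → β) : Multiset β :=
  (@Finset.univ α (Fintype.ofFinite α)).val.map f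

variable {α β γ : Type*} [Finite α]

theorem mem_family {f : α → γ} {c : γ} : c ∈ family f ↔ ∃ a, f a = c := by
  simp [family]

theorem family_congr_equiv [Finite β] (e : α ≃ β) {f : α → γ} {g : β → γ} (h : ∀ a, g (e a) = f a) :
    family f = family g := by
  let _ := Fintype.ofFinite α
  let _ := Fintype.ofFinite β
  have h1 : f = g ∘ e := by ext a; simp [h]
  simp only [family]
  rw [h1, ← Multiset.map_map]
  congr 1
  simp

theorem map_family (f : α → β) (g : β → γ) : (family f).map g = family fun a => g (f a) := by
  simp [family, Multiset.map_map]

theorem family_unique [Unique α] (f : α → γ) : family f = {f default} := by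
  simp [family]

theorem family_prod [Finite β] {δ ε : Type*} (f : α → δ) (g : β → ε) :
    family f ×ˢ family g = family fun p : α × β => (f p.1, g p.2) := by
  let _ := Fintype.ofFinite α
  let _ := Fintype.ofFinite β
  have h : (@Finset.univ (α × β) (Fintype.ofFinite _)) = Finset.univ ×ˢ Finset.univ := by
    ext; simp
  simp only [family]
  rw [h]
  change _ = ((Finset.univ : Finset α).val ×ˢ (Finset.univ : Finset β).val).map _
  generalize (Finset.univ : Finset α).val = s
  generalize (Finset.univ : Finset β).val = t
  induction s using Multiset.induction with
  | empty => simp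
  | cons a s ih => simp [ih, Multiset.map_map]

theorem family_bind {γ : α → Type*} [∀ a, Finite (γ a)] {δ : Type*} (f : α → β) (g : β → Multiset δ)
    (h : ∀ a, γ a → δ) (hg : ∀ a, g (f a) = family (h a)) :
    (family f).bind g = family fun p : Σ a, γ a => h p.1 p.2 := by
  let _ := Fintype.ofFinite α
  let _ := fun a => Fintype.ofFinite (γ a)
  have hs : (@Finset.univ (Σ a, γ a) (Fintype.ofFinite _)) =
      Finset.univ.sigma fun _ => Finset.univ := by
    ext; simp
  simp only [family] at hg ⊢
  rw [hs, Multiset.bind_map]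
  simp only [hg]
  change _ = (Multiset.sigma _ _).map _
  rw [Multiset.sigma, Multiset.map_bind]
  simp [Multiset.map_map]

theorem family_eq_cons (f : α → γ) (a₀ : α) :
    family f = f a₀ ::ₘ family fun a : {a // a ≠ a₀} => f a := by
  classical
  let _ := Fintype.ofFinite α
  have e : Option {a // a ≠ a₀} ≃ α := Equiv.optionSubtypeNe a₀
  rw [← family_congr_equiv (Equiv.optionSubtypeNe a₀) (f := fun o => f (Equiv.optionSubtypeNe a₀ o))
    (fun _ => rfl)]
  let _ := Fintype.ofFinite {a // a ≠ a₀}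
  have h : (@Finset.univ (Option {a // a ≠ a₀}) (Fintype.ofFinite _)) = Finset.insertNone Finset.univ := by
    ext; simp
  simp only [family]
  rw [h]
  simp [Finset.insertNone, Multiset.map_map, Function.comp_def]

end Family

universe u

/-! ### Labelled rooted forests -/

/-- A finite rooted forest with vertices labelled by `A`, as a labelled poset: the vertices below
(that is, on the path from the root to) a given vertex form a chain; roots are minimal. -/
structure ForestPoset (A : Type u) : Type (max 1 u) where
  V : Type
  [order : PartialOrder V]
  [finite : Finite V]
  label : V → A
  chain : ∀ x y z : V, y ≤ x → z ≤ x → y ≤ z ∨ z ≤ y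

attribute [instance] ForestPoset.order ForestPoset.finite

namespace ForestPoset

variable {A : Type u}

/-- The sub-poset on a set of vertices. -/
def restrict (U : ForestPoset A) (s : Set U.V) : ForestPoset A where
  V := s
  label x := U.label x
  chain x y z := U.chain x y z

/-- The disjoint union of two forests. -/
def union (U W : ForestPoset A) : ForestPoset A where
  V := U.V ⊕ W.V
  label := Sum.elim U.label W.label
  chain := by
    rintro (x | x) (y | y) (z | z) h1 h2 <;> simp at h1 h2 ⊢
    exacts [U.chain x y z h1 h2, W.chain x y z h1 h2]

/-- The empty forest. -/
def empty : ForestPoset A where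
  V := Empty
  label := Empty.elim
  chain x := x.elim

/-- Isomorphism of labelled forests. -/
def Iso (U W : ForestPoset A) : Prop := ∃ e : U.V ≃o W.V, ∀ x, W.label (e x) = U.label x

theorem Iso.refl (U : ForestPoset A) : Iso U U := ⟨OrderIso.refl _, fun _ => rfl⟩

theorem Iso.symm {U W : ForestPoset A} : Iso U W → Iso W U := by
  rintro ⟨e, he⟩
  exact ⟨e.symm, fun x => by rw [← he]; simp⟩

theorem Iso.trans {U W X : ForestPoset A} : Iso U W → Iso W X → Iso U X := by
  rintro ⟨e, he⟩ ⟨f, hf⟩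
  exact ⟨e.trans f, fun x => by simp [hf, he]⟩

instance setoid : Setoid (ForestPoset A) := ⟨Iso, Iso.refl, Iso.symm, Iso.trans⟩

theorem Iso.union {U U' W W' : ForestPoset A} : Iso U U' → Iso W W' →
    Iso (U.union W) (U'.union W') := by
  rintro ⟨e, he⟩ ⟨f, hf⟩
  refine ⟨OrderIso.sumCongr e f, ?_⟩
  rintro (x | x)
  exacts [he x, hf x]

end ForestPoset

/-- `F(A)`: the set of (non-planar) rooted forests labelled by `A`, i.e. isomorphism classes. -/
def Forest (A : Type u) : Type (max 1 u) := Quotient (ForestPoset.setoid (A := A))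

namespace Forest

open ForestPoset

variable {A : Type u}

/-- The labelled forest represented by a labelled poset. -/
def mk (U : ForestPoset A) : Forest A := Quotient.mk _ U

/-- An isomorphism-invariant function of labelled posets, as a function of forests. -/
def lift {β : Sort*} (f : ForestPoset A → β) (h : ∀ U W, U.Iso W → f U = f W) : Forest A → β :=
  Quotient.lift f h

theorem mk_eq {U W : ForestPoset A} : mk U = mk W ↔ Iso U W := Quotient.eq

theorem sound {U W : ForestPoset A} (e : U.V ≃ W.V) (hle : ∀ x y, e x ≤ e y ↔ x ≤ y)
    (hl : ∀ x, W.label (e x) = U.label x) : mk U = mk W :=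
  mk_eq.2 ⟨⟨e, fun {x y} => hle x y⟩, hl⟩

/-- Product of forests: disjoint union; the unit `𝕀` is the empty forest. -/
instance : CommMonoid (Forest A) where
  mul := Quotient.map₂ ForestPoset.union fun _ _ h _ _ h' => h.union h'
  one := mk ForestPoset.empty
  mul_assoc := by
    rintro ⟨U⟩ ⟨W⟩ ⟨X⟩
    refine mk_eq.2 ⟨OrderIso.sumAssoc U.V W.V X.V, ?_⟩
    rintro ((x | x) | x) <;> rfl
  one_mul := by
    rintro ⟨U⟩
    refine sound (U := ForestPoset.empty.union U) (W := U) (Equiv.emptySum Empty U.V) ?_ ?_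
    · rintro (x | x) (y | y)
      · exact x.elim
      · exact x.elim
      · exact y.elim
      · exact (Sum.inr_le_inr_iff (α := Empty)).symm
    · rintro (x | x)
      · exact x.elim
      · rfl
  mul_one := by
    rintro ⟨U⟩
    refine sound (U := U.union ForestPoset.empty) (W := U) (Equiv.sumEmpty U.V Empty) ?_ ?_
    · rintro (x | x) (y | y)
      · exact (Sum.inl_le_inl_iff (β := Empty)).symm
      · exact y.elim
      · exact x.elim
      · exact y.elim
    · rintro (x | x)
      · rfl
      · exact x.elim
  mul_comm := by
    rintro ⟨U⟩ ⟨W⟩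
    refine mk_eq.2 ⟨OrderIso.sumComm U.V W.V, ?_⟩
    rintro (x | x) <;> rfl

theorem mk_mul (U W : ForestPoset A) : mk U * mk W = mk (U.union W) := rfl

theorem one_def : (1 : Forest A) = mk ForestPoset.empty := rfl

theorem mk_eq_one {U : ForestPoset A} : mk U = 1 ↔ IsEmpty U.V := by
  constructor
  · intro h
    obtain ⟨e, -⟩ := mk_eq.1 h
    exact (e.toEquiv.isEmpty_congr).2 (inferInstanceAs (IsEmpty Empty))
  · intro h
    exact sound (U := U) (W := ForestPoset.empty) (Equiv.equivEmpty U.V) (fun x => h.elim x)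
      (fun x => h.elim x)

theorem mk_restrict_restrict (U : ForestPoset A) (s : Set U.V) (t : Set s) (w : Set U.V)
    (h : ∀ x, x ∈ w ↔ ∃ hx : x ∈ s, (⟨x, hx⟩ : s) ∈ t) :
    mk ((U.restrict s).restrict t) = mk (U.restrict w) := by
  refine sound (U := (U.restrict s).restrict t) (W := U.restrict w)
    ⟨fun x => ⟨x.1.1, (h _).2 ⟨x.1.2, x.2⟩⟩, fun x => ⟨⟨x.1, ((h _).1 x.2).1⟩, ((h _).1 x.2).2⟩,
      fun _ => rfl, fun _ => rfl⟩ (fun _ _ => Iff.rfl) fun _ => rfl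

theorem mk_restrict_univ (U : ForestPoset A) (s : Set U.V) (h : ∀ x, x ∈ s) :
    mk (U.restrict s) = mk U :=
  sound (U := U.restrict s) (W := U) ⟨fun x => x.1, fun x => ⟨x, h x⟩, fun _ => rfl, fun _ => rfl⟩
    (fun _ _ => Iff.rfl) fun _ => rfl

/-- The pairs `(v, w)` where the vertex set of `u` is the disjoint union of those of `v` and `w`,
and `w` contains with each vertex everything below it. -/
noncomputable def splitPoset (U : ForestPoset A) : Multiset (Forest A × Forest A) :=
  family fun s : {s : Set U.V // IsLowerSet s} => (mk (U.restrict s.1ᶜ), mk (U.restrict s.1))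

theorem splitPoset_congr {U W : ForestPoset A} (h : Iso U W) : splitPoset U = splitPoset W := by
  obtain ⟨e, he⟩ := h
  let E : {s : Set U.V // IsLowerSet s} ≃ {s : Set W.V // IsLowerSet s} :=
    { toFun := fun s => ⟨e.symm ⁻¹' s.1, fun a b hab ha => s.2 (by simpa using hab) ha⟩
      invFun := fun s => ⟨e ⁻¹' s.1, fun a b hab ha => s.2 (by simpa using hab) ha⟩
      left_inv := fun s => by ext; simp
      right_inv := fun s => by ext; simp }
  have key : ∀ (s : Set U.V) (t : Set W.V), (∀ x, x ∈ s ↔ e x ∈ t) →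
      mk (W.restrict t) = mk (U.restrict s) := by
    intro s t hst
    symm
    exact sound (U := U.restrict s) (W := W.restrict t) (e.toEquiv.subtypeEquiv hst)
      (fun x y => e.le_iff_le (x := x.1) (y := y.1)) (fun x => he x.1)
  exact family_congr_equiv E fun s => Prod.ext (key _ _ (by simp [E])) (key _ _ (by simp [E]))

noncomputable instance : SplitMonoid (Forest A) where
  split := Forest.lift splitPoset fun _ _ h => splitPoset_congr h
  split_one := by
    change splitPoset ForestPoset.empty = _
    let _ : IsEmpty (ForestPoset.empty : ForestPoset A).V := inferInstanceAs (IsEmpty Empty)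
    let _ : Unique {s : Set (ForestPoset.empty : ForestPoset A).V // IsLowerSet s} :=
      { default := ⟨∅, isLowerSet_empty⟩, uniq := fun s => Subtype.ext (Subsingleton.elim _ _) }
    rw [splitPoset, family_unique, mk_eq_one.2, mk_eq_one.2]
    · exact ⟨fun x => isEmptyElim x.1⟩
    · exact ⟨fun x => isEmptyElim x.1⟩
  split_mul := by
    rintro ⟨U⟩ ⟨W⟩
    change splitPoset (U.union W) = (splitPoset U ×ˢ splitPoset W).map _
    rw [splitPoset, splitPoset, splitPoset, family_prod, map_family]
    let E : {s : Set (U.union W).V // IsLowerSet s} ≃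
        {s : Set U.V // IsLowerSet s} × {s : Set W.V // IsLowerSet s} :=
      { toFun := fun s => (⟨Sum.inl ⁻¹' s.1, fun a b h => s.2 (Sum.inl_le_inl_iff.2 h)⟩,
          ⟨Sum.inr ⁻¹' s.1, fun a b h => s.2 (Sum.inr_le_inr_iff.2 h)⟩)
        invFun := fun p => ⟨{x | Sum.elim (· ∈ p.1.1) (· ∈ p.2.1) x}, by
          rintro (a | a) (b | b) h1 h2
          · exact p.1.2 (Sum.inl_le_inl_iff.1 h1) h2
          · exact absurd h1 Sum.not_inr_le_inl
          · exact absurd h1 Sum.not_inl_le_inr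
          · exact p.2.2 (Sum.inr_le_inr_iff.1 h1) h2⟩
        left_inv := fun s => by ext (x | x) <;> rfl
        right_inv := fun p => rfl }
    refine family_congr_equiv E fun s => ?_
    have key : ∀ s : Set (U.union W).V, mk (U.restrict (Sum.inl ⁻¹' s)) * mk (W.restrict (Sum.inr ⁻¹' s))
        = mk ((U.union W).restrict s) := by
      intro s
      symm
      refine sound (U := (U.union W).restrict s)
        (W := (U.restrict (Sum.inl ⁻¹' s)).union (W.restrict (Sum.inr ⁻¹' s)))
        (Equiv.subtypeSum (p := fun x => x ∈ s)) ?_ ?_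
      · rintro ⟨x | x, hx⟩ ⟨y | y, hy⟩
        · exact Sum.inl_le_inl_iff.trans (Sum.inl_le_inl_iff (a := x) (b := y)).symm
        · exact iff_of_false Sum.not_inl_le_inr (Sum.not_inl_le_inr (a := y) (b := x))
        · exact iff_of_false Sum.not_inr_le_inl (Sum.not_inr_le_inl (a := y) (b := x))
        · exact Sum.inr_le_inr_iff.trans (Sum.inr_le_inr_iff (a := x) (b := y)).symm
      · rintro ⟨x | x, hx⟩ <;> rfl
    exact Prod.ext (key s.1ᶜ) (key s.1)
  split_coassoc := by
    rintro ⟨U⟩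
    change (splitPoset U).bind _ = (splitPoset U).bind _
    let P := {p : Set U.V × Set U.V // IsLowerSet p.1 ∧ IsLowerSet p.2 ∧ p.1 ⊆ p.2}
    let F : P → Forest A × Forest A × Forest A := fun p =>
      (mk (U.restrict p.1.2ᶜ), mk (U.restrict (p.1.2 \ p.1.1)), mk (U.restrict p.1.1))
    trans family F
    · rw [splitPoset, family_bind (γ := fun s : {s : Set U.V // IsLowerSet s} =>
          {t : Set (U.restrict s.1ᶜ).V // IsLowerSet t}) _ _
        (fun s t => (mk ((U.restrict s.1ᶜ).restrict t.1ᶜ), mk ((U.restrict s.1ᶜ).restrict t.1),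
          mk (U.restrict s.1))) (fun s => map_family _ _)]
      let E : (Σ s : {s : Set U.V // IsLowerSet s}, {t : Set (U.restrict s.1ᶜ).V // IsLowerSet t}) ≃ P :=
        { toFun := fun q => ⟨(q.1.1, {x | ∀ h : x ∉ q.1.1, (⟨x, h⟩ : (q.1.1ᶜ : Set U.V)) ∈ q.2.1}),
            q.1.2, fun a b hab ha hb =>
              q.2.2 (a := ⟨a, fun h => hb (q.1.2 hab h)⟩) (b := ⟨b, hb⟩) hab
                (ha fun h => hb (q.1.2 hab h)),
            fun x hx h => absurd hx h⟩
          invFun := fun p => ⟨⟨p.1.1, p.2.1⟩, ⟨{x | x.1 ∈ p.1.2}, fun a b hab ha => p.2.2.1 hab ha⟩⟩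
          left_inv := by
            rintro ⟨⟨s, hs⟩, ⟨t, ht⟩⟩
            refine Sigma.ext rfl (heq_of_eq (Subtype.ext (Set.ext fun x => ?_)))
            exact ⟨fun h => h x.2, fun h _ => h⟩
          right_inv := by
            rintro ⟨⟨s, t⟩, hs, ht, hst⟩
            apply Subtype.ext
            refine Prod.ext rfl ?_
            ext x
            exact ⟨fun h => by_contra fun h' => h' (h fun h'' => h' (hst h'')), fun h _ => h⟩ }
      refine family_congr_equiv E fun q => ?_
      refine Prod.ext ?_ (Prod.ext ?_ rfl)
      · refine (mk_restrict_restrict U _ _ _ fun x => ?_).symm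
        exact ⟨fun h => not_forall.1 h, fun h => not_forall.2 h⟩
      · refine (mk_restrict_restrict U _ _ _ fun x => ?_).symm
        exact ⟨fun h => ⟨h.2, h.1 h.2⟩, fun ⟨h, h'⟩ => ⟨fun _ => h', h⟩⟩
    · symm
      rw [splitPoset, family_bind (γ := fun s : {s : Set U.V // IsLowerSet s} =>
          {t : Set (U.restrict s.1).V // IsLowerSet t}) _ _
        (fun s t => (mk (U.restrict s.1ᶜ), mk ((U.restrict s.1).restrict t.1ᶜ),
          mk ((U.restrict s.1).restrict t.1))) (fun s => map_family _ _)]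
      let E : (Σ s : {s : Set U.V // IsLowerSet s}, {t : Set (U.restrict s.1).V // IsLowerSet t}) ≃ P :=
        { toFun := fun q => ⟨({x | ∃ h : x ∈ q.1.1, (⟨x, h⟩ : q.1.1) ∈ q.2.1}, q.1.1),
            fun a b hab ⟨ha, ha'⟩ => ⟨q.1.2 hab ha, q.2.2 (a := ⟨a, ha⟩) (b := ⟨b, _⟩) hab ha'⟩,
            q.1.2, fun x hx => hx.1⟩
          invFun := fun p => ⟨⟨p.1.2, p.2.2.1⟩, ⟨{x | x.1 ∈ p.1.1}, fun a b hab ha => p.2.1 hab ha⟩⟩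
          left_inv := by
            rintro ⟨⟨s, hs⟩, ⟨t, ht⟩⟩
            refine Sigma.ext rfl (heq_of_eq (Subtype.ext (Set.ext fun x => ?_)))
            exact ⟨fun h => h.2, fun h => ⟨x.2, h⟩⟩
          right_inv := by
            rintro ⟨⟨s, t⟩, hs, ht, hst⟩
            apply Subtype.ext
            refine Prod.ext ?_ rfl
            ext x
            exact ⟨fun h => h.2, fun h => ⟨hst h, h⟩⟩ }
      refine family_congr_equiv E fun q => ?_
      refine Prod.ext rfl (Prod.ext ?_ ?_)
      · refine (mk_restrict_restrict U _ _ _ fun x => ?_).symm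
        exact ⟨fun h => ⟨h.1, fun h' => h.2 ⟨h.1, h'⟩⟩, fun ⟨h, h'⟩ => ⟨h, fun ⟨_, h''⟩ => h' h''⟩⟩
      · exact (mk_restrict_restrict U _ _ _ fun x => Iff.rfl).symm
  split_left := by
    rintro ⟨U⟩
    refine ⟨_, (family_eq_cons (α := {s : Set U.V // IsLowerSet s}) _
      ⟨Set.univ, isLowerSet_univ⟩).trans (congrArg (· ::ₘ _) ?_), ?_⟩
    · change (mk _, mk _) = ((1 : Forest A), mk U)
      rw [mk_restrict_univ U Set.univ (fun _ => trivial), mk_eq_one.2]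
      exact ⟨fun x => x.2 trivial⟩
    · rintro p hp
      obtain ⟨⟨⟨s, hs⟩, hne⟩, rfl⟩ := mem_family.1 hp
      intro h
      have h := mk_eq_one.1 h
      apply hne
      apply Subtype.ext
      exact Set.eq_univ_of_forall fun x => by_contra fun hx => h.elim ⟨x, hx⟩
  split_right := by
    rintro ⟨U⟩
    refine ⟨_, (family_eq_cons (α := {s : Set U.V // IsLowerSet s}) _
      ⟨∅, isLowerSet_empty⟩).trans (congrArg (· ::ₘ _) ?_), ?_⟩
    · change (mk _, mk _) = (mk U, (1 : Forest A))
      exact Prod.ext (mk_restrict_univ U ∅ᶜ fun _ => id) (mk_eq_one.2 ⟨fun x => x.2⟩)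
    · rintro p hp
      obtain ⟨⟨⟨s, hs⟩, hne⟩, rfl⟩ := mem_family.1 hp
      intro h
      have h := mk_eq_one.1 h
      apply hne
      apply Subtype.ext
      exact Set.eq_empty_of_forall_notMem fun x hx => h.elim ⟨x, hx⟩
  exists_deg := by
    refine ⟨Quotient.lift (fun U => Nat.card U.V) fun U W h => ?_, ?_, ?_⟩
    · obtain ⟨e, -⟩ := h
      exact Nat.card_congr e.toEquiv
    · rintro ⟨U⟩ h
      change Nat.card U.V = 0 at h
      exact mk_eq_one.2 ((Nat.card_eq_zero.1 h).resolve_right fun h => h.not_finite inferInstance)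
    · rintro ⟨U⟩ p hp
      obtain ⟨s, rfl⟩ := mem_family.1 (show p ∈ splitPoset U from hp)
      change Nat.card ↥(s.1ᶜ) + Nat.card ↥s.1 ≤ Nat.card U.V
      rw [add_comm, Nat.card_coe_set_eq, Nat.card_coe_set_eq, Set.ncard_add_ncard_compl]

theorem split_mk (U : ForestPoset A) : SplitMonoid.split (mk U) = splitPoset U := rfl

end Forest

/-! ### The Hopf algebra `K[T(A)]` and the map `π` -/

/-- `K[T(A)]`: the commutative algebra with basis the `A`-labelled forests, with coproduct
`Δ(u) = ∑ v ⊗ w` over the decompositions `(v, w)` of `u` given by `Forest.splitPoset`. -/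
abbrev KT (K : Type*) [CommRing K] (A : Type u) : Type _ := SplitAlgebra K (Forest A)

/-- The total orders on the vertices of `U` that extend its partial order, each given by the list
of all vertices in decreasing order. -/
def LinExt {A : Type u} (U : ForestPoset A) : Type :=
  {l : List U.V // l.Nodup ∧ (∀ x, x ∈ l) ∧ l.Pairwise fun x y => ¬ x < y}

instance {A : Type u} (U : ForestPoset A) : Finite (LinExt U) := by
  classical
  let _ := Fintype.ofFinite U.V
  exact Finite.of_injective (β := {l : List U.V // l.Nodup}) (fun l => ⟨l.1, l.2.1⟩)
    fun l l' h => Subtype.ext (Subtype.mk.inj h)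

/-- The multiset of words `a₁ a₂ … aₙ` read off along the linear extensions `x₁ > x₂ > … > xₙ`. -/
noncomputable def wordsPoset {A : Type u} (U : ForestPoset A) : Multiset (List A) :=
  family fun l : LinExt U => l.1.map U.label

theorem wordsPoset_congr {A : Type u} {U W : ForestPoset A} (h : U.Iso W) :
    wordsPoset U = wordsPoset W := by
  obtain ⟨e, he⟩ := h
  let E : LinExt U ≃ LinExt W :=
    { toFun := fun l => ⟨l.1.map e, l.2.1.map e.injective,
        fun x => List.mem_map.2 ⟨e.symm x, l.2.2.1 _, by simp⟩,
        List.pairwise_map.2 (l.2.2.2.imp (by simp))⟩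
      invFun := fun l => ⟨l.1.map e.symm, l.2.1.map e.symm.injective,
        fun x => List.mem_map.2 ⟨e x, l.2.2.1 _, by simp⟩,
        List.pairwise_map.2 (l.2.2.2.imp (by simp))⟩
      left_inv := fun l => Subtype.ext (by simp [Function.comp_def])
      right_inv := fun l => Subtype.ext (by simp [Function.comp_def]) }
  exact family_congr_equiv E fun l => by
    change (l.1.map e).map W.label = _
    simp [Function.comp_def, he]

/-- `π : K[T(A)] → K⟨A⟩`, the linear map `u ↦ ∑ w(>)` over all total orders `>` extending the
order of the forest `u`. -/
noncomputable def piMap (K : Type*) [CommRing K] (A : Type u) : KT K A →ₗ[K] (List A →₀ K) :=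
  SplitAlgebra.linLift fun u : Forest A =>
    ((Forest.lift wordsPoset (fun _ _ h => wordsPoset_congr h) u).map
      fun w => Finsupp.single w (1 : K)).sum

/-! ### The Connes–Kreimer Hopf algebra of labelled rooted trees -/

namespace Forest

variable {A : Type u}

/-- A rooted tree is a forest with exactly one root, which lies below all vertices. -/
def IsTree (u : Forest A) : Prop :=
  Forest.lift (fun U : ForestPoset A => ∃ r : U.V, ∀ x, r ≤ x)
    (fun U W h => by
      obtain ⟨e, -⟩ := h
      exact propext ⟨fun ⟨r, hr⟩ => ⟨e r, fun x => by rw [← e.le_symm_apply]; exact hr _⟩,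
        fun ⟨r, hr⟩ => ⟨e.symm r, fun x => by rw [e.symm_apply_le]; exact hr _⟩⟩) u

end Forest

/-- `T(A)`: the set of (non-planar) rooted trees labelled by `A`. -/
def Tree (A : Type u) : Type (max 1 u) := {t : Forest A // t.IsTree}

/-- A tree, seen as a forest. -/
def Tree.toForest {A : Type u} (t : Tree A) : Forest A := t.1

theorem Tree.exists_rep {A : Type u} (t : Tree A) :
    ∃ (U : ForestPoset A) (r : U.V), (∀ x, r ≤ x) ∧ t.toForest = Forest.mk U := by
  obtain ⟨⟨U⟩, r, hr⟩ := t
  exact ⟨U, r, hr, rfl⟩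

namespace Forest

open ForestPoset

variable {A : Type u}

/-- The subtree of `U` with root `r`. -/
def treeAt (U : ForestPoset A) (r : U.V) : Tree A :=
  ⟨mk (U.restrict (Set.Ici r)), ⟨⟨r, Set.self_mem_Ici⟩, fun x => x.2⟩⟩

/-- The multiset of the trees of a forest. -/
noncomputable def treesPoset (U : ForestPoset A) : Multiset (Tree A) :=
  family fun r : {r : U.V // IsMin r} => treeAt U r.1

theorem mk_restrict_congr {U W : ForestPoset A} (e : U.V ≃o W.V)
    (he : ∀ x, W.label (e x) = U.label x) (s : Set U.V) (t : Set W.V)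
    (hst : ∀ x, x ∈ s ↔ e x ∈ t) : mk (U.restrict s) = mk (W.restrict t) :=
  sound (U := U.restrict s) (W := W.restrict t) (e.toEquiv.subtypeEquiv hst)
    (fun x y => e.le_iff_le (x := x.1) (y := y.1)) (fun x => he x.1)

theorem treesPoset_congr {U W : ForestPoset A} (h : U.Iso W) : treesPoset U = treesPoset W := by
  obtain ⟨e, he⟩ := h
  refine family_congr_equiv (e.toEquiv.subtypeEquiv fun r => ?_) fun r => Subtype.ext ?_
  · exact (OrderIso.isMin_apply e).symm
  · exact (mk_restrict_congr e he _ _ fun x => e.le_iff_le.symm).symm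

/-- The multiset of the trees of a forest. -/
noncomputable def trees : Forest A → Multiset (Tree A) :=
  Forest.lift treesPoset fun _ _ h => treesPoset_congr h

theorem family_sum {α β γ : Type*} [Finite α] [Finite β] (f : α ⊕ β → γ) :
    family f = family (fun a => f (.inl a)) + family fun b => f (.inr b) := by
  let _ := Fintype.ofFinite α
  let _ := Fintype.ofFinite β
  have h : (@Finset.univ (α ⊕ β) (Fintype.ofFinite _)) = Finset.univ.disjSum Finset.univ := by
    ext; simp
  simp only [family, h]
  simp [Finset.disjSum, Multiset.disjSum, Multiset.map_map]

theorem trees_mul (u v : Forest A) : trees (u * v) = trees u + trees v := by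
  obtain ⟨U⟩ := u
  obtain ⟨W⟩ := v
  change treesPoset (U.union W) = treesPoset U + treesPoset W
  have hl : ∀ x : U.V, IsMin (Sum.inl x : U.V ⊕ W.V) ↔ IsMin x := by
    intro x
    constructor
    · intro h y hy; exact Sum.inl_le_inl_iff.1 (h (Sum.inl_le_inl_iff.2 hy))
    · rintro h (y | y) hy
      · exact Sum.inl_le_inl_iff.2 (h (Sum.inl_le_inl_iff.1 hy))
      · exact absurd hy Sum.not_inr_le_inl
  have hr : ∀ x : W.V, IsMin (Sum.inr x : U.V ⊕ W.V) ↔ IsMin x := by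
    intro x
    constructor
    · intro h y hy; exact Sum.inr_le_inr_iff.1 (h (Sum.inr_le_inr_iff.2 hy))
    · rintro h (y | y) hy
      · exact absurd hy Sum.not_inl_le_inr
      · exact Sum.inr_le_inr_iff.2 (h (Sum.inr_le_inr_iff.1 hy))
  let E : {r : (U.union W).V // IsMin r} ≃ {r : U.V // IsMin r} ⊕ {r : W.V // IsMin r} :=
    (Equiv.subtypeSum (p := fun x : U.V ⊕ W.V => IsMin x)).trans
      (Equiv.sumCongr (Equiv.subtypeEquivRight hl) (Equiv.subtypeEquivRight hr))
  have := family_sum (Sum.elim (fun r : {r : U.V // IsMin r} => treeAt U r.1)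
    (fun r : {r : W.V // IsMin r} => treeAt W r.1))
  refine Eq.trans (family_congr_equiv E ?_) this
  rintro ⟨x | x, hx⟩
  · apply Subtype.ext
    refine sound (U := U.restrict (Set.Ici x)) (W := (U.union W).restrict (Set.Ici (Sum.inl x)))
      ⟨fun y => ⟨Sum.inl y.1, Sum.inl_le_inl_iff.2 y.2⟩, fun y => match y with
        | ⟨Sum.inl y, hy⟩ => ⟨y, Sum.inl_le_inl_iff.1 hy⟩
        | ⟨Sum.inr y, hy⟩ => absurd hy Sum.not_inl_le_inr, fun _ => rfl, ?_⟩
      (fun y z => Sum.inl_le_inl_iff) fun _ => rfl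
    rintro ⟨y | y, hy⟩
    · rfl
    · exact absurd hy Sum.not_inl_le_inr
  · apply Subtype.ext
    refine sound (U := W.restrict (Set.Ici x)) (W := (U.union W).restrict (Set.Ici (Sum.inr x)))
      ⟨fun y => ⟨Sum.inr y.1, Sum.inr_le_inr_iff.2 y.2⟩, fun y => match y with
        | ⟨Sum.inr y, hy⟩ => ⟨y, Sum.inr_le_inr_iff.1 hy⟩
        | ⟨Sum.inl y, hy⟩ => absurd hy Sum.not_inr_le_inl, fun _ => rfl, ?_⟩
      (fun y z => Sum.inr_le_inr_iff) fun _ => rfl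
    rintro ⟨y | y, hy⟩
    · exact absurd hy Sum.not_inr_le_inl
    · rfl

theorem trees_tree (t : Tree A) : trees t.toForest = {t} := by
  obtain ⟨⟨U⟩, r, hr⟩ := t
  change treesPoset U = _
  have hmin : IsMin r := fun x _ => hr x
  let _ : Unique {r : U.V // IsMin r} :=
    { default := ⟨r, hmin⟩
      uniq := fun x => Subtype.ext (x.2.eq_of_ge (hr x.1)) }
  rw [treesPoset, family_unique]
  congr 1
  exact Subtype.ext (mk_restrict_univ U _ hr)

theorem trees_one : trees (1 : Forest A) = 0 := by
  have := trees_mul (1 : Forest A) 1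
  simpa using this

theorem prod_trees (u : Forest A) : ((trees u).map Tree.toForest).prod = u := by
  obtain ⟨U⟩ := u
  change ((trees (mk U)).map Tree.toForest).prod = mk U
  induction hn : Nat.card U.V using Nat.strong_induction_on generalizing U with
  | _ n ih =>
  rcases isEmpty_or_nonempty U.V with he | hne
  · rw [mk_eq_one.2 he, trees_one]; rfl
  · obtain ⟨r, -, hr⟩ := (Set.toFinite (Set.univ : Set U.V)).exists_minimal Set.univ_nonempty
    have hr : IsMin r := fun x hx => hr trivial hx
    have key : mk U = mk (U.restrict (Set.Ici r)) * mk (U.restrict (Set.Ici r)ᶜ) := by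
      symm
      classical
      refine sound (U := (U.restrict (Set.Ici r)).union (U.restrict (Set.Ici r)ᶜ)) (W := U)
        (Equiv.Set.sumCompl (Set.Ici r)) ?_ ?_
      · rintro (⟨x, hx⟩ | ⟨x, hx⟩) (⟨y, hy⟩ | ⟨y, hy⟩)
        · exact (Sum.inl_le_inl_iff (a := (⟨x, hx⟩ : Set.Ici r)) (b := ⟨y, hy⟩)).symm
        · refine iff_of_false (fun h : x ≤ y => hy (le_trans (Set.mem_Ici.1 hx) h)) Sum.not_inl_le_inr
        · refine iff_of_false (fun h : x ≤ y => hx ?_) Sum.not_inr_le_inl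
          rcases U.chain y x r h hy with h1 | h1
          · exact hr h1
          · exact h1
        · exact (Sum.inr_le_inr_iff (a := (⟨x, hx⟩ : ((Set.Ici r)ᶜ : Set U.V))) (b := ⟨y, hy⟩)).symm
      · rintro (x | x) <;> rfl
    have hlt : Nat.card (U.restrict (Set.Ici r)ᶜ).V < n := by
      rw [← hn]
      change Nat.card ↥(Set.Ici r)ᶜ < _
      rw [Nat.card_coe_set_eq]
      exact Set.ncard_lt_card fun h => absurd (h ▸ Set.mem_univ r : r ∈ (Set.Ici r)ᶜ) (by simp)
    conv_lhs => rw [key]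
    rw [trees_mul, Multiset.map_add, Multiset.prod_add, ih _ hlt _ rfl]
    have := trees_tree (treeAt U r)
    change trees (mk (U.restrict (Set.Ici r))) = _ at this
    rw [this, key]
    simp
    rfl

end Forest

section Transport

theorem coassoc_of_equiv {K C D : Type*} [CommRing K] [AddCommGroup C] [Module K C]
    [AddCommGroup D] [Module K D] [Coalgebra K D] (f : C →ₗ[K] D) (g : D →ₗ[K] C)
    (hgf : g ∘ₗ f = LinearMap.id) (Δ : C →ₗ[K] C ⊗[K] C)
    (hΔ : TensorProduct.map f f ∘ₗ Δ = Coalgebra.comul ∘ₗ f) :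
    (TensorProduct.assoc K C C C).toLinearMap ∘ₗ Δ.rTensor C ∘ₗ Δ = Δ.lTensor C ∘ₗ Δ := by
  have h1 : TensorProduct.map f (TensorProduct.map f f) ∘ₗ (TensorProduct.assoc K C C C).toLinearMap =
      (TensorProduct.assoc K D D D).toLinearMap ∘ₗ TensorProduct.map (TensorProduct.map f f) f := by
    ext; simp
  have h2 : TensorProduct.map (TensorProduct.map f f) f ∘ₗ Δ.rTensor C =
      LinearMap.rTensor D Coalgebra.comul ∘ₗ TensorProduct.map f f := by
    rw [LinearMap.rTensor, LinearMap.rTensor, ← TensorProduct.map_comp, ← TensorProduct.map_comp, hΔ,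
      LinearMap.comp_id, LinearMap.id_comp]
  have h3 : TensorProduct.map f (TensorProduct.map f f) ∘ₗ Δ.lTensor C =
      LinearMap.lTensor D Coalgebra.comul ∘ₗ TensorProduct.map f f := by
    rw [LinearMap.lTensor, LinearMap.lTensor, ← TensorProduct.map_comp, ← TensorProduct.map_comp, hΔ,
      LinearMap.comp_id, LinearMap.id_comp]
  have h4 : TensorProduct.map f (TensorProduct.map f f) ∘ₗ
      (TensorProduct.assoc K C C C).toLinearMap ∘ₗ Δ.rTensor C ∘ₗ Δ =
      TensorProduct.map f (TensorProduct.map f f) ∘ₗ Δ.lTensor C ∘ₗ Δ := by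
    rw [← LinearMap.comp_assoc, h1, LinearMap.comp_assoc, ← LinearMap.comp_assoc _ (Δ.rTensor C), h2,
      LinearMap.comp_assoc, hΔ, ← LinearMap.comp_assoc (f := Δ), h3, LinearMap.comp_assoc, hΔ,
      ← LinearMap.comp_assoc _ _ (LinearMap.lTensor D Coalgebra.comul), ← Coalgebra.coassoc]
    simp only [LinearMap.comp_assoc]
  have h5 : TensorProduct.map g (TensorProduct.map g g) ∘ₗ TensorProduct.map f (TensorProduct.map f f) =
      LinearMap.id := by
    rw [← TensorProduct.map_comp, ← TensorProduct.map_comp, hgf, TensorProduct.map_id,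
      TensorProduct.map_id]
  have h6 := congrArg (fun h => TensorProduct.map g (TensorProduct.map g g) ∘ₗ h) h4
  simpa only [← LinearMap.comp_assoc, h5, LinearMap.id_comp] using h6

variable {K H H' : Type*} [CommRing K] [CommRing H] [CommRing H'] [Algebra K H] [Bialgebra K H']

/-- An algebra homomorphism that corresponds to the coproduct of a bialgebra under an algebra
isomorphism is the coproduct of a bialgebra. -/
@[reducible] noncomputable def bialgebraOfEquiv (e : H ≃ₐ[K] H') (Δ : H →ₐ[K] H ⊗[K] H)
    (ε : H →ₐ[K] K)
    (hΔ : TensorProduct.map e.toLinearMap e.toLinearMap ∘ₗ Δ.toLinearMap =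
      Coalgebra.comul ∘ₗ e.toLinearMap)
    (hε : Coalgebra.counit ∘ₗ e.toLinearMap = ε.toLinearMap) : Bialgebra K H :=
  letI : Coalgebra K H :=
    { comul := Δ.toLinearMap
      counit := ε.toLinearMap
      coassoc := coassoc_of_equiv e.toLinearMap e.symm.toLinearMap (by ext; simp) _ hΔ
      rTensor_counit_comp_comul := by
        have h1 : LinearMap.lTensor K e.toLinearMap ∘ₗ ε.toLinearMap.rTensor H =
            LinearMap.rTensor H' Coalgebra.counit ∘ₗ TensorProduct.map e.toLinearMap e.toLinearMap := by
          rw [← hε, LinearMap.lTensor, LinearMap.rTensor, LinearMap.rTensor, ← TensorProduct.map_comp,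
            ← TensorProduct.map_comp, LinearMap.comp_id, LinearMap.id_comp, LinearMap.id_comp]
        ext x
        apply (LinearEquiv.lTensor K e.toLinearEquiv).injective
        change (LinearMap.lTensor K e.toLinearMap ∘ₗ ε.toLinearMap.rTensor H ∘ₗ Δ.toLinearMap) x = _
        rw [← LinearMap.comp_assoc, h1, LinearMap.comp_assoc, hΔ]
        simp
      lTensor_counit_comp_comul := by
        have h1 : LinearMap.rTensor K e.toLinearMap ∘ₗ ε.toLinearMap.lTensor H =
            LinearMap.lTensor H' Coalgebra.counit ∘ₗ TensorProduct.map e.toLinearMap e.toLinearMap := by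
          rw [← hε, LinearMap.lTensor, LinearMap.rTensor, LinearMap.lTensor, ← TensorProduct.map_comp,
            ← TensorProduct.map_comp, LinearMap.comp_id, LinearMap.id_comp, LinearMap.id_comp]
        ext x
        apply (LinearEquiv.rTensor K e.toLinearEquiv).injective
        change (LinearMap.rTensor K e.toLinearMap ∘ₗ ε.toLinearMap.lTensor H ∘ₗ Δ.toLinearMap) x = _
        rw [← LinearMap.comp_assoc, h1, LinearMap.comp_assoc, hΔ]
        simp }
  .mk' K H (map_one ε) (map_mul ε _ _) (map_one Δ) (map_mul Δ _ _)

end Transport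

/-- `H_CK(A) = Sym(K T(A))` as an algebra: polynomials in the `A`-labelled rooted trees. -/
def HCK (K : Type*) [CommRing K] (A : Type u) : Type _ := MvPolynomial (Tree A) K

/-- The non-trivial admissible cuts: non-empty sets of edges such that each path starting at a root
meets at most one of them. An edge is identified with its endpoint farther from the root, which can
be any vertex that is not a root. -/
def AdmissibleCut {A : Type u} (U : ForestPoset A) : Type :=
  {c : Set U.V // c.Nonempty ∧ (∀ v ∈ c, ¬ IsMin v) ∧ IsAntichain (· ≤ ·) c}

instance {A : Type u} (U : ForestPoset A) : Finite (AdmissibleCut U) := Subtype.finite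

namespace AdmissibleCut

variable {A : Type u} {U : ForestPoset A}

/-- The vertices cut off from the roots. -/
def pruned (c : AdmissibleCut U) : Set U.V := {x | ∃ v ∈ c.1, v ≤ x}

/-- `P_c`: the forest that is cut off. -/
def P (c : AdmissibleCut U) : Forest A := Forest.mk (U.restrict c.pruned)

/-- `R_c`: the part that contains the roots. -/
def R (c : AdmissibleCut U) : Forest A := Forest.mk (U.restrict c.prunedᶜ)

end AdmissibleCut

namespace HCK

open Forest

variable (K : Type*) [CommRing K] (A : Type u)

noncomputable instance : CommRing (HCK K A) := inferInstanceAs (CommRing (MvPolynomial (Tree A) K))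
noncomputable instance : Algebra K (HCK K A) :=
  inferInstanceAs (Algebra K (MvPolynomial (Tree A) K))

variable {A}

/-- A rooted tree, as a generator. -/
noncomputable def X (t : Tree A) : HCK K A := MvPolynomial.X t

variable {K} in
/-- The algebra homomorphism determined by its values on rooted trees. -/
noncomputable def lift {B : Type*} [CommRing B] [Algebra K B] (f : Tree A → B) : HCK K A →ₐ[K] B :=
  MvPolynomial.aeval f

@[simp] theorem lift_X {B : Type*} [CommRing B] [Algebra K B] (f : Tree A → B) (t : Tree A) :
    lift f (X K t) = f t := MvPolynomial.aeval_X f t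

variable {K} in
theorem hom_ext {B : Type*} [CommRing B] [Algebra K B] {f g : HCK K A →ₐ[K] B}
    (h : ∀ t, f (X K t) = g (X K t)) : f = g := MvPolynomial.algHom_ext h

/-- A forest, as the monomial in its trees. -/
noncomputable def monomial (u : Forest A) : HCK K A := ((trees u).map (X K)).prod

/-- `∑ P_c ⊗ R_c` over the non-trivial admissible cuts. -/
noncomputable def cutSum (U : ForestPoset A) : HCK K A ⊗[K] HCK K A :=
  (family fun c : AdmissibleCut U => monomial K c.P ⊗ₜ[K] monomial K c.R).sum

theorem cutSum_congr {U W : ForestPoset A} (h : U.Iso W) : cutSum K U = cutSum K W := by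
  obtain ⟨e, he⟩ := h
  let E : AdmissibleCut U ≃ AdmissibleCut W :=
    (Equiv.Set.congr e.toEquiv).subtypeEquiv fun c => by
      change _ ↔ (e '' c).Nonempty ∧ (∀ v ∈ e '' c, ¬ IsMin v) ∧ IsAntichain (· ≤ ·) (e '' c)
      rw [Set.image_nonempty]
      refine and_congr Iff.rfl (and_congr ?_ ?_)
      · rw [Set.forall_mem_image]
        exact forall₂_congr fun v _ => not_congr (OrderIso.isMin_apply e).symm
      · exact (IsAntichain.image_embedding_iff (φ := e.toOrderEmbedding)).symm
  have key : ∀ c : AdmissibleCut U, ∀ x, x ∈ c.pruned ↔ e x ∈ (E c).pruned := by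
    intro c x
    constructor
    · rintro ⟨v, hv, hvx⟩
      exact ⟨e v, ⟨v, hv, rfl⟩, e.le_iff_le.2 hvx⟩
    · rintro ⟨_, ⟨v, hv, rfl⟩, hvx⟩
      exact ⟨v, hv, e.le_iff_le.1 hvx⟩
  refine congrArg Multiset.sum (family_congr_equiv E fun c => ?_)
  have h1 : c.P = (E c).P := mk_restrict_congr e he _ _ (key c)
  have h2 : c.R = (E c).R := mk_restrict_congr e he _ _ fun x => not_congr (key c x)
  rw [h1, h2]

variable (A)

/-- The coproduct: the algebra homomorphism with
`Δ(t) = t ⊗ 1 + 1 ⊗ t + ∑ P_c(t) ⊗ R_c(t)` for each rooted tree `t`. -/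
noncomputable def comulHom : HCK K A →ₐ[K] HCK K A ⊗[K] HCK K A :=
  lift fun t => X K t ⊗ₜ[K] 1 + 1 ⊗ₜ[K] X K t +
    Forest.lift (cutSum K) (fun _ _ h => cutSum_congr K h) t.toForest

/-- The counit: `ε(t) = 0` for each rooted tree `t`. -/
noncomputable def counitHom : HCK K A →ₐ[K] K := lift fun _ => 0

variable {A} in
/-- A forest, as the monomial in its trees. -/
noncomputable def monomialHom : Forest A →* HCK K A where
  toFun := monomial K
  map_one' := by simp [monomial, trees_one]
  map_mul' u v := by simp [monomial, trees_mul]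

variable {A} in
theorem monomialHom_apply (u : Forest A) : monomialHom K u = ((trees u).map (X K)).prod := rfl

/-- Both `H_CK(A)` and `K[T(A)]` have the forests as a basis. -/
noncomputable def equivKT : HCK K A ≃ₐ[K] KT K A :=
  AlgEquiv.ofAlgHom (lift fun t => SplitAlgebra.of K t.toForest) (SplitAlgebra.lift (monomialHom K))
    (SplitAlgebra.hom_ext fun u => by
      simp only [AlgHom.comp_apply, SplitAlgebra.lift_of, monomialHom_apply,
        map_multiset_prod, Multiset.map_map, AlgHom.id_apply]
      conv_rhs => rw [← prod_trees u, map_multiset_prod, Multiset.map_map]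
      simp [Function.comp_def])
    (hom_ext fun t => by
      simp [monomialHom_apply, trees_tree])

theorem equivKT_X (t : Tree A) : equivKT K A (X K t) = SplitAlgebra.of K t.toForest :=
  lift_X K _ t

theorem equivKT_symm_of (u : Forest A) :
    (equivKT K A).symm (SplitAlgebra.of K u) = monomial K u :=
  SplitAlgebra.lift_of (monomialHom K) u

theorem equivKT_monomial (u : Forest A) : equivKT K A (monomial K u) = SplitAlgebra.of K u := by
  rw [← equivKT_symm_of, AlgEquiv.apply_symm_apply]

variable {A} in
theorem splitPoset_tree (U : ForestPoset A) (r : U.V) (hr : ∀ x, r ≤ x) :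
    splitPoset U = (mk U, 1) ::ₘ (1, mk U) ::ₘ family fun c : AdmissibleCut U => (c.P, c.R) := by
  let f : {s : Set U.V // IsLowerSet s} → Forest A × Forest A :=
    fun s => (mk (U.restrict s.1ᶜ), mk (U.restrict s.1))
  let s₀ : {s : Set U.V // IsLowerSet s} := ⟨∅, isLowerSet_empty⟩
  let s₁ : {s : {s : Set U.V // IsLowerSet s} // s ≠ s₀} := ⟨⟨Set.univ, isLowerSet_univ⟩,
    fun h => by
      have h : Set.univ = (∅ : Set U.V) := congrArg Subtype.val h
      have hr : r ∈ (∅ : Set U.V) := h ▸ Set.mem_univ r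
      exact hr⟩
  have h0 : f s₀ = (mk U, 1) :=
    Prod.ext (mk_restrict_univ U ∅ᶜ fun _ => id) (mk_eq_one.2 ⟨fun x => x.2⟩)
  have h1 : f s₁ = (1, mk U) :=
    Prod.ext (mk_eq_one.2 ⟨fun x => x.2 trivial⟩) (mk_restrict_univ U Set.univ fun _ => trivial)
  have hmin : IsMin r := fun x _ => hr x
  change family f = _
  rw [family_eq_cons f s₀, family_eq_cons _ s₁, h0, h1]
  congr 2
  symm
  let g : AdmissibleCut U → {s : {s : {s : Set U.V // IsLowerSet s} // s ≠ s₀} // s ≠ s₁} := fun c =>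
    ⟨⟨⟨c.prunedᶜ, fun a b hba ha ⟨v, hv, hvb⟩ => ha ⟨v, hv, le_trans hvb hba⟩⟩, fun h => by
      have h' : c.prunedᶜ = ∅ := congrArg Subtype.val h
      have hrm : r ∈ c.prunedᶜ := fun ⟨v, hv, hvr⟩ =>
        c.2.2.1 v hv (fun x hx => le_trans (hvr.trans (hr x)) le_rfl)
      simp [h'] at hrm⟩, fun h => by
      have h' : c.prunedᶜ = Set.univ := congrArg (fun s => s.1.1) h
      obtain ⟨v, hv⟩ := c.2.1
      have : v ∈ c.prunedᶜ := h' ▸ Set.mem_univ v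
      exact this ⟨v, hv, le_rfl⟩⟩
  have hinj : ∀ c c' : AdmissibleCut U, c.pruned = c'.pruned → c.1 ⊆ c'.1 := by
    intro c c' h v hv
    obtain ⟨v', hv', h1⟩ : v ∈ c'.pruned := h ▸ ⟨v, hv, le_rfl⟩
    obtain ⟨v'', hv'', h2⟩ : v' ∈ c.pruned := h ▸ ⟨v', hv', le_rfl⟩
    have h3 : v'' = v := by
      by_contra hne
      exact c.2.2.2 hv'' hv hne (h2.trans h1)
    have h4 : v' = v := le_antisymm h1 (h3 ▸ h2)
    exact h4 ▸ hv'
  have hg : Function.Bijective g := by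
    constructor
    · intro c c' h
      have h : c.prunedᶜ = c'.prunedᶜ := congrArg (fun s => s.1.1.1) h
      have h := compl_injective h
      exact Subtype.ext (Set.Subset.antisymm (hinj c c' h) (hinj c' c h.symm))
    · rintro ⟨⟨⟨s, hs⟩, hs0⟩, hs1⟩
      have hexists : ∀ x ∉ s, ∃ v, (v ∉ s ∧ ∀ y, y < v → y ∈ s) ∧ v ≤ x := by
        intro x hx
        obtain ⟨v, hv, hv'⟩ := (Set.toFinite {y | y ∉ s ∧ y ≤ x}).exists_minimal ⟨x, hx, le_rfl⟩
        refine ⟨v, ⟨hv.1, fun y hy => by_contra fun hys => ?_⟩, hv.2⟩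
        exact absurd (hv' ⟨hys, hy.le.trans hv.2⟩ hy.le) (not_le_of_gt hy)
      have hrs : r ∈ s := by
        by_contra h
        apply hs0
        apply Subtype.ext
        exact Set.eq_empty_of_forall_notMem fun x hx => h (hs (hr x) hx)
      have hne : ∃ x, x ∉ s := by
        by_contra h
        push Not at h
        exact hs1 (Subtype.ext (Subtype.ext (Set.eq_univ_of_forall h)))
      refine ⟨⟨{v | v ∉ s ∧ ∀ y, y < v → y ∈ s}, ?_, ?_, ?_⟩, ?_⟩
      · obtain ⟨x, hx⟩ := hne
        obtain ⟨v, hv, -⟩ := hexists x hx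
        exact ⟨v, hv⟩
      · intro v hv hmv
        exact hv.1 (hs (hmv (hr v)) hrs)
      · intro v hv w hw hvw hle
        exact hv.1 (hw.2 v (lt_of_le_of_ne hle hvw))
      · apply Subtype.ext
        apply Subtype.ext
        apply Subtype.ext
        ext x
        constructor
        · intro hx
          by_contra hxs
          obtain ⟨v, hv, hvx⟩ := hexists x hxs
          exact hx ⟨v, hv, hvx⟩
        · rintro hx ⟨v, hv, hvx⟩
          exact hv.1 (hs hvx hx)
  refine family_congr_equiv (Equiv.ofBijective g hg) fun c => ?_
  change (mk (U.restrict c.prunedᶜᶜ), mk (U.restrict c.prunedᶜ)) = (c.P, c.R)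
  rw [compl_compl]
  rfl

theorem map_comulHom :
    (Algebra.TensorProduct.map (equivKT K A).toAlgHom (equivKT K A).toAlgHom).comp (comulHom K A) =
      (Bialgebra.comulAlgHom K (KT K A)).comp (equivKT K A).toAlgHom := by
  apply hom_ext
  intro t
  obtain ⟨U, r, hr, hU⟩ := t.exists_rep
  change Algebra.TensorProduct.map (equivKT K A).toAlgHom (equivKT K A).toAlgHom
      (lift _ (X K t)) = Coalgebra.comul (R := K) (equivKT K A (X K t))
  rw [lift_X, equivKT_X, SplitAlgebra.comul_of, hU]
  change Algebra.TensorProduct.map (equivKT K A).toAlgHom (equivKT K A).toAlgHom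
    (_ + _ + cutSum K U) = ((splitPoset U).map _).sum
  rw [splitPoset_tree U r hr, cutSum, map_add, map_add, map_multiset_sum, map_family,
    Multiset.map_cons, Multiset.map_cons, Multiset.sum_cons, Multiset.sum_cons, map_family,
    ← add_assoc]
  simp only [Algebra.TensorProduct.map_tmul, map_one]
  change equivKT K A (X K t) ⊗ₜ[K] 1 + 1 ⊗ₜ[K] equivKT K A (X K t) +
    (family fun a : AdmissibleCut U => equivKT K A (monomial K a.P) ⊗ₜ[K]
      equivKT K A (monomial K a.R)).sum = _
  simp only [equivKT_monomial, equivKT_X, hU]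

theorem counit_comp :
    (Bialgebra.counitAlgHom K (KT K A)).comp (equivKT K A).toAlgHom = counitHom K A := by
  apply hom_ext
  intro t
  obtain ⟨U, r, hr, hU⟩ := t.exists_rep
  change Coalgebra.counit (R := K) (equivKT K A (X K t)) = lift _ (X K t)
  rw [lift_X, equivKT_X, SplitAlgebra.counit_of, if_neg]
  intro h
  exact (mk_eq_one.1 (hU ▸ h)).elim r

noncomputable instance : Bialgebra K (HCK K A) :=
  bialgebraOfEquiv (equivKT K A) (comulHom K A) (counitHom K A)
    (congrArg AlgHom.toLinearMap (map_comulHom K A)) (congrArg AlgHom.toLinearMap (counit_comp K A))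

theorem comul_X (t : Tree A) : Coalgebra.comul (R := K) (X K t) =
    X K t ⊗ₜ[K] 1 + 1 ⊗ₜ[K] X K t +
      Forest.lift (cutSum K) (fun _ _ h => cutSum_congr K h) t.toForest := lift_X K _ t

theorem counit_X (t : Tree A) : Coalgebra.counit (R := K) (X K t) = 0 := lift_X K _ t

theorem comul_monomial (u : Forest A) : Coalgebra.comul (R := K) (monomial K u) =
    ((SplitMonoid.split u).map fun p => monomial K p.1 ⊗ₜ[K] monomial K p.2).sum := by
  have h : TensorProduct.map (equivKT K A).toLinearMap (equivKT K A).toLinearMap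
      (Coalgebra.comul (R := K) (monomial K u)) =
      Coalgebra.comul (R := K) (equivKT K A (monomial K u)) :=
    AlgHom.congr_fun (map_comulHom K A) (monomial K u)
  rw [equivKT_monomial, SplitAlgebra.comul_of] at h
  apply (TensorProduct.congr (equivKT K A).toLinearEquiv (equivKT K A).toLinearEquiv).injective
  refine h.trans ?_
  rw [map_multiset_sum, Multiset.map_map]
  refine congrArg Multiset.sum (Multiset.map_congr rfl fun p _ => ?_)
  change _ = equivKT K A (monomial K p.1) ⊗ₜ[K] equivKT K A (monomial K p.2)
  rw [equivKT_monomial, equivKT_monomial]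

noncomputable instance : HopfAlgebra K (HCK K A) :=
  hopfOfExists (by
    obtain ⟨deg, h1, h2⟩ := SplitMonoid.exists_deg (M := Forest A)
    refine exists_antipode (monomial K) deg ?_ (fun m => ?_) (fun m hm => ?_)
    · have : Set.range (monomial K (A := A)) =
          (equivKT K A).symm.toLinearMap '' Set.range (SplitAlgebra.of K (M := Forest A)) := by
        rw [← Set.range_comp]
        congr 1
        ext u
        exact (equivKT_symm_of K A u).symm
      rw [this, Submodule.span_image, SplitAlgebra.span_of, Submodule.map_top, LinearMap.range_eq_top]
      exact (equivKT K A).symm.surjective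
    · rw [comul_monomial]
      refine multiset_sum_mem _ fun z hz => ?_
      obtain ⟨p, hp, rfl⟩ := Multiset.mem_map.1 hz
      exact Submodule.subset_span ⟨p.1, p.2, h2 m p hp, rfl⟩
    · rw [h1 m hm]
      have : monomial K (1 : Forest A) = 1 := map_one (monomialHom K)
      simp [this])

end HCK

/-! ### Quasi-shuffle Hopf algebras -/

/-- A Hoffman pairing on a graded set `A`: a commutative and associative operation on `A ∪ {0}` with
absorbing element `0` that adds degrees wherever it does not take the value `0`. -/
structure HoffmanPairing (A : Type u) (deg : A → ℕ) where
  op : WithZero A → WithZero A → WithZero A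
  op_zero : ∀ a, op a 0 = 0
  op_comm : ∀ a b, op a b = op b a
  op_assoc : ∀ a b c, op (op a b) c = op a (op b c)
  deg_op : ∀ a b c : A, op a b = (c : WithZero A) → deg c = deg a + deg b

/-- `K⟨A⟩` with the quasi-shuffle structure: the vector space of the words in the alphabet `A`. -/
def QSh (K : Type*) [CommRing K] {A : Type u} {deg : A → ℕ} (_br : HoffmanPairing A deg) : Type _ :=
  List A →₀ K

namespace QSh

variable (K : Type*) [CommRing K] {A : Type u} {deg : A → ℕ} (br : HoffmanPairing A deg)

noncomputable instance : AddCommGroup (QSh K br) := inferInstanceAs (AddCommGroup (List A →₀ K))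
noncomputable instance : Module K (QSh K br) := inferInstanceAs (Module K (List A →₀ K))

/-- A word, as a basis element. -/
noncomputable def word (w : List A) : QSh K br := Finsupp.single w (1 : K)

variable {K br} in
/-- The linear map determined by its values on words. -/
noncomputable def linLift {B : Type*} [AddCommGroup B] [Module K B] (f : List A → B) :
    QSh K br →ₗ[K] B := Finsupp.linearCombination K f

@[simp] theorem linLift_word {B : Type*} [AddCommGroup B] [Module K B] (f : List A → B)
    (w : List A) : linLift f (word K br w) = f w := by
  refine (Finsupp.linearCombination_single K (1 : K) w).trans ?_
  simp

variable {K br} in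
theorem lin_ext {B : Type*} [AddCommGroup B] [Module K B] {f g : QSh K br →ₗ[K] B}
    (h : ∀ w, f (word K br w) = g (word K br w)) : f = g :=
  Finsupp.lhom_ext' fun w => LinearMap.ext_ring (h w)

theorem span_word : Submodule.span K (Set.range (word K br)) = ⊤ := by
  rw [eq_top_iff]
  have h : (Submodule.span K (Set.range (word K br))).mkQ = 0 := lin_ext fun w => by
    simpa using Submodule.subset_span (Set.mem_range_self w)
  intro x _
  simpa using LinearMap.congr_fun h x

/-- Putting a letter, or `0`, in front: `w ↦ a w`, respectively `w ↦ 0`. -/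
noncomputable def consMap (a : WithZero A) : QSh K br →ₗ[K] QSh K br :=
  linLift fun w => Option.elim a 0 fun x => word K br (x :: w)

@[simp] theorem consMap_coe (a : A) (w : List A) :
    consMap K br a (word K br w) = word K br (a :: w) := linLift_word K br _ w

@[simp] theorem consMap_zero : consMap K br 0 = 0 := lin_ext fun w => linLift_word K br _ w

/-- The quasi-shuffle product of words: `1 ⋆ w = w ⋆ 1 = w` and
`a w₁ ⋆ b w₂ = a (w₁ ⋆ b w₂) + b (a w₁ ⋆ w₂) + [a, b] (w₁ ⋆ w₂)`. -/
noncomputable def mulWord : List A → List A → QSh K br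
  | [], w => word K br w
  | a :: w₁, [] => word K br (a :: w₁)
  | a :: w₁, b :: w₂ => consMap K br a (mulWord w₁ (b :: w₂)) + consMap K br b (mulWord (a :: w₁) w₂) +
      consMap K br (br.op a b) (mulWord w₁ w₂)
termination_by w₁ w₂ => w₁.length + w₂.length

/-- The quasi-shuffle product, extended bilinearly. -/
noncomputable def mulLin : QSh K br →ₗ[K] QSh K br →ₗ[K] QSh K br :=
  linLift fun w₁ => linLift fun w₂ => mulWord K br w₁ w₂

noncomputable instance : Mul (QSh K br) := ⟨fun x y => mulLin K br x y⟩
noncomputable instance : One (QSh K br) := ⟨word K br []⟩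

variable {K br}

theorem mul_def (x y : QSh K br) : x * y = mulLin K br x y := rfl
theorem one_def : (1 : QSh K br) = word K br [] := rfl

theorem word_mul (w₁ w₂ : List A) : word K br w₁ * word K br w₂ = mulWord K br w₁ w₂ := by
  rw [mul_def, mulLin, linLift_word, linLift_word]

theorem mul_add' (x y z : QSh K br) : x * (y + z) = x * y + x * z := map_add _ _ _
theorem add_mul' (x y z : QSh K br) : (x + y) * z = x * z + y * z := by
  simp only [mul_def, map_add, LinearMap.add_apply]

theorem one_mul' (x : QSh K br) : 1 * x = x := by
  have : mulLin K br 1 = LinearMap.id := lin_ext fun w => by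
    change 1 * word K br w = _
    rw [one_def, word_mul]
    cases w <;> simp [mulWord]
  exact LinearMap.congr_fun this x

theorem mul_one' (x : QSh K br) : x * 1 = x := by
  have : (mulLin K br).flip 1 = LinearMap.id := lin_ext fun w => by
    change word K br w * 1 = _
    rw [one_def, word_mul]
    cases w <;> simp [mulWord]
  exact LinearMap.congr_fun this x

theorem zero_op (a : WithZero A) : br.op 0 a = 0 := by rw [br.op_comm, br.op_zero]

theorem cons_mul_cons (a b : WithZero A) (x y : QSh K br) :
    consMap K br a x * consMap K br b y = consMap K br a (x * consMap K br b y) +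
      consMap K br b (consMap K br a x * y) + consMap K br (br.op a b) (x * y) := by
  have h0 : ∀ z : QSh K br, 0 * z = 0 := fun z => by simp [mul_def]
  have h0' : ∀ z : QSh K br, z * 0 = 0 := fun z => by simp [mul_def]
  induction a with
  | zero => simp [zero_op, h0]
  | coe a =>
  induction b with
  | zero => simp [br.op_zero, h0']
  | coe b =>
  have : (mulLin K br).compl₁₂ (consMap K br a) (consMap K br b) =
      (((mulLin K br).compl₂ (consMap K br b)).compr₂ (consMap K br a)) +
      (((mulLin K br).comp (consMap K br a)).compr₂ (consMap K br b)) +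
      ((mulLin K br).compr₂ (consMap K br (br.op a b))) := by
    refine lin_ext fun w₁ => lin_ext fun w₂ => ?_
    simp only [LinearMap.compl₁₂_apply, LinearMap.add_apply, LinearMap.compr₂_apply,
      LinearMap.compl₂_apply, LinearMap.comp_apply, consMap_coe, ← mul_def, word_mul]
    rw [mulWord]
  exact LinearMap.congr_fun₂ this x y

theorem mul_comm' (x y : QSh K br) : x * y = y * x := by
  have hw : ∀ n, ∀ w₁ w₂ : List A, w₁.length + w₂.length = n →
      word K br w₁ * word K br w₂ = word K br w₂ * word K br w₁ := by
    intro n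
    induction n using Nat.strong_induction_on with
    | _ n ih =>
    replace ih := fun u v h => ih _ h u v rfl
    rintro (_ | ⟨a, w₁⟩) (_ | ⟨b, w₂⟩) hn
    · rfl
    · rw [← one_def, one_mul', mul_one']
    · rw [← one_def, one_mul', mul_one']
    · simp only [List.length_cons] at hn
      simp only [← consMap_coe, cons_mul_cons] at *
      rw [br.op_comm b a]
      have h1 := ih w₁ w₂ (by omega)
      have h2 := ih w₁ (b :: w₂) (by simp; omega)
      have h3 := ih (a :: w₁) w₂ (by simp; omega)
      simp only [← consMap_coe] at h2 h3
      rw [h1, h2, h3]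
      abel
  have : mulLin K br = (mulLin K br).flip := lin_ext fun w₁ => lin_ext fun w₂ => hw _ w₁ w₂ rfl
  exact LinearMap.congr_fun₂ this x y

theorem cons_mul_mul (a b c : WithZero A) (x y z : QSh K br) :
    consMap K br a x * consMap K br b y * consMap K br c z =
      consMap K br a (x * consMap K br b y * consMap K br c z) +
      consMap K br b (consMap K br a x * y * consMap K br c z) +
      consMap K br c (consMap K br a x * consMap K br b y * z) +
      consMap K br (br.op a b) (x * y * consMap K br c z) +
      consMap K br (br.op a c) (x * consMap K br b y * z) +
      consMap K br (br.op b c) (consMap K br a x * y * z) +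
      consMap K br (br.op (br.op a b) c) (x * y * z) := by
  have h : consMap K br c (consMap K br a x * consMap K br b y * z) =
      consMap K br c (consMap K br a (x * consMap K br b y) * z) +
      consMap K br c (consMap K br b (consMap K br a x * y) * z) +
      consMap K br c (consMap K br (br.op a b) (x * y) * z) := by
    rw [← map_add, ← map_add, ← add_mul', ← add_mul', ← cons_mul_cons]
  rw [h, cons_mul_cons a b, add_mul', add_mul', cons_mul_cons _ c, cons_mul_cons _ c,
    cons_mul_cons _ c]
  abel

theorem mul_assoc' (x y z : QSh K br) : x * y * z = x * (y * z) := by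
  have hw : ∀ n, ∀ w₁ w₂ w₃ : List A, w₁.length + w₂.length + w₃.length = n →
      word K br w₁ * word K br w₂ * word K br w₃ = word K br w₁ * (word K br w₂ * word K br w₃) := by
    intro n
    induction n using Nat.strong_induction_on with
    | _ n ih =>
    replace ih := fun u v w h => ih _ h u v w rfl
    rintro (_ | ⟨a, w₁⟩) (_ | ⟨b, w₂⟩) (_ | ⟨c, w₃⟩) hn
    on_goal 8 =>
      simp only [List.length_cons] at hn
      have h1 := ih w₁ (b :: w₂) (c :: w₃) (by simp; omega)
      have h2 := ih (a :: w₁) w₂ (c :: w₃) (by simp; omega)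
      have h3 := ih (a :: w₁) (b :: w₂) w₃ (by simp; omega)
      have h4 := ih w₁ w₂ (c :: w₃) (by simp; omega)
      have h5 := ih w₁ (b :: w₂) w₃ (by simp; omega)
      have h6 := ih (a :: w₁) w₂ w₃ (by simp; omega)
      have h7 := ih w₁ w₂ w₃ (by omega)
      simp only [← consMap_coe] at h1 h2 h3 h4 h5 h6 ⊢
      have h8 := cons_mul_mul (br := br) b c a (word K br w₂) (word K br w₃) (word K br w₁)
      rw [mul_comm' _ (consMap K br a (word K br w₁))] at h8
      rw [cons_mul_mul, h8, h1, h2, h3, h4, h5, h6, h7, br.op_assoc,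
        br.op_comm (br.op b c), br.op_comm b a, br.op_comm c a]
      simp only [mul_comm' _ (word K br w₁), mul_comm' _ (consMap K br a (word K br w₁))]
      abel
    all_goals simp only [← one_def, one_mul', mul_one']
  have h1 : ∀ w₂ w₃ x, x * word K br w₂ * word K br w₃ = x * (word K br w₂ * word K br w₃) := by
    intro w₂ w₃
    refine LinearMap.congr_fun (f := (mulLin K br).flip (word K br w₃) ∘ₗ (mulLin K br).flip (word K br w₂))
      (g := (mulLin K br).flip (word K br w₂ * word K br w₃)) (lin_ext fun w₁ => hw _ w₁ w₂ w₃ rfl)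
  have h2 : ∀ x w₃ y, x * y * word K br w₃ = x * (y * word K br w₃) := by
    intro x w₃
    exact LinearMap.congr_fun (f := (mulLin K br).flip (word K br w₃) ∘ₗ mulLin K br x)
      (g := mulLin K br x ∘ₗ (mulLin K br).flip (word K br w₃)) (lin_ext fun w₂ => h1 w₂ w₃ x)
  exact LinearMap.congr_fun (f := mulLin K br (x * y)) (g := mulLin K br x ∘ₗ mulLin K br y)
    (lin_ext fun w₃ => h2 x w₃ y) z

noncomputable instance : CommRing (QSh K br) :=
  { (inferInstance : AddCommGroup (QSh K br)) with
    mul_assoc := mul_assoc'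
    one_mul := one_mul'
    mul_one := mul_one'
    left_distrib := mul_add'
    right_distrib := add_mul'
    mul_comm := mul_comm'
    zero_mul := fun x => by simp [mul_def]
    mul_zero := fun x => by simp [mul_def] }

noncomputable instance : Algebra K (QSh K br) :=
  Algebra.ofModule (fun r x y => by simp [mul_def]) (fun r x y => by simp [mul_def])

variable (K br)

/-- Deconcatenation: `Δ(w) = ∑ w₁ ⊗ w₂` over all `w = w₁ w₂`. -/
noncomputable def comulLin : QSh K br →ₗ[K] QSh K br ⊗[K] QSh K br :=
  linLift fun w => ∑ i ∈ Finset.range (w.length + 1),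
    word K br (w.take i) ⊗ₜ[K] word K br (w.drop i)

/-- The coefficient of the empty word. -/
noncomputable def counitLin : QSh K br →ₗ[K] K := linLift fun w => if w = [] then 1 else 0

theorem comul_one : comulLin K br 1 = 1 ⊗ₜ[K] 1 := by
  rw [one_def, comulLin, linLift_word]; simp

theorem comul_cons (a : WithZero A) (x : QSh K br) : comulLin K br (consMap K br a x) =
    1 ⊗ₜ[K] consMap K br a x + (consMap K br a).rTensor _ (comulLin K br x) := by
  induction a with
  | zero => simp
  | coe a =>
  have : comulLin K br ∘ₗ consMap K br a = TensorProduct.mk K _ _ 1 ∘ₗ consMap K br a +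
      (consMap K br a).rTensor _ ∘ₗ comulLin K br := lin_ext fun w => by
    simp only [LinearMap.comp_apply, LinearMap.add_apply, consMap_coe, TensorProduct.mk_apply]
    rw [comulLin, linLift_word, linLift_word, List.length_cons, Finset.sum_range_succ', map_sum,
      add_comm]
    simp [one_def]
  exact LinearMap.congr_fun this x

theorem counit_cons (a : WithZero A) (x : QSh K br) : counitLin K br (consMap K br a x) = 0 := by
  induction a with
  | zero => simp
  | coe a =>
  have : counitLin K br ∘ₗ consMap K br a = 0 := lin_ext fun w => by
    simp [counitLin]
  exact LinearMap.congr_fun this x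

theorem counit_one : counitLin K br 1 = 1 := by
  rw [one_def, counitLin, linLift_word]; simp

theorem comul_coassoc : (TensorProduct.assoc K _ _ _).toLinearMap ∘ₗ
    (comulLin K br).rTensor (QSh K br) ∘ₗ comulLin K br =
      (comulLin K br).lTensor (QSh K br) ∘ₗ comulLin K br := lin_ext fun w => by
  simp only [LinearMap.comp_apply]
  induction w with
  | nil => rw [← one_def, comul_one]; simp [comul_one]
  | cons a w ih =>
    rw [← consMap_coe]
    generalize word K br w = x at *
    have h1 : (TensorProduct.assoc K _ _ _).toLinearMap ∘ₗ (comulLin K br).rTensor (QSh K br) ∘ₗ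
          (consMap K br a).rTensor _ =
        TensorProduct.mk K (QSh K br) _ 1 ∘ₗ (consMap K br a).rTensor _ +
          (consMap K br a).rTensor _ ∘ₗ (TensorProduct.assoc K _ _ _).toLinearMap ∘ₗ
            (comulLin K br).rTensor _ := by
      refine TensorProduct.ext' fun p q => ?_
      simp only [LinearMap.comp_apply, LinearMap.add_apply, LinearMap.rTensor_tmul, comul_cons,
        TensorProduct.add_tmul, map_add, TensorProduct.mk_apply, LinearEquiv.coe_coe,
        TensorProduct.assoc_tmul]
      congr 1
      generalize comulLin K br p = z
      induction z with
      | zero => simp only [LinearMap.map_zero, LinearEquiv.map_zero, TensorProduct.zero_tmul]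
      | tmul p r => simp only [LinearMap.rTensor_tmul, TensorProduct.assoc_tmul]
      | add p r hp hr => simp only [map_add, hp, hr, TensorProduct.add_tmul]
    have h2 : (comulLin K br).lTensor (QSh K br) ∘ₗ (consMap K br a).rTensor _ =
        (consMap K br a).rTensor _ ∘ₗ (comulLin K br).lTensor _ := by
      rw [LinearMap.lTensor_comp_rTensor, LinearMap.rTensor_comp_lTensor]
    have h1 := LinearMap.congr_fun h1 (comulLin K br x)
    have h2 := LinearMap.congr_fun h2 (comulLin K br x)
    simp only [LinearMap.comp_apply, LinearMap.add_apply] at h1 h2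
    rw [comul_cons, map_add, map_add, map_add, h1, h2, ← ih]
    simp only [LinearMap.rTensor_tmul, LinearMap.lTensor_tmul, comul_one, comul_cons,
      TensorProduct.assoc_tmul, TensorProduct.tmul_add, LinearEquiv.coe_coe, TensorProduct.mk_apply]
    rw [add_assoc]

noncomputable instance : Coalgebra K (QSh K br) where
  comul := comulLin K br
  counit := counitLin K br
  coassoc := comul_coassoc K br
  rTensor_counit_comp_comul := lin_ext fun w => by
    simp only [LinearMap.comp_apply]
    rcases w with _ | ⟨a, w⟩
    · rw [← one_def, comul_one]; simp [counit_one]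
    · rw [← consMap_coe, comul_cons, map_add]
      have h : ∀ z, (counitLin K br).rTensor (QSh K br) ((consMap K br a).rTensor _ z) = 0 := by
        intro z
        induction z with
        | zero => simp
        | tmul p q => simp [counit_cons]
        | add p q hp hq => simp only [map_add, hp, hq, add_zero]
      rw [h]; simp [counit_one]
  lTensor_counit_comp_comul := lin_ext fun w => by
    simp only [LinearMap.comp_apply]
    induction w with
    | nil => rw [← one_def, comul_one]; simp [counit_one]
    | cons a w ih =>
      rw [← consMap_coe, comul_cons, map_add]
      have h : ∀ z, (counitLin K br).lTensor (QSh K br) ((consMap K br a).rTensor _ z) =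
          (consMap K br a).rTensor _ ((counitLin K br).lTensor _ z) := by
        intro z
        induction z with
        | zero => simp
        | tmul p q => simp
        | add p q hp hq => simp only [map_add, hp, hq]
      rw [h, ih, LinearMap.lTensor_tmul, counit_cons]; simp

theorem rTensor_cons_mul (a b : WithZero A) (p q : QSh K br ⊗[K] QSh K br) :
    (consMap K br a).rTensor _ p * (consMap K br b).rTensor _ q =
      (consMap K br a).rTensor _ (p * (consMap K br b).rTensor _ q) +
      (consMap K br b).rTensor _ ((consMap K br a).rTensor _ p * q) +
      (consMap K br (br.op a b)).rTensor _ (p * q) := by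
  induction p with
  | zero => simp
  | add p p' hp hp' => simp only [map_add, add_mul, hp, hp']; abel
  | tmul p₁ p₂ =>
  induction q with
  | zero => simp
  | add q q' hq hq' => simp only [map_add, mul_add, hq, hq']; abel
  | tmul q₁ q₂ =>
  simp only [LinearMap.rTensor_tmul, Algebra.TensorProduct.tmul_mul_tmul, cons_mul_cons,
    TensorProduct.add_tmul]

theorem rTensor_mul_one_tmul (a : WithZero A) (p : QSh K br ⊗[K] QSh K br) (s : QSh K br) :
    (consMap K br a).rTensor _ (p * (1 ⊗ₜ s)) = (consMap K br a).rTensor _ p * (1 ⊗ₜ s) := by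
  induction p with
  | zero => simp
  | add p p' hp hp' => simp only [map_add, add_mul, hp, hp']
  | tmul p₁ p₂ => simp

theorem comul_mul' (x y : QSh K br) : comulLin K br (x * y) = comulLin K br x * comulLin K br y := by
  have hw : ∀ n, ∀ w₁ w₂ : List A, w₁.length + w₂.length = n →
      comulLin K br (word K br w₁ * word K br w₂) =
        comulLin K br (word K br w₁) * comulLin K br (word K br w₂) := by
    intro n
    induction n using Nat.strong_induction_on with
    | _ n ih =>
    replace ih := fun u v h => ih _ h u v rfl
    rintro (_ | ⟨a, w₁⟩) (_ | ⟨b, w₂⟩) hn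
    · rw [← one_def, comul_one, one_mul, comul_one]; simp
    · rw [← one_def, comul_one, one_mul, ← Algebra.TensorProduct.one_def, one_mul]
    · rw [← one_def, comul_one, mul_one, ← Algebra.TensorProduct.one_def, mul_one]
    · simp only [List.length_cons] at hn
      have h1 := ih w₁ w₂ (by omega)
      have h2 := ih w₁ (b :: w₂) (by simp; omega)
      have h3 := ih (a :: w₁) w₂ (by simp; omega)
      simp only [← consMap_coe] at h2 h3 ⊢
      generalize word K br w₁ = x at *
      generalize word K br w₂ = y at *
      rw [cons_mul_cons, map_add, map_add, comul_cons, comul_cons, comul_cons, h1, h2, h3,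
        comul_cons, comul_cons, add_mul, add_mul, mul_add, mul_add, mul_add, map_add, map_add,
        rTensor_cons_mul, rTensor_mul_one_tmul, mul_comm (1 ⊗ₜ[K] (consMap K br a) x) (comulLin K br y),
        rTensor_mul_one_tmul, Algebra.TensorProduct.tmul_mul_tmul, mul_one, cons_mul_cons,
        TensorProduct.tmul_add, TensorProduct.tmul_add,
        mul_comm (1 ⊗ₜ[K] (consMap K br a) x)]
      abel
  have : (mulLin K br).compr₂ (comulLin K br) =
      (LinearMap.mul K (QSh K br ⊗[K] QSh K br)).compl₁₂ (comulLin K br) (comulLin K br) :=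
    lin_ext fun w₁ => lin_ext fun w₂ => hw _ w₁ w₂ rfl
  exact LinearMap.congr_fun₂ this x y

theorem counit_mul' (x y : QSh K br) :
    counitLin K br (x * y) = counitLin K br x * counitLin K br y := by
  have : (mulLin K br).compr₂ (counitLin K br) =
      (LinearMap.mul K K).compl₁₂ (counitLin K br) (counitLin K br) := by
    refine lin_ext fun w₁ => lin_ext fun w₂ => ?_
    change counitLin K br (word K br w₁ * word K br w₂) =
      counitLin K br (word K br w₁) * counitLin K br (word K br w₂)
    rcases w₁ with _ | ⟨a, w₁⟩
    · rw [← one_def, one_mul, counit_one, one_mul]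
    rcases w₂ with _ | ⟨b, w₂⟩
    · rw [← one_def, mul_one, counit_one, mul_one]
    · simp only [← consMap_coe, cons_mul_cons, map_add, counit_cons]; simp
  exact LinearMap.congr_fun₂ this x y

noncomputable instance : Bialgebra K (QSh K br) :=
  .mk' K (QSh K br) (counit_one K br) (counit_mul' K br _ _) (comul_one K br) (comul_mul' K br _ _)

theorem comul_word (w : List A) : Coalgebra.comul (R := K) (word K br w) =
    ∑ i ∈ Finset.range (w.length + 1), word K br (w.take i) ⊗ₜ[K] word K br (w.drop i) :=
  linLift_word K br _ w

noncomputable instance : HopfAlgebra K (QSh K br) :=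
  hopfOfExists (exists_antipode (word K br) List.length (span_word K br)
    (fun w => by
      rw [comul_word]
      refine Submodule.sum_mem _ fun i hi => Submodule.subset_span ⟨_, _, ?_, rfl⟩
      rw [← List.length_append, List.take_append_drop])
    (fun w hw => by
      rw [List.length_eq_zero_iff.1 hw, ← one_def]; simp))

end QSh

/-! ### Incidence Hopf algebras of intervals with coloured relations -/

section SubSplit

open SplitMonoid

/-- A submonoid that contains both parts of each decomposition of its elements. -/
@[reducible] noncomputable def subSplitMonoid {M : Type*} [CommMonoid M] [SplitMonoid M]
    (S : Submonoid M) (hS : ∀ x ∈ S, ∀ p ∈ split x, p.1 ∈ S ∧ p.2 ∈ S) : SplitMonoid S :=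
  let sp : S → Multiset (S × S) := fun x =>
    (split x.1).pmap (fun p h => (⟨p.1, h.1⟩, ⟨p.2, h.2⟩)) (hS x.1 x.2)
  have hsp : ∀ x : S, (sp x).map (Prod.map Subtype.val Subtype.val) = split x.1 := fun x => by
    simp only [sp, Multiset.map_pmap, Prod.map_apply, Multiset.pmap_eq_map, Multiset.map_id']
  have hinj : Function.Injective (Multiset.map (Prod.map (Subtype.val : S → M) (Subtype.val : S → M))) :=
    Multiset.map_injective (Prod.map_injective.2 ⟨Subtype.val_injective, Subtype.val_injective⟩)
  have hmem : ∀ x : S, ∀ p ∈ sp x, (p.1.1, p.2.1) ∈ split x.1 := fun x p hp => by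
    rw [← hsp x]; exact Multiset.mem_map_of_mem _ hp
  { split := sp
    split_one := hinj (by rw [hsp]; simp [split_one])
    split_mul := fun x y => hinj (by
      rw [hsp, Multiset.map_map, Submonoid.coe_mul, split_mul, ← hsp x, ← hsp y]
      generalize sp x = s
      generalize sp y = t
      induction s using Multiset.induction with
      | empty => simp
      | cons a s ih => simp [ih, Multiset.map_map])
    split_coassoc := fun x => by
      have hinj3 : Function.Injective (Multiset.map
          (Prod.map (Subtype.val : S → M) (Prod.map (Subtype.val : S → M) (Subtype.val : S → M)))) :=
        Multiset.map_injective (Prod.map_injective.2 ⟨Subtype.val_injective,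
          Prod.map_injective.2 ⟨Subtype.val_injective, Subtype.val_injective⟩⟩)
      apply hinj3
      have h := split_coassoc x.1
      rw [← hsp x, Multiset.bind_map, Multiset.bind_map] at h
      simp only [Prod.map_fst, Prod.map_snd, ← hsp, Multiset.map_map] at h
      simp only [Multiset.map_bind, Multiset.map_map]
      exact h
    split_left := fun x => by
      obtain ⟨s, hs, hs'⟩ := split_left x.1
      obtain ⟨t, ht⟩ : ∃ t, sp x = (1, x) ::ₘ t := by
        have h1 : ((1 : M), x.1) ∈ (sp x).map (Prod.map Subtype.val Subtype.val) := by
          rw [hsp, hs]; exact Multiset.mem_cons_self _ _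
        obtain ⟨p, hp, hpe⟩ := Multiset.mem_map.1 h1
        have : p = (1, x) := Prod.ext (Subtype.ext (congrArg Prod.fst hpe))
          (Subtype.ext (congrArg Prod.snd hpe))
        exact Multiset.exists_cons_of_mem (this ▸ hp)
      refine ⟨t, ht, fun p hp h => ?_⟩
      have h2 := hsp x
      rw [ht, hs, Multiset.map_cons] at h2
      have h3 := (Multiset.cons_inj_right _).1 h2
      exact hs' _ (h3 ▸ Multiset.mem_map_of_mem _ hp) (congrArg Subtype.val h)
    split_right := fun x => by
      obtain ⟨s, hs, hs'⟩ := split_right x.1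
      obtain ⟨t, ht⟩ : ∃ t, sp x = (x, 1) ::ₘ t := by
        have h1 : (x.1, (1 : M)) ∈ (sp x).map (Prod.map Subtype.val Subtype.val) := by
          rw [hsp, hs]; exact Multiset.mem_cons_self _ _
        obtain ⟨p, hp, hpe⟩ := Multiset.mem_map.1 h1
        have : p = (x, 1) := Prod.ext (Subtype.ext (congrArg Prod.fst hpe))
          (Subtype.ext (congrArg Prod.snd hpe))
        exact Multiset.exists_cons_of_mem (this ▸ hp)
      refine ⟨t, ht, fun p hp h => ?_⟩
      have h2 := hsp x
      rw [ht, hs, Multiset.map_cons] at h2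
      have h3 := (Multiset.cons_inj_right _).1 h2
      exact hs' _ (h3 ▸ Multiset.mem_map_of_mem _ hp) (congrArg Subtype.val h)
    exists_deg := by
      obtain ⟨deg, h1, h2⟩ := exists_deg (M := M)
      exact ⟨fun x => deg x.1, fun x hx => Subtype.ext (h1 _ hx), fun x p hp => h2 _ _ (hmem x p hp)⟩ }

end SubSplit

/-- A finite poset with least and greatest elements, some of whose relations `p < q` have colours
in `A`. -/
structure LInterval (A : Type u) : Type (max 1 u) where
  P : Type
  [order : PartialOrder P]
  [finite : Finite P]
  bot : P
  top : P
  bot_le : ∀ p, bot ≤ p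
  le_top : ∀ p, p ≤ top
  colour : P → P → A → Prop
  lt_of_colour : ∀ p q a, colour p q a → p < q

attribute [instance] LInterval.order LInterval.finite

namespace LInterval

variable {A : Type u}

/-- Isomorphisms of posets that preserve the colours. -/
def Iso (X Y : LInterval A) : Prop :=
  ∃ e : X.P ≃o Y.P, ∀ p q a, Y.colour (e p) (e q) a ↔ X.colour p q a

theorem Iso.refl (X : LInterval A) : Iso X X := ⟨OrderIso.refl _, fun _ _ _ => Iff.rfl⟩

theorem Iso.symm {X Y : LInterval A} : Iso X Y → Iso Y X := by
  rintro ⟨e, he⟩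
  exact ⟨e.symm, fun p q a => by rw [← he]; simp⟩

theorem Iso.trans {X Y Z : LInterval A} : Iso X Y → Iso Y Z → Iso X Z := by
  rintro ⟨e, he⟩ ⟨f, hf⟩
  exact ⟨e.trans f, fun p q a => by simp [hf, he]⟩

instance setoid : Setoid (LInterval A) := ⟨Iso, Iso.refl, Iso.symm, Iso.trans⟩

/-- The direct product; the relation `(p, q) < (p', q)` has the colours of `p < p'`, and
`(p, q) < (p, q')` those of `q < q'`. -/
def prod (X Y : LInterval A) : LInterval A where
  P := X.P × Y.P
  bot := (X.bot, Y.bot)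
  top := (X.top, Y.top)
  bot_le p := Prod.mk_le_mk.2 ⟨X.bot_le p.1, Y.bot_le p.2⟩
  le_top p := Prod.mk_le_mk.2 ⟨X.le_top p.1, Y.le_top p.2⟩
  colour p q a := (X.colour p.1 q.1 a ∧ p.2 = q.2) ∨ (p.1 = q.1 ∧ Y.colour p.2 q.2 a)
  lt_of_colour := by
    rintro ⟨p, p'⟩ ⟨q, q'⟩ a (⟨h, rfl : p' = q'⟩ | ⟨rfl : p = q, h⟩)
    · exact Prod.mk_lt_mk_iff_left.2 (X.lt_of_colour _ _ _ h)
    · exact Prod.mk_lt_mk_iff_right.2 (Y.lt_of_colour _ _ _ h)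

/-- The interval with one element. -/
def point : LInterval A where
  P := Unit
  bot := ()
  top := ()
  bot_le _ := le_rfl
  le_top _ := le_rfl
  colour _ _ _ := False
  lt_of_colour _ _ _ h := h.elim

/-- The subinterval `[a, b]`. -/
def sub (X : LInterval A) (a b : X.P) (h : a ≤ b) : LInterval A where
  P := {p : X.P // a ≤ p ∧ p ≤ b}
  bot := ⟨a, le_rfl, h⟩
  top := ⟨b, h, le_rfl⟩
  bot_le p := p.2.1
  le_top p := p.2.2
  colour p q c := X.colour p.1 q.1 c
  lt_of_colour _ _ _ hc := X.lt_of_colour _ _ _ hc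

end LInterval

/-- Isomorphism classes of coloured intervals. -/
def IntervalClass (A : Type u) : Type (max 1 u) := Quotient (LInterval.setoid (A := A))

namespace IntervalClass

open LInterval

variable {A : Type u}

/-- The class of an interval. -/
def mk (X : LInterval A) : IntervalClass A := Quotient.mk _ X

theorem sound {X Y : LInterval A} (e : X.P ≃ Y.P) (hle : ∀ p q, e p ≤ e q ↔ p ≤ q)
    (hc : ∀ p q a, Y.colour (e p) (e q) a ↔ X.colour p q a) : mk X = mk Y :=
  Quotient.sound ⟨⟨e, fun {p q} => hle p q⟩, hc⟩

theorem mk_eq {X Y : LInterval A} : mk X = mk Y ↔ Iso X Y := Quotient.eq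

/-- The product is the direct product of intervals, the unit is the one-point interval. -/
instance : CommMonoid (IntervalClass A) where
  mul := Quotient.map₂ LInterval.prod (by
    rintro X X' ⟨e, he⟩ Y Y' ⟨f, hf⟩
    refine ⟨⟨e.toEquiv.prodCongr f.toEquiv, fun {p q} => and_congr e.le_iff_le f.le_iff_le⟩,
      fun p q a => ?_⟩
    exact or_congr (and_congr (he _ _ _) f.injective.eq_iff) (and_congr e.injective.eq_iff (hf _ _ _)))
  one := mk point
  mul_assoc := by
    rintro ⟨X⟩ ⟨Y⟩ ⟨Z⟩
    refine sound (X := (X.prod Y).prod Z) (Y := X.prod (Y.prod Z)) (Equiv.prodAssoc _ _ _) ?_ ?_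
    · rintro ⟨⟨p, q⟩, r⟩ ⟨⟨p', q'⟩, r'⟩
      exact and_assoc.symm
    · rintro ⟨⟨p, q⟩, r⟩ ⟨⟨p', q'⟩, r'⟩ a
      change (X.colour p p' a ∧ (q, r) = (q', r')) ∨ (p = p' ∧
        ((Y.colour q q' a ∧ r = r') ∨ (q = q' ∧ Z.colour r r' a))) ↔
        (((X.colour p p' a ∧ q = q') ∨ (p = p' ∧ Y.colour q q' a)) ∧ r = r') ∨
          ((p, q) = (p', q') ∧ Z.colour r r' a)
      rw [Prod.mk.injEq, Prod.mk.injEq]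
      tauto
  one_mul := by
    rintro ⟨X⟩
    refine sound (X := point.prod X) (Y := X) (Equiv.punitProd X.P) ?_ ?_
    · rintro ⟨⟨⟩, p⟩ ⟨⟨⟩, q⟩
      exact ⟨fun h => ⟨le_rfl, h⟩, fun h => h.2⟩
    · rintro ⟨⟨⟩, p⟩ ⟨⟨⟩, q⟩ a
      exact ⟨fun h => Or.inr ⟨rfl, h⟩, fun h => h.elim (fun h => h.1.elim) fun h => h.2⟩
  mul_one := by
    rintro ⟨X⟩
    refine sound (X := X.prod point) (Y := X) (Equiv.prodPUnit X.P) ?_ ?_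
    · rintro ⟨p, ⟨⟩⟩ ⟨q, ⟨⟩⟩
      exact ⟨fun h => ⟨h, le_rfl⟩, fun h => h.1⟩
    · rintro ⟨p, ⟨⟩⟩ ⟨q, ⟨⟩⟩ a
      exact ⟨fun h => Or.inl ⟨h, rfl⟩, fun h => h.elim (fun h => h.1) fun h => h.2.elim⟩
  mul_comm := by
    rintro ⟨X⟩ ⟨Y⟩
    refine sound (X := X.prod Y) (Y := Y.prod X) (Equiv.prodComm _ _) ?_ ?_
    · rintro ⟨p, q⟩ ⟨p', q'⟩
      exact and_comm
    · rintro ⟨p, q⟩ ⟨p', q'⟩ a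
      change (Y.colour q q' a ∧ p = p') ∨ (q = q' ∧ X.colour p p' a) ↔
        (X.colour p p' a ∧ q = q') ∨ (p = p' ∧ Y.colour q q' a)
      tauto

theorem mk_mul (X Y : LInterval A) : mk X * mk Y = mk (X.prod Y) := rfl

theorem mk_eq_one {X : LInterval A} : mk X = 1 ↔ X.bot = X.top := by
  constructor
  · intro h
    obtain ⟨e, -⟩ := mk_eq.1 h
    exact e.injective (Subsingleton.elim (α := Unit) _ _)
  · intro h
    have hs : ∀ p q : X.P, p = q := fun p q => le_antisymm
      ((X.le_top p).trans (h ▸ X.bot_le q)) ((X.le_top q).trans (h ▸ X.bot_le p))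
    refine sound (X := X) (Y := point) ⟨fun _ => (), fun _ => X.bot, fun p => hs _ _, fun _ => rfl⟩
      (fun p q => ⟨fun _ => (hs p q).le, fun _ => le_rfl⟩) fun p q a => ⟨fun h => h.elim, fun h => ?_⟩
    exact absurd (hs p q) (X.lt_of_colour p q a h).ne

theorem mk_sub_univ (X : LInterval A) (h : X.bot ≤ X.top) : mk (X.sub X.bot X.top h) = mk X :=
  sound (X := X.sub X.bot X.top h) (Y := X)
    ⟨fun p => p.1, fun p => ⟨p, X.bot_le p, X.le_top p⟩, fun _ => rfl, fun _ => rfl⟩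
    (fun _ _ => Iff.rfl) fun _ _ _ => Iff.rfl

theorem mk_sub_sub (X : LInterval A) (a b : X.P) (h : a ≤ b) (c d : (X.sub a b h).P) (h' : c ≤ d) :
    mk ((X.sub a b h).sub c d h') = mk (X.sub c.1 d.1 h') :=
  sound (X := (X.sub a b h).sub c d h') (Y := X.sub c.1 d.1 h')
    ⟨fun p => ⟨p.1.1, p.2⟩, fun p => ⟨⟨p.1, c.2.1.trans p.2.1, p.2.2.trans d.2.2⟩, p.2⟩,
      fun _ => rfl, fun _ => rfl⟩
    (fun _ _ => Iff.rfl) fun _ _ _ => Iff.rfl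

/-- The pairs `([0, x], [x, 1])`. -/
noncomputable def splitInterval (X : LInterval A) : Multiset (IntervalClass A × IntervalClass A) :=
  family fun x : X.P => (mk (X.sub X.bot x (X.bot_le x)), mk (X.sub x X.top (X.le_top x)))

theorem splitInterval_congr {X Y : LInterval A} (h : Iso X Y) :
    splitInterval X = splitInterval Y := by
  obtain ⟨e, he⟩ := h
  have key : ∀ (a b : X.P) (h : a ≤ b) (a' b' : Y.P) (h' : a' ≤ b'), e a = a' → e b = b' →
      mk (Y.sub a' b' h') = mk (X.sub a b h) := by
    rintro a b h _ _ h' rfl rfl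
    exact (sound (X := X.sub a b h) (Y := Y.sub (e a) (e b) h')
      (e.toEquiv.subtypeEquiv fun p => and_congr e.le_iff_le.symm e.le_iff_le.symm)
      (fun p q => e.le_iff_le (x := p.1) (y := q.1)) fun p q c => he p.1 q.1 c).symm
  have hb : e X.bot = Y.bot := le_antisymm (by
    have := e.monotone (X.bot_le (e.symm Y.bot)); simpa using this) (Y.bot_le _)
  have ht : e X.top = Y.top := le_antisymm (Y.le_top _) (by
    have := e.monotone (X.le_top (e.symm Y.top)); simpa using this)
  exact family_congr_equiv e.toEquiv fun x =>
    Prod.ext (key _ _ _ _ _ _ hb rfl) (key _ _ _ _ _ _ rfl ht)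

noncomputable instance : SplitMonoid (IntervalClass A) where
  split := Quotient.lift splitInterval fun _ _ h => splitInterval_congr h
  split_one := by
    change splitInterval point = _
    let _ : Unique (point : LInterval A).P := inferInstanceAs (Unique Unit)
    rw [splitInterval, family_unique, mk_eq_one.2, mk_eq_one.2] <;> rfl
  split_mul := by
    rintro ⟨X⟩ ⟨Y⟩
    change splitInterval (X.prod Y) = (splitInterval X ×ˢ splitInterval Y).map _
    rw [splitInterval, splitInterval, splitInterval, family_prod, map_family]
    have key : ∀ (a b : X.P) (h : a ≤ b) (c d : Y.P) (h' : c ≤ d) (h'' : ((a, c) : X.P × Y.P) ≤ (b, d)),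
        mk (X.sub a b h) * mk (Y.sub c d h') = mk ((X.prod Y).sub (a, c) (b, d) h'') := by
      intro a b h c d h' h''
      refine sound (X := (X.sub a b h).prod (Y.sub c d h')) (Y := (X.prod Y).sub (a, c) (b, d) h'')
        ⟨fun p => ⟨(p.1.1, p.2.1), ⟨p.1.2.1, p.2.2.1⟩, ⟨p.1.2.2, p.2.2.2⟩⟩,
          fun p => (⟨p.1.1, p.2.1.1, p.2.2.1⟩, ⟨p.1.2, p.2.1.2, p.2.2.2⟩),
          fun _ => rfl, fun _ => rfl⟩ (fun p q => Iff.rfl) fun p q e => ?_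
      exact or_congr (and_congr Iff.rfl Subtype.ext_iff.symm) (and_congr Subtype.ext_iff.symm Iff.rfl)
    exact family_congr_equiv (Equiv.refl (X.P × Y.P)) fun p =>
      Prod.ext (key _ _ _ _ _ _ _) (key _ _ _ _ _ _ _)
  split_coassoc := by
    rintro ⟨X⟩
    change (splitInterval X).bind _ = (splitInterval X).bind _
    let Q := {p : X.P × X.P // p.1 ≤ p.2}
    let F : Q → IntervalClass A × IntervalClass A × IntervalClass A := fun p =>
      (mk (X.sub X.bot p.1.1 (X.bot_le _)), mk (X.sub p.1.1 p.1.2 p.2),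
        mk (X.sub p.1.2 X.top (X.le_top _)))
    trans family F
    · rw [splitInterval, family_bind (γ := fun x : X.P => (X.sub X.bot x (X.bot_le x)).P) _ _
        (fun x y => (mk ((X.sub X.bot x (X.bot_le x)).sub _ y (LInterval.bot_le _ _)),
          mk ((X.sub X.bot x (X.bot_le x)).sub y _ (LInterval.le_top _ _)),
          mk (X.sub x X.top (X.le_top x)))) (fun s => map_family _ _)]
      let E : (Σ x : X.P, (X.sub X.bot x (X.bot_le x)).P) ≃ Q :=
        { toFun := fun q => ⟨(q.2.1, q.1), q.2.2.2⟩
          invFun := fun p => ⟨p.1.2, ⟨p.1.1, X.bot_le _, p.2⟩⟩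
          left_inv := fun _ => rfl
          right_inv := fun _ => rfl }
      refine family_congr_equiv E fun q => ?_
      exact Prod.ext (mk_sub_sub X X.bot q.1 _ ⟨X.bot, le_rfl, X.bot_le _⟩ q.2 q.2.2.1).symm
        (Prod.ext (mk_sub_sub X X.bot q.1 _ q.2 ⟨q.1, X.bot_le _, le_rfl⟩ _).symm rfl)
    · symm
      rw [splitInterval, family_bind (γ := fun x : X.P => (X.sub x X.top (X.le_top x)).P) _ _
        (fun x y => (mk (X.sub X.bot x (X.bot_le x)),
          mk ((X.sub x X.top (X.le_top x)).sub _ y (LInterval.bot_le _ _)),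
          mk ((X.sub x X.top (X.le_top x)).sub y _ (LInterval.le_top _ _))))
          (fun s => map_family _ _)]
      let E : (Σ x : X.P, (X.sub x X.top (X.le_top x)).P) ≃ Q :=
        { toFun := fun q => ⟨(q.1, q.2.1), q.2.2.1⟩
          invFun := fun p => ⟨p.1.1, ⟨p.1.2, p.2, X.le_top _⟩⟩
          left_inv := fun _ => rfl
          right_inv := fun _ => rfl }
      refine family_congr_equiv E fun q => ?_
      exact Prod.ext rfl (Prod.ext
        (mk_sub_sub X q.1 X.top _ ⟨q.1, le_rfl, X.le_top _⟩ q.2 _).symm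
        (mk_sub_sub X q.1 X.top _ q.2 ⟨X.top, X.le_top _, le_rfl⟩ q.2.2.2).symm)
  split_left := by
    rintro ⟨X⟩
    refine ⟨_, (family_eq_cons (α := X.P) _ X.bot).trans (congrArg (· ::ₘ _) ?_), ?_⟩
    · exact Prod.ext (mk_eq_one.2 rfl) (mk_sub_univ X _)
    · rintro p hp
      obtain ⟨⟨x, hx⟩, rfl⟩ := mem_family.1 hp
      intro h
      exact hx (congrArg Subtype.val (mk_eq_one.1 h)).symm
  split_right := by
    rintro ⟨X⟩
    refine ⟨_, (family_eq_cons (α := X.P) _ X.top).trans (congrArg (· ::ₘ _) ?_), ?_⟩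
    · exact Prod.ext (mk_sub_univ X _) (mk_eq_one.2 rfl)
    · rintro p hp
      obtain ⟨⟨x, hx⟩, rfl⟩ := mem_family.1 hp
      intro h
      exact hx (congrArg Subtype.val (mk_eq_one.1 h))
  exists_deg := by
    refine ⟨Quotient.lift (fun X => Nat.card X.P - 1) fun X Y h => ?_, ?_, ?_⟩
    · obtain ⟨e, -⟩ := h
      rw [Nat.card_congr e.toEquiv]
    · rintro ⟨X⟩ h
      change Nat.card X.P - 1 = 0 at h
      have : Subsingleton X.P := Finite.card_le_one_iff_subsingleton.1 (by omega)
      exact mk_eq_one.2 (Subsingleton.elim _ _)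
    · rintro ⟨X⟩ p hp
      obtain ⟨x, rfl⟩ := mem_family.1 (show p ∈ splitInterval X from hp)
      change (Nat.card {p : X.P // X.bot ≤ p ∧ p ≤ x} - 1) + (Nat.card {p : X.P // x ≤ p ∧ p ≤ X.top} - 1)
        ≤ Nat.card X.P - 1
      let s : Set X.P := {p | X.bot ≤ p ∧ p ≤ x}
      let t : Set X.P := {p | x ≤ p ∧ p ≤ X.top}
      change (Nat.card s - 1) + (Nat.card t - 1) ≤ _
      rw [Nat.card_coe_set_eq, Nat.card_coe_set_eq]
      have h1 := Set.ncard_union_add_ncard_inter s t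
      have h2 : s ∩ t = {x} := by
        ext p
        exact ⟨fun h => le_antisymm h.1.2 h.2.1, fun h => by
          rw [Set.mem_singleton_iff] at h
          subst h
          exact ⟨⟨X.bot_le _, le_rfl⟩, ⟨le_rfl, X.le_top _⟩⟩⟩
      have h3 : (s ∪ t).ncard ≤ Nat.card X.P := Set.ncard_le_card _
      have h4 : 0 < s.ncard := (Set.ncard_pos (Set.toFinite _)).2 ⟨x, X.bot_le _, le_rfl⟩
      have h5 : 0 < t.ncard := (Set.ncard_pos (Set.toFinite _)).2 ⟨x, le_rfl, X.le_top _⟩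
      rw [h2, Set.ncard_singleton] at h1
      omega

theorem split_mk (X : LInterval A) : SplitMonoid.split (mk X) = splitInterval X := rfl

end IntervalClass

/-! ### The operadic partition posets of `NAP` and the labelled incidence Hopf algebra -/

/-- The elements of `Π_NAP(I)`: forests of rooted trees with vertex set `I`, given by the tree
order (roots are minimal). -/
@[ext] structure NapForest (I : Type) where
  le : I → I → Prop
  le_refl : ∀ v, le v v
  le_trans : ∀ v w z, le v w → le w z → le v z
  le_antisymm : ∀ v w, le v w → le w v → v = w
  chain : ∀ v w z, le w v → le z v → le w z ∨ le z w

namespace NapForest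

variable {I : Type}

instance [Finite I] : Finite (NapForest I) :=
  Finite.of_injective (fun x : NapForest I => x.le) fun _ _ h => NapForest.ext h

/-- The roots of a forest. -/
def IsRoot (x : NapForest I) (r : I) : Prop := ∀ v, x.le v r → v = r

/-- `y` is obtained from `x` by grafting the component of `x` with root `r` to the root `s` of
another component: a new edge joins `s` to `r`. -/
def Graft (x y : NapForest I) (r s : I) : Prop :=
  x.IsRoot r ∧ x.IsRoot s ∧ r ≠ s ∧ ∀ v w, y.le v w ↔ x.le v w ∨ (v = s ∧ x.le r w)

theorem Graft.le_le {x y : NapForest I} {r s : I} (h : Graft x y r s) {v w : I} (hvw : x.le v w) :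
    y.le v w := (h.2.2.2 v w).2 (Or.inl hvw)

theorem Graft.ne {x y : NapForest I} {r s : I} (h : Graft x y r s) : x ≠ y := by
  rintro rfl
  exact h.2.2.1 (h.1 s ((h.2.2.2 s r).2 (Or.inr ⟨rfl, x.le_refl r⟩))).symm

/-- The order of `Π_NAP(I)`: `y` is obtained from `x` by a sequence of graftings of roots to roots. -/
instance : PartialOrder (NapForest I) where
  le := Relation.ReflTransGen fun x y => ∃ r s, Graft x y r s
  le_refl _ := .refl
  le_trans _ _ _ := .trans
  le_antisymm x y hxy hyx := by
    have h : ∀ {x y : NapForest I}, Relation.ReflTransGen (fun x y => ∃ r s, Graft x y r s) x y →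
        ∀ v w, x.le v w → y.le v w := by
      intro x y h
      induction h with
      | refl => exact fun _ _ h => h
      | tail _ hs ih =>
        obtain ⟨r, s, hs⟩ := hs
        exact fun v w hvw => hs.le_le (ih v w hvw)
    ext v w
    exact ⟨h hxy v w, h hyx v w⟩

theorem Graft.lt {x y : NapForest I} {r s : I} (h : Graft x y r s) : x < y :=
  lt_of_le_of_ne (.single ⟨r, s, h⟩) h.ne

end NapForest

/-- The interval `[x, y]` of `Π_NAP(I)` for a set of vertices labelled by `l : I → A`: the covering
relation that grafts a root `r` to another root is coloured by the label of `r`. -/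
def napInterval {A : Type u} {I : Type} [Finite I] (l : I → A) (x y : NapForest I) (h : x ≤ y) :
    LInterval A where
  P := {z : NapForest I // x ≤ z ∧ z ≤ y}
  bot := ⟨x, le_rfl, h⟩
  top := ⟨y, h, le_rfl⟩
  bot_le z := z.2.1
  le_top z := z.2.2
  colour z z' a := ∃ r s, NapForest.Graft z.1 z'.1 r s ∧ l r = a
  lt_of_colour := by
    rintro z z' _ ⟨r, s, h, -⟩
    exact h.lt

/-- The classes of the products of intervals of the posets `Π_NAP(I)`, for all finite sets `I` of
vertices labelled by `A`. -/
def napMonoid (A : Type u) : Submonoid (IntervalClass A) :=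
  Submonoid.closure {c | ∃ (I : Type) (_ : Finite I) (l : I → A) (x y : NapForest I) (h : x ≤ y),
    c = IntervalClass.mk (napInterval l x y h)}

theorem napMonoid_split {A : Type u} : ∀ c ∈ napMonoid A, ∀ p ∈ SplitMonoid.split c,
    p.1 ∈ napMonoid A ∧ p.2 ∈ napMonoid A := by
  intro c hc
  induction hc using Submonoid.closure_induction with
  | mem c hc =>
    obtain ⟨I, _, l, x, y, h, rfl⟩ := hc
    have key : ∀ (a b : (napInterval l x y h).P) (hab : a ≤ b),
        IntervalClass.mk ((napInterval l x y h).sub a b hab) ∈ napMonoid A := by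
      intro a b hab
      refine Submonoid.subset_closure ⟨I, ‹_›, l, a.1, b.1, hab, ?_⟩
      exact IntervalClass.sound (X := (napInterval l x y h).sub a b hab)
        (Y := napInterval l a.1 b.1 hab)
        ⟨fun p => ⟨p.1.1, p.2⟩, fun p => ⟨⟨p.1, a.2.1.trans p.2.1, p.2.2.trans b.2.2⟩, p.2⟩,
          fun _ => rfl, fun _ => rfl⟩ (fun _ _ => Iff.rfl) fun _ _ _ => Iff.rfl
    intro p hp
    obtain ⟨z, rfl⟩ := mem_family.1 hp
    exact ⟨key _ _ _, key _ _ _⟩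
  | one =>
    intro p hp
    rw [SplitMonoid.split_one, Multiset.mem_singleton] at hp
    subst hp
    exact ⟨one_mem _, one_mem _⟩
  | mul c d _ _ hc hd =>
    intro p hp
    rw [SplitMonoid.split_mul] at hp
    obtain ⟨⟨q, q'⟩, hq, rfl⟩ := Multiset.mem_map.1 hp
    rw [Multiset.mem_product] at hq
    exact ⟨mul_mem (hc q hq.1).1 (hd q' hq.2).1, mul_mem (hc q hq.1).2 (hd q' hq.2).2⟩

noncomputable instance (A : Type u) : SplitMonoid (napMonoid A) :=
  subSplitMonoid (napMonoid A) napMonoid_split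

/-- `H_NAP(A)`, the labelled incidence Hopf algebra of the set operad `NAP`: its basis `F_[i]` are
the isomorphism classes of the products of labelled intervals, `F_[i] F_[j] = F_[i × j]` and
`Δ(F_[i]) = ∑ F_[0, x] ⊗ F_[x, 1]` over the elements `x` of the interval. -/
abbrev HNAP (K : Type*) [CommRing K] (A : Type u) : Type _ := SplitAlgebra K (napMonoid A)

/-! ### The universal Hopf algebra of renormalization -/

section Enveloping

attribute [local instance 100] LieRing.ofAssociativeRing LieAlgebra.ofAssociativeAlgebra

variable (K L : Type*) [CommRing K] [LieRing L] [LieAlgebra K L]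

open UniversalEnvelopingAlgebra

/-- `x ↦ x ⊗ 1 + 1 ⊗ x` on a Lie algebra. -/
noncomputable def primitiveHom : L →ₗ⁅K⁆
    UniversalEnvelopingAlgebra K L ⊗[K] UniversalEnvelopingAlgebra K L where
  toFun x := ι K x ⊗ₜ[K] 1 + 1 ⊗ₜ[K] ι K x
  map_add' x y := by simp only [map_add, TensorProduct.add_tmul, TensorProduct.tmul_add]; abel
  map_smul' c x := by simp [TensorProduct.smul_tmul']
  map_lie' {x y} := by
    simp only [LieHom.map_lie, LieRing.of_associative_ring_bracket, mul_add, add_mul,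
      Algebra.TensorProduct.tmul_mul_tmul, one_mul, mul_one, TensorProduct.sub_tmul,
      TensorProduct.tmul_sub]
    abel

variable {K L} in
theorem uea_ext {B : Type*} [Ring B] [Algebra K B] {f g : UniversalEnvelopingAlgebra K L →ₐ[K] B}
    (h : ∀ x, f (ι K x) = g (ι K x)) : f = g :=
  UniversalEnvelopingAlgebra.hom_ext K (LieHom.ext h)

theorem lift_primitive (x : L) : UniversalEnvelopingAlgebra.lift K (primitiveHom K L) (ι K x) =
    ι K x ⊗ₜ[K] 1 + 1 ⊗ₜ[K] ι K x := lift_ι_apply K (primitiveHom K L) x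

theorem lift_zero (x : L) : UniversalEnvelopingAlgebra.lift K (0 : L →ₗ⁅K⁆ K) (ι K x) = 0 :=
  lift_ι_apply K (0 : L →ₗ⁅K⁆ K) x

/-- The universal enveloping algebra is a bialgebra in which the elements of the Lie algebra are
primitive. -/
noncomputable instance : Bialgebra K (UniversalEnvelopingAlgebra K L) :=
  .ofAlgHom (UniversalEnvelopingAlgebra.lift K (primitiveHom K L))
    (UniversalEnvelopingAlgebra.lift K (0 : L →ₗ⁅K⁆ K))
    (uea_ext fun x => by
      simp only [AlgHom.comp_apply, lift_primitive, map_add, Algebra.TensorProduct.map_tmul,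
        AlgHom.id_apply, map_one, TensorProduct.add_tmul, TensorProduct.tmul_add,
        Algebra.TensorProduct.one_def, AlgEquiv.coe_toAlgHom, Algebra.TensorProduct.assoc_tmul,
        add_assoc])
    (uea_ext fun x => by
      simp only [AlgHom.comp_apply, lift_primitive, map_add, Algebra.TensorProduct.map_tmul,
        AlgHom.id_apply, map_one, lift_zero, TensorProduct.zero_tmul, zero_add]
      rfl)
    (uea_ext fun x => by
      simp only [AlgHom.comp_apply, lift_primitive, map_add, Algebra.TensorProduct.map_tmul,
        AlgHom.id_apply, map_one, lift_zero, TensorProduct.tmul_zero, add_zero]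
      rfl)

theorem comul_ι (x : L) : Coalgebra.comul (R := K) (ι K x) = ι K x ⊗ₜ[K] 1 + 1 ⊗ₜ[K] ι K x :=
  lift_primitive K L x

theorem counit_ι (x : L) : Coalgebra.counit (R := K) (ι K x) = 0 :=
  lift_zero K L x

instance : Coalgebra.IsCocomm K (UniversalEnvelopingAlgebra K L) where
  comm_comp_comul := by
    have : (Algebra.TensorProduct.comm K (UniversalEnvelopingAlgebra K L)
        (UniversalEnvelopingAlgebra K L)).toAlgHom.comp
          (Bialgebra.comulAlgHom K (UniversalEnvelopingAlgebra K L)) =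
        Bialgebra.comulAlgHom K (UniversalEnvelopingAlgebra K L) := uea_ext fun x => by
      change Algebra.TensorProduct.comm K _ _ (Coalgebra.comul (R := K) (ι K x)) =
        Coalgebra.comul (R := K) (ι K x)
      rw [comul_ι, map_add, Algebra.TensorProduct.comm_tmul, Algebra.TensorProduct.comm_tmul, add_comm]
    exact congrArg AlgHom.toLinearMap this

end Enveloping

/-- `U(L)` for the free Lie algebra `L` with one generator `e_{-n}` in each degree `n > 0`. -/
abbrev UL (K : Type*) [CommRing K] : Type _ :=
  UniversalEnvelopingAlgebra K (FreeLieAlgebra K ℕ+)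

namespace UL

variable (K : Type*) [CommRing K]

/-- The generator `e_{-n}`. -/
noncomputable def gen (n : ℕ+) : UL K :=
  UniversalEnvelopingAlgebra.ι K (FreeLieAlgebra.of K n)

/-- The products of generators. -/
noncomputable def mono (w : List ℕ+) : UL K := (w.map (gen K)).prod

/-- The degree of a product of generators. -/
def weight (w : List ℕ+) : ℕ := (w.map fun n : ℕ+ => (n : ℕ)).sum

/-- The homogeneous component of degree `n`. -/
noncomputable def grade (n : ℕ) : Submodule K (UL K) :=
  Submodule.span K {x | ∃ w, weight w = n ∧ x = mono K w}

theorem mono_nil : mono K [] = 1 := rfl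

theorem mono_cons (a : ℕ+) (w : List ℕ+) : mono K (a :: w) = gen K a * mono K w := by
  simp [mono]

theorem mono_append (u v : List ℕ+) : mono K (u ++ v) = mono K u * mono K v := by
  simp [mono]

theorem weight_cons (a : ℕ+) (w : List ℕ+) : weight (a :: w) = a + weight w := by
  simp [weight]

theorem comul_gen (n : ℕ+) :
    Coalgebra.comul (R := K) (gen K n) = gen K n ⊗ₜ[K] 1 + 1 ⊗ₜ[K] gen K n := comul_ι K _ _

theorem counit_mono_cons (a : ℕ+) (w : List ℕ+) :
    Coalgebra.counit (R := K) (mono K (a :: w)) = 0 := by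
  rw [mono_cons, Bialgebra.counit_mul, gen, counit_ι, zero_mul]

theorem comul_mono_mem (w : List ℕ+) : Coalgebra.comul (R := K) (mono K w) ∈
    Submodule.span K {z | ∃ u v, weight u + weight v = weight w ∧ z = mono K u ⊗ₜ[K] mono K v} := by
  induction w with
  | nil =>
    rw [mono_nil, Bialgebra.comul_one]
    exact Submodule.subset_span ⟨[], [], rfl, rfl⟩
  | cons a w ih =>
    rw [mono_cons, Bialgebra.comul_mul]
    generalize Coalgebra.comul (R := K) (mono K w) = z at ih
    induction ih using Submodule.span_induction with
    | mem z hz =>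
      obtain ⟨u, v, h, rfl⟩ := hz
      rw [comul_gen, add_mul, Algebra.TensorProduct.tmul_mul_tmul,
        Algebra.TensorProduct.tmul_mul_tmul, one_mul, one_mul, ← mono_cons, ← mono_cons]
      refine Submodule.add_mem _ (Submodule.subset_span ⟨_, _, ?_, rfl⟩)
        (Submodule.subset_span ⟨_, _, ?_, rfl⟩)
      · rw [weight_cons, weight_cons]; omega
      · rw [weight_cons, weight_cons]; omega
    | zero => rw [mul_zero]; exact Submodule.zero_mem _
    | add x y _ _ hx hy => rw [mul_add]; exact Submodule.add_mem _ hx hy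
    | smul c x _ hx => rw [mul_smul_comm]; exact Submodule.smul_mem _ _ hx

/-- The products of generators form a basis. -/
noncomputable def basis : Module.Basis (List ℕ+) K (UL K) :=
  (FreeAlgebra.basisFreeMonoid K ℕ+).map
    (FreeLieAlgebra.universalEnvelopingEquivFreeAlgebra K ℕ+).symm.toLinearEquiv

theorem basis_apply (w : List ℕ+) : basis K w = mono K w := by
  have h : FreeAlgebra.basisFreeMonoid K ℕ+ w = (w.map (FreeAlgebra.ι K)).prod := by
    change MonoidAlgebra.lift K _ _ _ (MonoidAlgebra.of K (FreeMonoid ℕ+) w) = _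
    exact (MonoidAlgebra.lift_of (R := K) (FreeMonoid.lift (FreeAlgebra.ι K))
      (FreeMonoid.ofList w)).trans (FreeMonoid.lift_apply _ _)
  have h' : basis K w = (FreeLieAlgebra.universalEnvelopingEquivFreeAlgebra K ℕ+).symm
      (FreeAlgebra.basisFreeMonoid K ℕ+ w) := rfl
  rw [h', h, map_list_prod, List.map_map, mono]
  congr 2
  ext n
  exact FreeAlgebra.lift_ι_apply _ _

theorem finite_weight_le (N : ℕ) : {w : List ℕ+ | weight w ≤ N}.Finite := by
  induction N with
  | zero =>
    refine (Set.finite_singleton []).subset ?_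
    rintro (_ | ⟨a, w⟩) h
    · rfl
    · have h1 : weight (a :: w) ≤ 0 := h
      have h2 : 0 < (a : ℕ) := a.pos
      rw [weight_cons] at h1
      omega
  | succ N ih =>
    refine ((Set.finite_singleton []).union
      (Set.Finite.image2 List.cons (Set.finite_Iic (N.succPNat)) ih)).subset ?_
    rintro (_ | ⟨a, w⟩) h
    · exact Or.inl rfl
    · have h1 : weight (a :: w) ≤ N + 1 := h
      have h2 : 0 < (a : ℕ) := a.pos
      rw [weight_cons] at h1
      refine Or.inr ⟨a, ?_, w, ?_, rfl⟩
      · change (a : ℕ) ≤ N + 1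
        omega
      · change weight w ≤ N
        omega

end UL

open WithConv

variable (K : Type*) [CommRing K]

/-- The graded dual of `U(L)`: the linear functionals that vanish on all but finitely many homogeneous
components, with the convolution product `(f g)(x) = (f ⊗ g)(Δ x)`. -/
noncomputable def gradedDual : Subalgebra K (WithConv (UL K →ₗ[K] K)) where
  carrier := {f | ∃ N, ∀ n > N, ∀ x ∈ UL.grade K n, f.ofConv x = 0}
  add_mem' := by
    rintro f g ⟨N, hN⟩ ⟨M, hM⟩
    refine ⟨max N M, fun n hn x hx => ?_⟩
    rw [ofConv_add, LinearMap.add_apply, hN n (by omega) x hx, hM n (by omega) x hx, add_zero]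
  mul_mem' := by
    rintro f g ⟨N, hN⟩ ⟨M, hM⟩
    refine ⟨N + M, fun n hn x hx => ?_⟩
    induction hx using Submodule.span_induction with
    | mem x hx =>
      obtain ⟨w, hw, rfl⟩ := hx
      have hle : Submodule.span K {z | ∃ u v, UL.weight u + UL.weight v = UL.weight w ∧
          z = UL.mono K u ⊗ₜ[K] UL.mono K v} ≤
          LinearMap.ker (LinearMap.mul' K K ∘ₗ TensorProduct.map f.ofConv g.ofConv) := by
        rw [Submodule.span_le]
        rintro _ ⟨u, v, huv, rfl⟩
        simp only [SetLike.mem_coe, LinearMap.mem_ker, LinearMap.comp_apply,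
          TensorProduct.map_tmul, LinearMap.mul'_apply]
        rcases lt_or_ge N (UL.weight u) with hu | hu
        · rw [hN _ hu _ (Submodule.subset_span ⟨u, rfl, rfl⟩), zero_mul]
        · rw [hM (UL.weight v) (by omega) _ (Submodule.subset_span ⟨v, rfl, rfl⟩), mul_zero]
      exact hle (UL.comul_mono_mem K w)
    | zero => simp
    | add x y _ _ hx hy => rw [map_add, hx, hy, add_zero]
    | smul c x _ hx => rw [map_smul, hx, smul_zero]
  algebraMap_mem' c := by
    refine ⟨0, fun n hn x hx => ?_⟩
    induction hx using Submodule.span_induction with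
    | mem x hx =>
      obtain ⟨w, hw, rfl⟩ := hx
      rcases w with _ | ⟨a, w⟩
      · exact absurd hw (ne_of_lt hn)
      · simp [UL.counit_mono_cons]
    | zero => simp
    | add x y _ _ hx hy => rw [map_add, hx, hy, add_zero]
    | smul c x _ hx => rw [map_smul, hx, smul_zero]

/-- `H_U`, the universal Hopf algebra of renormalization. -/
def HU : Type _ := gradedDual K

namespace HU

noncomputable instance : CommRing (HU K) := inferInstanceAs (CommRing (gradedDual K))
noncomputable instance : Algebra K (HU K) := inferInstanceAs (Algebra K (gradedDual K))

variable {K}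

/-- The linear functional on `U(L)`. -/
noncomputable def toDual : HU K →ₗ[K] Module.Dual K (UL K) where
  toFun f := f.1.ofConv
  map_add' _ _ := rfl
  map_smul' _ _ := rfl

theorem toDual_injective : Function.Injective (toDual (K := K)) := fun _ _ h =>
  Subtype.ext (WithConv.ofConv_injective h)

theorem exists_vanish (f : HU K) : ∃ N, ∀ w, N < UL.weight w → toDual f (UL.mono K w) = 0 := by
  obtain ⟨N, hN⟩ := f.2
  exact ⟨N, fun w hw => hN _ hw _ (Submodule.subset_span ⟨w, rfl, rfl⟩)⟩

/-- A functional that vanishes on the products of generators of large degree. -/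
noncomputable def ofDual (f : Module.Dual K (UL K))
    (h : ∃ N, ∀ w, N < UL.weight w → f (UL.mono K w) = 0) : HU K :=
  ⟨toConv f, by
    obtain ⟨N, hN⟩ := h
    refine ⟨N, fun n hn x hx => ?_⟩
    induction hx using Submodule.span_induction with
    | mem x hx =>
      obtain ⟨w, hw, rfl⟩ := hx
      exact hN w (hw ▸ hn)
    | zero => simp
    | add x y _ _ hx hy => rw [map_add, hx, hy, add_zero]
    | smul c x _ hx => rw [map_smul, hx, smul_zero]⟩

@[simp] theorem toDual_ofDual (f : Module.Dual K (UL K)) (h) : toDual (ofDual f h) = f := rfl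

theorem mul_apply (f g : HU K) (x : UL K) : toDual (f * g) x =
    LinearMap.mul' K K (TensorProduct.map (toDual f) (toDual g) (Coalgebra.comul x)) := rfl

theorem one_apply (x : UL K) : toDual (1 : HU K) x = Coalgebra.counit (R := K) x := rfl

theorem ext_mono {f g : HU K} (h : ∀ w, toDual f (UL.mono K w) = toDual g (UL.mono K w)) : f = g :=
  toDual_injective ((UL.basis K).ext fun w => by rw [UL.basis_apply]; exact h w)

/-- `(∂_a f)(x) = f(e_a x)`. -/
noncomputable def shift (a : ℕ+) (f : HU K) : HU K :=
  ofDual (toDual f ∘ₗ LinearMap.mulLeft K (UL.gen K a)) (by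
    obtain ⟨N, hN⟩ := exists_vanish f
    refine ⟨N, fun w hw => ?_⟩
    rw [LinearMap.comp_apply, LinearMap.mulLeft_apply, ← UL.mono_cons]
    exact hN _ (by rw [UL.weight_cons]; omega))

theorem shift_apply (a : ℕ+) (f : HU K) (x : UL K) : toDual (shift a f) x = toDual f (UL.gen K a * x) :=
  rfl

theorem mul_gen (a : ℕ+) (f g : HU K) (x : UL K) : toDual (f * g) (UL.gen K a * x) =
    toDual (shift a f * g) x + toDual (f * shift a g) x := by
  rw [mul_apply, mul_apply, mul_apply, Bialgebra.comul_mul, UL.comul_gen]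
  generalize Coalgebra.comul (R := K) x = z
  induction z with
  | zero => simp
  | tmul p q => simp [add_mul, shift_apply]
  | add p q hp hq =>
    rw [mul_add, map_add, map_add, hp, hq]
    simp only [map_add]
    abel

variable (K)

/-- The zero pairing; its quasi-shuffle product is the shuffle product. -/
def trivialPairing (A : Type u) (deg : A → ℕ) : HoffmanPairing A deg where
  op _ _ := 0
  op_zero _ := rfl
  op_comm _ _ := rfl
  op_assoc _ _ _ := rfl
  deg_op _ _ _ h := absurd h.symm WithZero.coe_ne_zero

/-- The shuffle algebra on words in `ℕ+`. -/
abbrev Sh : Type _ := QSh K (trivialPairing ℕ+ fun n => (n : ℕ))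

/-- The coefficient of a word. -/
noncomputable def coeff (w : List ℕ+) : Sh K →ₗ[K] K := Finsupp.lapply w

theorem coeff_word (w w' : List ℕ+) :
    coeff K w (QSh.word K _ w') = if w' = w then 1 else 0 := Finsupp.single_apply

variable {K} in
theorem coeff_ext {x y : Sh K} (h : ∀ w, coeff K w x = coeff K w y) : x = y := Finsupp.ext h

/-- Removing the first letter `a`. -/
noncomputable def unshift (a : ℕ+) : Sh K →ₗ[K] Sh K :=
  Finsupp.lcomapDomain (List.cons a) (List.cons_injective)

theorem coeff_unshift (a : ℕ+) (w : List ℕ+) (x : Sh K) :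
    coeff K w (unshift K a x) = coeff K (a :: w) x := rfl

theorem unshift_one (a : ℕ+) : unshift K a 1 = 0 := coeff_ext fun w => by
  rw [coeff_unshift, QSh.one_def, coeff_word]; simp

theorem unshift_cons (a b : ℕ+) (x : Sh K) :
    unshift K a (QSh.consMap K _ b x) = if b = a then x else 0 := by
  have : unshift K a ∘ₗ QSh.consMap K _ b = if b = a then LinearMap.id else 0 := by
    refine QSh.lin_ext fun w => coeff_ext fun w' => ?_
    rw [LinearMap.comp_apply, coeff_unshift, QSh.consMap_coe, coeff_word]
    by_cases h : b = a
    · simp [h, coeff_word]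
    · simp [h]
  rw [← LinearMap.comp_apply, this]
  split_ifs <;> rfl

theorem unshift_mul (a : ℕ+) (x y : Sh K) :
    unshift K a (x * y) = unshift K a x * y + x * unshift K a y := by
  have h0 : ∀ w₁ w₂, unshift K a (QSh.word K _ w₁ * QSh.word K _ w₂) =
      unshift K a (QSh.word K _ w₁) * QSh.word K _ w₂ +
        QSh.word K _ w₁ * unshift K a (QSh.word K _ w₂) := by
    intro w₁ w₂
    rcases w₁ with _ | ⟨b, w₁⟩
    · rw [← QSh.one_def, unshift_one, one_mul, one_mul, zero_mul, zero_add]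
    rcases w₂ with _ | ⟨c, w₂⟩
    · rw [← QSh.one_def, unshift_one, mul_one, mul_one, mul_zero, add_zero]
    rw [← QSh.consMap_coe, ← QSh.consMap_coe, QSh.cons_mul_cons]
    have h0 : (trivialPairing ℕ+ fun n => (n : ℕ)).op b c = 0 := rfl
    rw [h0, QSh.consMap_zero, LinearMap.zero_apply, add_zero, map_add, unshift_cons, unshift_cons,
      unshift_cons, unshift_cons]
    split_ifs <;> simp
  have h1 : ∀ w₂ x, unshift K a (x * QSh.word K _ w₂) =
      unshift K a x * QSh.word K _ w₂ + x * unshift K a (QSh.word K _ w₂) := fun w₂ =>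
    LinearMap.congr_fun (f := unshift K a ∘ₗ LinearMap.mulRight K (QSh.word K _ w₂))
      (g := LinearMap.mulRight K (QSh.word K _ w₂) ∘ₗ unshift K a +
        LinearMap.mulRight K (unshift K a (QSh.word K _ w₂))) (QSh.lin_ext fun w₁ => h0 w₁ w₂)
  exact LinearMap.congr_fun (f := unshift K a ∘ₗ LinearMap.mulLeft K x)
    (g := LinearMap.mulLeft K (unshift K a x) + LinearMap.mulLeft K x ∘ₗ unshift K a)
    (QSh.lin_ext fun w₂ => h1 w₂ x) y

/-- The values on the products of generators. -/
noncomputable def toShLin : HU K →ₗ[K] Sh K where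
  toFun f := Finsupp.ofSupportFinite (fun w => toDual f (UL.mono K w)) (by
    obtain ⟨N, hN⟩ := exists_vanish f
    refine (UL.finite_weight_le N).subset fun w hw => ?_
    by_contra h
    exact hw (hN w (not_le.1 h)))
  map_add' f g := coeff_ext fun w => by
    change toDual (f + g) (UL.mono K w) = _
    rw [map_add]; rfl
  map_smul' c f := coeff_ext fun w => by
    change toDual (c • f) (UL.mono K w) = _
    rw [map_smul]; rfl

theorem coeff_toShLin (f : HU K) (w : List ℕ+) :
    coeff K w (toShLin K f) = toDual f (UL.mono K w) := rfl

/-- The values on the products of generators, as a linear isomorphism. -/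
noncomputable def toSh : HU K ≃ₗ[K] Sh K :=
  LinearEquiv.ofBijective (toShLin K)
    ⟨fun f g h => ext_mono fun w => congrArg (coeff K w) h,
      fun x => ⟨ofDual ((UL.basis K).constr K fun w => coeff K w x) (by
        classical
        let s : Finset (List ℕ+) := Finsupp.support (show List ℕ+ →₀ K from x)
        refine ⟨s.sup UL.weight, fun w hw => ?_⟩
        rw [← UL.basis_apply, Module.Basis.constr_basis]
        by_contra h
        exact absurd (Finset.le_sup (f := UL.weight) (Finsupp.mem_support_iff.2 h : w ∈ s))
          (not_le.2 hw)),
        coeff_ext fun w => by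
          rw [coeff_toShLin, toDual_ofDual, ← UL.basis_apply, Module.Basis.constr_basis]⟩⟩

theorem coeff_toSh (f : HU K) (w : List ℕ+) : coeff K w (toSh K f) = toDual f (UL.mono K w) := rfl

theorem toSh_shift (a : ℕ+) (f : HU K) : toSh K (shift a f) = unshift K a (toSh K f) :=
  coeff_ext fun w => by rw [coeff_unshift, coeff_toSh, coeff_toSh, shift_apply, UL.mono_cons]

theorem counit_eq_coeff (x : Sh K) : Coalgebra.counit (R := K) x = coeff K [] x := by
  have : Coalgebra.counit (R := K) (A := Sh K) = coeff K [] := QSh.lin_ext fun w => by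
    rw [coeff_word]
    exact QSh.linLift_word K _ _ w
  rw [this]

theorem toSh_mul (f g : HU K) : toSh K (f * g) = toSh K f * toSh K g := by
  refine coeff_ext fun w => ?_
  induction w generalizing f g with
  | nil =>
    rw [← counit_eq_coeff, ← counit_eq_coeff, Bialgebra.counit_mul, counit_eq_coeff,
      counit_eq_coeff, counit_eq_coeff, coeff_toSh, coeff_toSh, coeff_toSh, mul_apply, UL.mono_nil,
      Bialgebra.comul_one]
    simp [Algebra.TensorProduct.one_def]
  | cons a w ih =>
    rw [coeff_toSh, UL.mono_cons, mul_gen, ← coeff_unshift, unshift_mul, map_add, ← toSh_shift,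
      ← toSh_shift, ← ih, ← ih, coeff_toSh, coeff_toSh]

theorem toSh_one : toSh K 1 = 1 := coeff_ext fun w => by
  rw [coeff_toSh, one_apply, QSh.one_def, coeff_word]
  rcases w with _ | ⟨a, w⟩
  · rw [UL.mono_nil, Bialgebra.counit_one]; rfl
  · rw [UL.counit_mono_cons]; rfl

/-- The values on the products of generators, as an isomorphism of algebras. -/
noncomputable def toShAlg : HU K ≃ₐ[K] Sh K := AlgEquiv.ofLinearEquiv (toSh K) (toSh_one K) (toSh_mul K)

/-- The pairing of `H_U ⊗ H_U` with `U(L) ⊗ U(L)`. -/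
noncomputable def pairing : HU K ⊗[K] HU K →ₗ[K] Module.Dual K (UL K ⊗[K] UL K) :=
  TensorProduct.dualDistrib K (UL K) (UL K) ∘ₗ TensorProduct.map toDual toDual

theorem pairing_tmul (f g : HU K) (x y : UL K) :
    pairing K (f ⊗ₜ g) (x ⊗ₜ y) = toDual f x * toDual g y := rfl

/-- The coefficients of pairs of words. -/
noncomputable def coeffTwo : Sh K ⊗[K] Sh K ≃ₗ[K] (List ℕ+ × List ℕ+ →₀ K) :=
  finsuppTensorFinsupp' K (List ℕ+) (List ℕ+)

theorem coeffTwo_tmul (x y : Sh K) (u v : List ℕ+) :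
    coeffTwo K (x ⊗ₜ y) (u, v) = coeff K u x * coeff K v y :=
  finsuppTensorFinsupp'_apply_apply K _ _ _ _ u v

theorem coeffTwo_map (z : HU K ⊗[K] HU K) (u v : List ℕ+) :
    coeffTwo K (TensorProduct.map (toSh K).toLinearMap (toSh K).toLinearMap z) (u, v) =
      pairing K z (UL.mono K u ⊗ₜ UL.mono K v) := by
  induction z with
  | zero => simp
  | tmul f g =>
    rw [pairing_tmul, TensorProduct.map_tmul, ← coeff_toSh, ← coeff_toSh]
    exact coeffTwo_tmul K _ _ u v
  | add p q hp hq => simp only [map_add, Finsupp.add_apply, LinearMap.add_apply, hp, hq]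

theorem pairing_injective {s t : HU K ⊗[K] HU K}
    (h : ∀ x y, pairing K s (x ⊗ₜ y) = pairing K t (x ⊗ₜ y)) : s = t := by
  apply (TensorProduct.congr (toSh K) (toSh K)).injective
  apply (coeffTwo K).injective
  ext ⟨u, v⟩
  exact ((coeffTwo_map K s u v).trans (h _ _)).trans (coeffTwo_map K t u v).symm

theorem coeffTwo_comul (x : Sh K) (u v : List ℕ+) :
    coeffTwo K (Coalgebra.comul (R := K) x) (u, v) = coeff K (u ++ v) x := by
  have : (Finsupp.lapply (u, v) ∘ₗ (coeffTwo K).toLinearMap) ∘ₗ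
      Coalgebra.comul (R := K) (A := Sh K) = coeff K (u ++ v) := QSh.lin_ext fun w => by
    rw [LinearMap.comp_apply, QSh.comul_word, map_sum, coeff_word]
    have h : ∀ i, (Finsupp.lapply (u, v) ∘ₗ (coeffTwo K).toLinearMap)
        (QSh.word K (trivialPairing ℕ+ fun n => (n : ℕ)) (w.take i) ⊗ₜ[K] QSh.word K _ (w.drop i)) =
        if w.take i = u ∧ w.drop i = v then 1 else 0 := by
      intro i
      refine (coeffTwo_tmul K _ _ u v).trans ?_
      rw [coeff_word, coeff_word]
      split_ifs <;> simp_all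
    simp only [h]
    by_cases hw : w = u ++ v
    · rw [if_pos hw, Finset.sum_eq_single u.length, if_pos]
      · simp [hw]
      · intro i hi hne
        rw [if_neg]
        rintro ⟨h1, -⟩
        have := congrArg List.length h1
        simp only [List.length_take] at this
        simp only [Finset.mem_range] at hi
        omega
      · intro h
        simp [hw] at h
    · rw [if_neg hw]
      refine Finset.sum_eq_zero fun i _ => if_neg ?_
      rintro ⟨rfl, rfl⟩
      exact hw (List.take_append_drop i w).symm
  exact LinearMap.congr_fun this x

/-- For each `f` in `H_U`, the functional `x ⊗ y ↦ f(x y)` is given by an element of `H_U ⊗ H_U`,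
which is unique by `pairing_injective`. -/
theorem exists_comul (f : HU K) :
    ∃ t : HU K ⊗[K] HU K, ∀ x y, pairing K t (x ⊗ₜ y) = toDual f (x * y) := by
  obtain ⟨t, ht⟩ := (TensorProduct.congr (toSh K) (toSh K)).surjective
    (Coalgebra.comul (R := K) (toSh K f))
  have h1 : TensorProduct.map (toSh K).toLinearMap (toSh K).toLinearMap t =
      Coalgebra.comul (R := K) (toSh K f) := ht
  have h2 : TensorProduct.curry (pairing K t) = (LinearMap.mul K (UL K)).compr₂ (toDual f) := by
    refine (UL.basis K).ext fun u => (UL.basis K).ext fun v => ?_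
    rw [UL.basis_apply, UL.basis_apply]
    change pairing K t (UL.mono K u ⊗ₜ UL.mono K v) = toDual f (UL.mono K u * UL.mono K v)
    rw [← coeffTwo_map, h1, coeffTwo_comul, coeff_toSh, UL.mono_append]
  exact ⟨t, fun x y => LinearMap.congr_fun₂ h2 x y⟩

/-- The element `Δ f` of `H_U ⊗ H_U` with `⟨Δ f, x ⊗ y⟩ = f(x y)` for all `x` and `y`. -/
noncomputable def comulFun (f : HU K) : HU K ⊗[K] HU K := (exists_comul K f).choose

theorem pairing_comul (f : HU K) (x y : UL K) :
    pairing K (comulFun K f) (x ⊗ₜ y) = toDual f (x * y) := (exists_comul K f).choose_spec x y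

/-- The coproduct of `H_U`, the transpose of the product of `U(L)`. -/
noncomputable def comulLin : HU K →ₗ[K] HU K ⊗[K] HU K where
  toFun := comulFun K
  map_add' f g := pairing_injective K fun x y => by
    rw [map_add, LinearMap.add_apply, pairing_comul, pairing_comul, pairing_comul, map_add,
      LinearMap.add_apply]
  map_smul' c f := pairing_injective K fun x y => by
    rw [map_smul, LinearMap.smul_apply, pairing_comul, pairing_comul, map_smul,
      LinearMap.smul_apply, RingHom.id_apply]

/-- The counit `f ↦ f(1)`. -/
noncomputable def counitLin : HU K →ₗ[K] K := LinearMap.applyₗ (1 : UL K) ∘ₗ toDual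

theorem map_comulLin (f : HU K) :
    TensorProduct.map (toSh K).toLinearMap (toSh K).toLinearMap (comulLin K f) =
      Coalgebra.comul (R := K) (toSh K f) := by
  apply (coeffTwo K).injective
  ext ⟨u, v⟩
  rw [coeffTwo_map, coeffTwo_comul, coeff_toSh, UL.mono_append]
  exact pairing_comul K f _ _

noncomputable def comulHom : HU K →ₐ[K] HU K ⊗[K] HU K :=
  have h : ∀ f, Algebra.TensorProduct.congr (toShAlg K) (toShAlg K) (comulLin K f) =
    Coalgebra.comul (R := K) (toShAlg K f) := map_comulLin K
  AlgHom.ofLinearMap (comulLin K)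
    ((Algebra.TensorProduct.congr (toShAlg K) (toShAlg K)).injective (by
      rw [h, map_one (toShAlg K), Bialgebra.comul_one, map_one]))
    (fun f g => (Algebra.TensorProduct.congr (toShAlg K) (toShAlg K)).injective (by
      rw [h, map_mul (toShAlg K), Bialgebra.comul_mul, map_mul, h, h]))

noncomputable def counitHom : HU K →ₐ[K] K :=
  have h : ∀ f, counitLin K f = Coalgebra.counit (R := K) (toShAlg K f) := fun f =>
    (counit_eq_coeff K (toSh K f)).symm
  AlgHom.ofLinearMap (counitLin K) (by rw [h, map_one, Bialgebra.counit_one])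
    (fun f g => by rw [h, h, h, map_mul, Bialgebra.counit_mul])

noncomputable instance : Bialgebra K (HU K) :=
  bialgebraOfEquiv (toShAlg K) (comulHom K) (counitHom K) (LinearMap.ext (map_comulLin K))
    (LinearMap.ext fun f => counit_eq_coeff K (toSh K f))

theorem comul_eq : Coalgebra.comul (R := K) (A := HU K) = comulLin K := rfl

theorem counit_eq : Coalgebra.counit (R := K) (A := HU K) = counitLin K := rfl

noncomputable instance : HopfAlgebra K (HU K) :=
  hopfOfExists (exists_antipode (fun w => (toSh K).symm (QSh.word K _ w)) List.length
    (by
      have : Set.range (fun w => (toSh K).symm (QSh.word K _ w)) =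
          (toSh K).symm.toLinearMap '' Set.range (QSh.word K _) := by
        rw [← Set.range_comp]; rfl
      rw [this, Submodule.span_image, QSh.span_word, Submodule.map_top, LinearMap.range_eq_top]
      exact (toSh K).symm.surjective)
    (fun w => by
      have h : Coalgebra.comul (R := K) ((toSh K).symm (QSh.word K _ w)) =
          ∑ i ∈ Finset.range (w.length + 1), (toSh K).symm (QSh.word K _ (w.take i)) ⊗ₜ[K]
            (toSh K).symm (QSh.word K _ (w.drop i)) := by
        apply (TensorProduct.congr (toSh K) (toSh K)).injective
        refine (map_comulLin K _).trans ?_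
        rw [LinearEquiv.apply_symm_apply, QSh.comul_word, map_sum]
        simp
      rw [h]
      refine Submodule.sum_mem _ fun i _ => Submodule.subset_span ⟨_, _, ?_, rfl⟩
      rw [← List.length_append, List.take_append_drop])
    (fun w hw => by
      have h1 : (toSh K).symm (QSh.word K _ []) = 1 := (toSh K).injective (by
        rw [LinearEquiv.apply_symm_apply, toSh_one]; rfl)
      rw [List.length_eq_zero_iff.1 hw, h1]
      simp))

end HU

end RenHopf

/-! All the Hopf algebras are compared with a single target, the shuffle Hopf algebra on words in
`A`. Let `H` be a commutative bialgebra with an infinitesimal character `f a` for each letter. If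
for each `x` only finitely many words contribute, then `x ↦ ∑ (f_{a₁} * ⋯ * f_{aₙ})(x) a₁⋯aₙ` is a
homomorphism of bialgebras (`toShuffle`). It respects coproducts because deconcatenation is dual to
concatenation of words, which convolution mirrors. It respects products because contracting with an
infinitesimal character and removing the first letter of a shuffle are both derivations
(`contract_mul`, `Shuffle.unshift_mul`).

A surjective homomorphism of commutative Hopf algebras has a Hopf ideal as its kernel, and the
quotient by it is the target (`exists_quotient_equiv`). So it suffices to find suitable
infinitesimal characters that give surjections from `K[T(A)]`, `H_CK(A)` and `H_NAP(A)`, and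
isomorphisms from the quasi-shuffle algebra and from `H_U`.

Forests: `f a` detects the single vertex labelled `a`. The iterated coproduct strips off maximal
vertices one by one, so the coefficient of a word counts the linear extensions that spell it
(`Forest.convWord_vertex`). The homomorphism is therefore `π`, whose kernel is `I`, and a ladder
goes to the word of its labels. `H_CK(A)` is isomorphic to `K[T(A)]`, since forests are the
monomials in trees.

`NAP`: `f a` detects an interval whose least and greatest elements are joined by a relation of
colour `a`. Stacking a chain of vertices from the top down gives an interval that is itself a chain
with prescribed colours, so that every word is reached (`HNAP.convWord_rung`).

Quasi-shuffles: `f a` sends a word of `n` letters with Hoffman product `a` to the coefficient of `X`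
in the binomial polynomial `X choose n`, which is `(-1)^(n-1)/n`; this is Hoffman's logarithm. It is
infinitesimal because words of length `n` go to `X choose n` multiplicatively as long as the product
of the letters is not `0`, and because a product of two polynomials without constant term has no
linear term (`QSh.isInfinitesimal_logFun`). The resulting map is unitriangular with respect to
length, hence bijective (`QSh.toShuffle_bijective`). Characteristic `0` enters only here.

`H_U`: the products of generators form a basis of `U(L)`, and the values on them identify `H_U` with
the shuffle algebra on `ℕ+` (`HU.toShAlg`). -/

namespace RenHopf

universe u

/-! ### Kernels of surjective homomorphisms as Hopf ideals. -/

section HopfQuotient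

open WithConv

variable {K H H' : Type*} [CommRing K] [CommRing H] [CommRing H'] [HopfAlgebra K H]
  [HopfAlgebra K H']

/-- A homomorphism of bialgebras commutes with the antipodes. -/
theorem map_antipode (f : H →ₐc[K] H') (x : H) :
    f (HopfAlgebra.antipode K x) = HopfAlgebra.antipode K (f x) := by
  let F : H →ₗ[K] H' := (f : H →ₗc[K] H').toLinearMap
  -- In the convolution algebra of linear maps `H → H'`, the two candidates are a left and a right
  -- inverse of `F`, hence equal.
  have h1 : toConv (F ∘ₗ HopfAlgebra.antipode K) * toConv F = (1 : WithConv (H →ₗ[K] H')) := by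
    have h := LinearMap.algHom_comp_convMul_distrib (f : H →ₐ[K] H')
      (toConv (HopfAlgebra.antipode K (A := H))) (toConv LinearMap.id)
    ext y
    have h2 := LinearMap.congr_fun h y
    refine h2.symm.trans ?_
    change f (LinearMap.mul' K H (TensorProduct.map _ LinearMap.id (Coalgebra.comul y))) = _
    exact (congrArg f (HopfAlgebra.mul_antipode_rTensor_comul_apply (R := K) y)).trans
      (AlgHomClass.commutes f _)
  have h2 : toConv F * toConv (HopfAlgebra.antipode K ∘ₗ F) = (1 : WithConv (H →ₗ[K] H')) := by
    have h := LinearMap.convMul_comp_coalgHom_distrib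
      (toConv LinearMap.id) (toConv (HopfAlgebra.antipode K (A := H'))) (f : H →ₗc[K] H')
    ext y
    have h2 := LinearMap.congr_fun h y
    refine h2.symm.trans ?_
    change LinearMap.mul' K H' (TensorProduct.map LinearMap.id _ (Coalgebra.comul (f y))) = _
    refine (HopfAlgebra.mul_antipode_lTensor_comul_apply (R := K) (f y)).trans ?_
    exact congrArg _ (CoalgHomClass.counit_comp_apply f y)
  have h3 := left_inv_eq_right_inv h1 h2
  exact LinearMap.congr_fun (congrArg ofConv h3) x

/-- The kernel of a surjective homomorphism of commutative Hopf algebras is a Hopf ideal, and the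
target is the quotient by it. -/
theorem exists_quotient_equiv (f : H →ₐc[K] H') (hf : Function.Surjective f) :
    ∃ _ : (RingHom.ker f).IsHopfIdeal K, Nonempty ((H ⧸ RingHom.ker f) ≃ₐc[K] H') := by
  let e : (H ⧸ RingHom.ker f) ≃ₐ[K] H' :=
    Ideal.quotientKerAlgEquivOfSurjective (f := (f : H →ₐ[K] H')) hf
  -- Composing `e` with the quotient map gives `f` back, so the left side is `(f ⊗ f)(Δ x)`. This
  -- yields both the coideal condition and the compatibility of `e` with the coproducts.
  have hΔ : ∀ x, TensorProduct.map e.toLinearMap e.toLinearMap (TensorProduct.map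
      (Ideal.Quotient.mkₐ K (RingHom.ker f)).toLinearMap
      (Ideal.Quotient.mkₐ K (RingHom.ker f)).toLinearMap (Coalgebra.comul (R := K) x)) =
        Coalgebra.comul (R := K) (f x) := fun x => by
    rw [← CoalgHomClass.map_comp_comul_apply f x]
    generalize Coalgebra.comul (R := K) x = z
    induction z with
    | zero => simp
    | tmul p q => rfl
    | add p q hp hq => simp only [map_add, hp, hq]
  have hI : (RingHom.ker f).IsHopfIdeal K :=
    { counit_eq_zero := fun x hx => by
        have hx : f x = 0 := hx
        rw [← CoalgHomClass.counit_comp_apply f x, hx, map_zero]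
      map_mkQ_comul_eq_zero := fun x hx => by
        have hx : f x = 0 := hx
        have h : TensorProduct.map (Ideal.Quotient.mkₐ K (RingHom.ker f)).toLinearMap
            (Ideal.Quotient.mkₐ K (RingHom.ker f)).toLinearMap (Coalgebra.comul (R := K) x) = 0 := by
          -- The vanishing may be tested after the isomorphism `e ⊗ e`, where the element becomes
          -- `Δ(f x) = 0`.
          apply (TensorProduct.congr e.toLinearEquiv e.toLinearEquiv).injective
          refine (hΔ x).trans ?_
          rw [hx, map_zero, map_zero]
        exact h
      antipode_mem := fun x hx => by
        have hx : f x = 0 := hx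
        change f _ = 0
        rw [map_antipode, hx, map_zero] }
  refine ⟨hI, ⟨BialgEquiv.ofAlgEquiv e ?_ ?_⟩⟩
  · refine Ideal.Quotient.algHom_ext K (AlgHom.ext fun x => ?_)
    exact CoalgHomClass.counit_comp_apply f x
  · refine Ideal.Quotient.algHom_ext K (AlgHom.ext fun x => ?_)
    exact hΔ x

end HopfQuotient

/-! ### Coefficients and left derivations of the shuffle algebra. -/

/-- The shuffle algebra on words in `A`. -/
abbrev Shuffle (K : Type*) [CommRing K] (A : Type u) (deg : A → ℕ) : Type _ :=
  QSh K (HU.trivialPairing A deg)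

namespace Shuffle

variable (K : Type*) [CommRing K] {A : Type u} {deg : A → ℕ}

/-- The coefficient of a word. -/
noncomputable def coeff (w : List A) : Shuffle K A deg →ₗ[K] K := Finsupp.lapply w

open Classical in
theorem coeff_word (w w' : List A) :
    coeff K (deg := deg) w (QSh.word K _ w') = if w' = w then 1 else 0 := Finsupp.single_apply

variable {K} in
theorem coeff_ext {x y : Shuffle K A deg} (h : ∀ w, coeff K w x = coeff K w y) : x = y :=
  Finsupp.ext h

/-- Removing the first letter `a`. -/
noncomputable def unshift (a : A) : Shuffle K A deg →ₗ[K] Shuffle K A deg :=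
  Finsupp.lcomapDomain (List.cons a) (List.cons_injective)

theorem coeff_unshift (a : A) (w : List A) (x : Shuffle K A deg) :
    coeff K w (unshift K a x) = coeff K (a :: w) x := rfl

theorem unshift_one (a : A) : unshift K (deg := deg) a 1 = 0 := coeff_ext fun w => by
  rw [coeff_unshift, QSh.one_def, coeff_word]; simp

open Classical in
theorem unshift_cons (a b : A) (x : Shuffle K A deg) :
    unshift K a (QSh.consMap K _ b x) = if b = a then x else 0 := by
  have : unshift K (deg := deg) a ∘ₗ QSh.consMap K _ b = if b = a then LinearMap.id else 0 := by
    refine QSh.lin_ext fun w => coeff_ext fun w' => ?_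
    rw [LinearMap.comp_apply, coeff_unshift, QSh.consMap_coe, coeff_word]
    by_cases h : b = a
    · simp [h, coeff_word]
    · simp [h]
  rw [← LinearMap.comp_apply, this]
  split_ifs <;> rfl

/-- For the zero pairing the merged term of the product recursion disappears, so the first letter of
a shuffle comes from exactly one of the two factors. -/
theorem unshift_mul (a : A) (x y : Shuffle K A deg) :
    unshift K a (x * y) = unshift K a x * y + x * unshift K a y := by
  have h0 : ∀ w₁ w₂, unshift K a
      (QSh.word K (HU.trivialPairing A deg) w₁ * QSh.word K (HU.trivialPairing A deg) w₂) =
      unshift K a (QSh.word K (HU.trivialPairing A deg) w₁) * QSh.word K (HU.trivialPairing A deg) w₂ +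
        QSh.word K (HU.trivialPairing A deg) w₁ * unshift K a (QSh.word K (HU.trivialPairing A deg) w₂) := by
    intro w₁ w₂
    rcases w₁ with _ | ⟨b, w₁⟩
    · rw [← QSh.one_def, unshift_one, one_mul, one_mul, zero_mul, zero_add]
    rcases w₂ with _ | ⟨c, w₂⟩
    · rw [← QSh.one_def, unshift_one, mul_one, mul_one, mul_zero, add_zero]
    rw [← QSh.consMap_coe, ← QSh.consMap_coe, QSh.cons_mul_cons]
    have h0 : (HU.trivialPairing A deg).op b c = 0 := rfl
    rw [h0, QSh.consMap_zero, LinearMap.zero_apply, add_zero, map_add, unshift_cons, unshift_cons,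
      unshift_cons, unshift_cons]
    split_ifs <;> simp
  have h1 : ∀ w₂ (x : Shuffle K A deg), unshift K a (x * QSh.word K (HU.trivialPairing A deg) w₂) =
      unshift K a x * QSh.word K (HU.trivialPairing A deg) w₂ +
        x * unshift K a (QSh.word K (HU.trivialPairing A deg) w₂) := fun w₂ =>
    LinearMap.congr_fun (f := unshift K a ∘ₗ LinearMap.mulRight K (QSh.word K (HU.trivialPairing A deg) w₂))
      (g := LinearMap.mulRight K (QSh.word K (HU.trivialPairing A deg) w₂) ∘ₗ unshift K a +
        LinearMap.mulRight K (unshift K a (QSh.word K (HU.trivialPairing A deg) w₂))) (QSh.lin_ext fun w₁ => h0 w₁ w₂)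
  exact LinearMap.congr_fun (f := unshift K a ∘ₗ LinearMap.mulLeft K x)
    (g := LinearMap.mulLeft K (unshift K a x) + LinearMap.mulLeft K x ∘ₗ unshift K a)
    (QSh.lin_ext fun w₂ => h1 w₂ x) y

theorem counit_eq_coeff (x : Shuffle K A deg) : Coalgebra.counit (R := K) x = coeff K [] x := by
  have : Coalgebra.counit (R := K) (A := Shuffle K A deg) = coeff K [] := QSh.lin_ext fun w => by
    classical
    rw [coeff_word]
    refine (QSh.linLift_word K _ _ w).trans ?_
    congr
  rw [this]

/-- The coefficients of pairs of words. -/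
noncomputable def coeffTwo : Shuffle K A deg ⊗[K] Shuffle K A deg ≃ₗ[K] (List A × List A →₀ K) :=
  finsuppTensorFinsupp' K (List A) (List A)

theorem coeffTwo_tmul (x y : Shuffle K A deg) (u v : List A) :
    coeffTwo K (x ⊗ₜ y) (u, v) = coeff K u x * coeff K v y :=
  finsuppTensorFinsupp'_apply_apply K _ _ _ _ u v

/-- Among the cuts of a word, only the one after `u.length` letters can have `u` as its first part.
This is the duality between deconcatenation and concatenation that matches `convWord_append`. -/
theorem coeffTwo_comul (x : Shuffle K A deg) (u v : List A) :
    coeffTwo K (Coalgebra.comul (R := K) x) (u, v) = coeff K (u ++ v) x := by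
  classical
  have : (Finsupp.lapply (u, v) ∘ₗ (coeffTwo K).toLinearMap) ∘ₗ
      Coalgebra.comul (R := K) (A := Shuffle K A deg) = coeff K (u ++ v) := QSh.lin_ext fun w => by
    rw [LinearMap.comp_apply, QSh.comul_word, map_sum, coeff_word]
    have h : ∀ i, (Finsupp.lapply (u, v) ∘ₗ (coeffTwo K).toLinearMap)
        (QSh.word K (HU.trivialPairing A deg) (w.take i) ⊗ₜ[K] QSh.word K _ (w.drop i)) =
        if w.take i = u ∧ w.drop i = v then 1 else 0 := by
      intro i
      refine (coeffTwo_tmul K _ _ u v).trans ?_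
      rw [coeff_word, coeff_word]
      split_ifs <;> simp_all
    simp only [h]
    by_cases hw : w = u ++ v
    · rw [if_pos hw, Finset.sum_eq_single u.length, if_pos]
      · simp [hw]
      · intro i hi hne
        rw [if_neg]
        rintro ⟨h1, -⟩
        have := congrArg List.length h1
        simp only [List.length_take] at this
        simp only [Finset.mem_range] at hi
        omega
      · intro h
        simp [hw] at h
    · rw [if_neg hw]
      refine Finset.sum_eq_zero fun i _ => if_neg ?_
      rintro ⟨rfl, rfl⟩
      exact hw (List.take_append_drop i w).symm
  exact LinearMap.congr_fun this x

end Shuffle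

/-! ### Homomorphisms to the shuffle algebra from infinitesimal characters. -/

section ToShuffle

open WithConv

variable {K H : Type*} [CommRing K] [CommRing H] [Bialgebra K H] {A : Type u}

/-- Infinitesimal characters: the derivations with values in the trivial module. -/
def IsInfinitesimal (f : H →ₗ[K] K) : Prop :=
  ∀ x y, f (x * y) = f x * Coalgebra.counit (R := K) y + Coalgebra.counit (R := K) x * f y

/-- The convolution product of the functionals that belong to the letters of a word. -/
noncomputable def convWord (f : A → H →ₗ[K] K) (w : List A) : WithConv (H →ₗ[K] K) :=
  (w.map fun a => toConv (f a)).prod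

/-- `x ↦ (f ⊗ id)(Δ x)`. -/
noncomputable def contract (f : H →ₗ[K] K) : H →ₗ[K] H :=
  (TensorProduct.lid K H).toLinearMap ∘ₗ f.rTensor H ∘ₗ Coalgebra.comul

theorem convWord_nil (f : A → H →ₗ[K] K) (x : H) :
    (convWord f []).ofConv x = Coalgebra.counit (R := K) x := rfl

theorem convWord_cons (f : A → H →ₗ[K] K) (a : A) (w : List A) (x : H) :
    (convWord f (a :: w)).ofConv x =
      LinearMap.mul' K K (TensorProduct.map (f a) (convWord f w).ofConv (Coalgebra.comul x)) := by
  rw [convWord, List.map_cons, List.prod_cons]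
  rfl

theorem convWord_append (f : A → H →ₗ[K] K) (u v : List A) (x : H) :
    (convWord f (u ++ v)).ofConv x = LinearMap.mul' K K
      (TensorProduct.map (convWord f u).ofConv (convWord f v).ofConv (Coalgebra.comul x)) := by
  rw [convWord, List.map_append, List.prod_append]
  rfl

/-- The first functional can be applied to the argument beforehand. This makes `contract (f a)` the
counterpart of removing the first letter `a`. -/
theorem convWord_cons_eq_contract (f : A → H →ₗ[K] K) (a : A) (w : List A) (x : H) :
    (convWord f (a :: w)).ofConv x = (convWord f w).ofConv (contract (f a) x) := by
  rw [convWord_cons, contract, LinearMap.comp_apply, LinearMap.comp_apply]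
  generalize Coalgebra.comul (R := K) x = z
  induction z with
  | zero => simp
  | tmul p q => simp
  | add p q hp hq => simp only [map_add, hp, hq]

/-- `Δ` is multiplicative and `f` obeys the Leibniz rule with respect to the counit; contracting the
other factor with the counit returns it unchanged. Hence the contraction is a derivation. -/
theorem contract_mul {f : H →ₗ[K] K} (hf : IsInfinitesimal f) (x y : H) :
    contract f (x * y) = contract f x * y + x * contract f y := by
  have key : ∀ z z' : H ⊗[K] H, TensorProduct.lid K H (f.rTensor H (z * z')) =
      TensorProduct.lid K H (f.rTensor H z) *
          TensorProduct.lid K H ((Coalgebra.counit (R := K)).rTensor H z') +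
        TensorProduct.lid K H ((Coalgebra.counit (R := K)).rTensor H z) *
          TensorProduct.lid K H (f.rTensor H z') := by
    intro z z'
    induction z with
    | zero => simp
    | add p q hp hq => simp only [map_add, add_mul, hp, hq]; abel
    | tmul p q =>
    induction z' with
    | zero => simp
    | add p q hp hq => simp only [map_add, mul_add, hp, hq]; abel
    | tmul p' q' =>
      simp only [Algebra.TensorProduct.tmul_mul_tmul, LinearMap.rTensor_tmul, TensorProduct.lid_tmul,
        hf p p', add_smul, smul_mul_smul_comm]
  -- For coproducts, the contractions with the counit in `key` collapse to `x` and `y`.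
  have h := key (Coalgebra.comul x) (Coalgebra.comul y)
  rw [← Bialgebra.comul_mul, Coalgebra.rTensor_counit_comul, Coalgebra.rTensor_counit_comul,
    TensorProduct.lid_tmul, TensorProduct.lid_tmul, one_smul, one_smul] at h
  exact h

variable (f : A → H →ₗ[K] K) (hfin : ∀ x, {w | (convWord f w).ofConv x ≠ 0}.Finite)
  (deg : A → ℕ)

/-- `x ↦ ∑ (f_{a₁} * ⋯ * f_{aₙ})(x) a₁ ⋯ aₙ`, the sum over all words. -/
noncomputable def toShuffleLin : H →ₗ[K] Shuffle K A deg where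
  toFun x := Finsupp.ofSupportFinite (fun w => (convWord f w).ofConv x) (hfin x)
  map_add' x y := Shuffle.coeff_ext fun w => map_add (convWord f w).ofConv x y
  map_smul' c x := Shuffle.coeff_ext fun w => map_smul (convWord f w).ofConv c x

theorem coeff_toShuffleLin (w : List A) (x : H) :
    Shuffle.coeff K w (toShuffleLin f hfin deg x) = (convWord f w).ofConv x := rfl

theorem toShuffleLin_contract (a : A) (x : H) :
    toShuffleLin f hfin deg (contract (f a) x) = Shuffle.unshift K a (toShuffleLin f hfin deg x) :=
  Shuffle.coeff_ext fun w => by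
    rw [Shuffle.coeff_unshift, coeff_toShuffleLin, coeff_toShuffleLin, convWord_cons_eq_contract]

/-- Coefficients are compared by induction on the word. Taking off the first letter is a derivation
on both sides, and the map intertwines these derivations, so the induction hypothesis applies to the
two products in the Leibniz rule. -/
theorem toShuffleLin_mul (hf : ∀ a, IsInfinitesimal (f a)) (x y : H) :
    toShuffleLin f hfin deg (x * y) = toShuffleLin f hfin deg x * toShuffleLin f hfin deg y := by
  refine Shuffle.coeff_ext fun w => ?_
  induction w generalizing x y with
  | nil =>
    rw [← Shuffle.counit_eq_coeff K (_ * _), Bialgebra.counit_mul, Shuffle.counit_eq_coeff,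
      Shuffle.counit_eq_coeff, coeff_toShuffleLin, coeff_toShuffleLin, coeff_toShuffleLin,
      convWord_nil, convWord_nil, convWord_nil, Bialgebra.counit_mul]
  | cons a w ih =>
    rw [← Shuffle.coeff_unshift, ← toShuffleLin_contract, contract_mul (hf a), map_add, map_add, ih,
      ih, toShuffleLin_contract, toShuffleLin_contract, ← map_add, ← Shuffle.unshift_mul,
      Shuffle.coeff_unshift]

theorem convWord_cons_one (hf : ∀ a, IsInfinitesimal (f a)) (a : A) (w : List A) :
    (convWord f (a :: w)).ofConv (1 : H) = 0 := by
  -- The Leibniz rule for `1 * 1` reads `f(1) = f(1) + f(1)`.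
  have h : f a 1 = 0 := by
    have := hf a 1 1
    simpa using this
  rw [convWord_cons, Bialgebra.comul_one, Algebra.TensorProduct.one_def]
  simp [h]

theorem toShuffleLin_one (hf : ∀ a, IsInfinitesimal (f a)) : toShuffleLin f hfin deg 1 = 1 := by
  classical
  refine Shuffle.coeff_ext fun w => ?_
  rw [coeff_toShuffleLin, QSh.one_def, Shuffle.coeff_word]
  rcases w with _ | ⟨a, w⟩
  · rw [convWord_nil, Bialgebra.counit_one, if_pos rfl]
  · rw [convWord_cons_one f hf, if_neg (by simp)]

/-- The homomorphism of bialgebras to the shuffle algebra determined by a family of infinitesimal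
characters. -/
noncomputable def toShuffle (hf : ∀ a, IsInfinitesimal (f a)) : H →ₐc[K] Shuffle K A deg :=
  .ofAlgHom (AlgHom.ofLinearMap (toShuffleLin f hfin deg) (toShuffleLin_one f hfin deg hf)
      (toShuffleLin_mul f hfin deg hf))
    (AlgHom.ext fun x => Shuffle.counit_eq_coeff K (toShuffleLin f hfin deg x))
    (AlgHom.ext fun x => by
      apply (Shuffle.coeffTwo K).injective
      ext ⟨u, v⟩
      -- At the pair `(u, v)`, both coproducts have the coefficient that belongs to the word `u ++
      -- v`.
      refine Eq.trans ?_ (Shuffle.coeffTwo_comul K (toShuffleLin f hfin deg x) u v).symm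
      rw [coeff_toShuffleLin, convWord_append]
      change Shuffle.coeffTwo K (TensorProduct.map (toShuffleLin f hfin deg)
        (toShuffleLin f hfin deg) (Coalgebra.comul (R := K) x)) (u, v) = _
      generalize Coalgebra.comul (R := K) x = z
      induction z with
      | zero => simp
      | tmul p q => exact Shuffle.coeffTwo_tmul K _ _ u v
      | add p q hp hq => simp only [map_add, Finsupp.add_apply, hp, hq])

theorem coeff_toShuffle (hf : ∀ a, IsInfinitesimal (f a)) (w : List A) (x : H) :
    Shuffle.coeff K w (toShuffle f hfin deg hf x) = (convWord f w).ofConv x := rfl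

/-- The words with a non-zero value at a sum lie in the union of those for the summands, so
finiteness only has to be checked on a spanning set. -/
theorem finite_convWord_of_span {f : A → H →ₗ[K] K} {s : Set H} (hs : Submodule.span K s = ⊤)
    (h : ∀ x ∈ s, {w | (convWord f w).ofConv x ≠ 0}.Finite) (x : H) :
    {w | (convWord f w).ofConv x ≠ 0}.Finite := by
  have hx : x ∈ Submodule.span K s := hs ▸ Submodule.mem_top
  induction hx using Submodule.span_induction with
  | mem x hx => exact h x hx
  | zero => simp
  | add x y _ _ hx hy =>
    refine (hx.union hy).subset fun w hw => ?_
    by_contra hn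
    rw [Set.mem_union, not_or] at hn
    simp only [Set.mem_ofPred_eq, not_not] at hn
    exact hw (by rw [map_add, hn.1, hn.2, add_zero])
  | smul c x _ hx =>
    refine hx.subset fun w hw h0 => hw ?_
    rw [map_smul, h0, smul_zero]

end ToShuffle

/-! ### Infinitesimal characters of algebras with a monoid basis. -/

section SplitToShuffle

open SplitMonoid

variable {K M : Type*} [CommRing K] [CommMonoid M] [SplitMonoid M] {A : Type u}

-- The counit is `1` or `0` on basis elements, so the Leibniz rule reduces to a condition on the
-- monoid: `f` lives on indecomposable elements.
open Classical in
theorem isInfinitesimal_linLift {f : M → K}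
    (hf : ∀ x y, f (x * y) = f x * (if y = 1 then 1 else 0) + (if x = 1 then 1 else 0) * f y) :
    IsInfinitesimal (SplitAlgebra.linLift (K := K) f) := by
  intro x y
  let F := SplitAlgebra.linLift (K := K) f
  have h : (LinearMap.mul K (SplitAlgebra K M)).compr₂ F =
      (LinearMap.mul K K).compl₁₂ F Coalgebra.counit +
        (LinearMap.mul K K).compl₁₂ Coalgebra.counit F := by
    refine LinearMap.ext_on_range SplitAlgebra.span_of fun m =>
      LinearMap.ext_on_range SplitAlgebra.span_of fun n => ?_
    simp only [LinearMap.compr₂_apply, LinearMap.mul_apply', LinearMap.add_apply,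
      LinearMap.compl₁₂_apply, ← map_mul, F, SplitAlgebra.linLift_of, SplitAlgebra.counit_of, hf]
  exact LinearMap.congr_fun₂ h x y

theorem convWord_cons_of (f : A → M → K) (a : A) (w : List A) (m : M) :
    (convWord (fun a => SplitAlgebra.linLift (K := K) (f a)) (a :: w)).ofConv (SplitAlgebra.of K m) =
      ((split m).map fun p => f a p.1 * (convWord (fun a => SplitAlgebra.linLift (K := K) (f a))
        w).ofConv (SplitAlgebra.of K p.2)).sum := by
  rw [convWord_cons, SplitAlgebra.comul_of, map_multiset_sum, map_multiset_sum, Multiset.map_map,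
    Multiset.map_map]
  refine congrArg Multiset.sum (Multiset.map_congr rfl fun p _ => ?_)
  change SplitAlgebra.linLift (K := K) (f a) (SplitAlgebra.of K p.1) * _ = _
  rw [SplitAlgebra.linLift_of]

/-- Each letter has to consume a left part different from `1`, as the functionals vanish at `1`. The
degree of what remains drops, so only finitely many words can be read off. -/
theorem finite_convWord (f : A → M → K) (h1 : ∀ a, f a 1 = 0)
    (hfin : ∀ m, {a | f a m ≠ 0}.Finite) (x : SplitAlgebra K M) :
    {w | (convWord (fun a => SplitAlgebra.linLift (K := K) (f a)) w).ofConv x ≠ 0}.Finite := by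
  refine finite_convWord_of_span SplitAlgebra.span_of ?_ x
  rintro _ ⟨m, rfl⟩
  obtain ⟨d, hd1, hd2⟩ := exists_deg (M := M)
  induction hn : d m using Nat.strong_induction_on generalizing m with
  | _ n ih =>
  have hsub : {w | (convWord (fun a => SplitAlgebra.linLift (K := K) (f a)) w).ofConv
      (SplitAlgebra.of K m) ≠ 0} ⊆ {[]} ∪ ⋃ p ∈ {p | p ∈ split m ∧ p.1 ≠ 1},
        Set.image2 List.cons {a | f a p.1 ≠ 0} {w | (convWord (fun a =>
          SplitAlgebra.linLift (K := K) (f a)) w).ofConv (SplitAlgebra.of K p.2) ≠ 0} := by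
    rintro (_ | ⟨a, w⟩) hw
    · exact Or.inl rfl
    · rw [Set.mem_ofPred_eq, convWord_cons_of] at hw
      obtain ⟨p, hp, hne⟩ : ∃ p ∈ split m, f a p.1 * (convWord (fun a =>
          SplitAlgebra.linLift (K := K) (f a)) w).ofConv (SplitAlgebra.of K p.2) ≠ 0 := by
        by_contra hcon
        push Not at hcon
        exact hw (Multiset.sum_eq_zero fun z hz => by
          obtain ⟨p, hp, rfl⟩ := Multiset.mem_map.1 hz
          exact hcon p hp)
      have hp1 : p.1 ≠ 1 := fun h => hne (by rw [h, h1, zero_mul])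
      refine Or.inr (Set.mem_biUnion (x := p) ⟨hp, hp1⟩ ⟨a, left_ne_zero_of_mul hne, w,
        right_ne_zero_of_mul hne, rfl⟩)
  refine ((Set.finite_singleton _).union (Set.Finite.biUnion ?_ ?_)).subset hsub
  · classical
    exact (split m).toFinset.finite_toSet.subset fun p hp => by simpa using hp.1
  · rintro p ⟨hp, hp1⟩
    have h3 := hd2 m p hp
    -- Only `1` has degree `0`; so the right part has strictly smaller degree than `m`.
    have h4 : d p.1 ≠ 0 := fun h => hp1 (hd1 _ h)
    exact Set.Finite.image2 _ (hfin _) (ih (d p.2) (by omega) p.2 rfl)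

end SplitToShuffle

theorem sum_family {α M : Type*} [Fintype α] [AddCommMonoid M] (g : α → M) :
    (family g).sum = ∑ a, g a := by
  rw [family, Subsingleton.elim (Fintype.ofFinite α) ‹Fintype α›]
  rfl

/-! ### Forests: `π` as a surjective homomorphism to the shuffle algebra. -/

namespace Forest

variable {A : Type u}

/-- The forest consists of a single vertex, which is labelled by `a`. -/
def IsVertex (a : A) (u : Forest A) : Prop :=
  Forest.lift (fun U : ForestPoset A => ∃ x : U.V, (∀ y, y = x) ∧ U.label x = a)
    (fun U W h => by
      have key : ∀ {U W : ForestPoset A}, U.Iso W → (∃ x : U.V, (∀ y, y = x) ∧ U.label x = a) →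
          ∃ x : W.V, (∀ y, y = x) ∧ W.label x = a := by
        rintro U W ⟨e, he⟩ ⟨x, hx, hl⟩
        exact ⟨e x, fun y => by rw [← hx (e.symm y)]; simp, by rw [he, hl]⟩
      exact propext ⟨key h, key h.symm⟩) u

theorem isVertex_mk {a : A} {U : ForestPoset A} :
    IsVertex a (mk U) ↔ ∃ x : U.V, (∀ y, y = x) ∧ U.label x = a := Iff.rfl

theorem not_isVertex_one (a : A) : ¬ IsVertex a (1 : Forest A) := by
  rintro ⟨x, -⟩
  exact Empty.elim x

/-- A one-vertex forest is not a disjoint union of two non-empty ones, which is what makes its dual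
functional infinitesimal. -/
theorem isVertex_mul {a : A} {u v : Forest A} :
    IsVertex a (u * v) ↔ (IsVertex a u ∧ v = 1) ∨ (u = 1 ∧ IsVertex a v) := by
  constructor
  · obtain ⟨U⟩ := u
    obtain ⟨W⟩ := v
    rintro ⟨x | x, hx, hl⟩
    · refine Or.inl ⟨⟨x, fun y => Sum.inl_injective (hx (.inl y)), hl⟩, mk_eq_one.2 ⟨fun y => ?_⟩⟩
      exact Sum.inr_ne_inl (hx (.inr y))
    · refine Or.inr ⟨mk_eq_one.2 ⟨fun y => ?_⟩, ⟨x, fun y => Sum.inr_injective (hx (.inr y)), hl⟩⟩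
      exact Sum.inl_ne_inr (hx (.inl y))
  · rintro (⟨h, rfl⟩ | ⟨rfl, h⟩)
    · rwa [mul_one]
    · rwa [one_mul]

theorem IsVertex.unique {a b : A} {u : Forest A} (ha : IsVertex a u) (hb : IsVertex b u) : a = b := by
  obtain ⟨U⟩ := u
  obtain ⟨x, hx, rfl⟩ := ha
  obtain ⟨y, -, rfl⟩ := hb
  rw [hx y]

open Classical in
/-- The functional that picks out the one-vertex forest labelled by `a`. -/
noncomputable def vertexFun (K : Type*) [CommRing K] (a : A) (u : Forest A) : K :=
  if IsVertex a u then 1 else 0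

variable (K : Type*) [CommRing K]

open Classical in
theorem vertexFun_mul (a : A) (u v : Forest A) : vertexFun K a (u * v) =
    vertexFun K a u * (if v = 1 then 1 else 0) + (if u = 1 then 1 else 0) * vertexFun K a v := by
  simp only [vertexFun, isVertex_mul]
  by_cases hu : u = 1 <;> by_cases hv : v = 1 <;> simp [hu, hv, not_isVertex_one]

/-- The vertex functionals, extended linearly. -/
noncomputable def vertexLin (a : A) : KT K A →ₗ[K] K := SplitAlgebra.linLift (vertexFun K a)

theorem finite_convWord_vertex (x : KT K A) :
    {w | (convWord (vertexLin K (A := A)) w).ofConv x ≠ 0}.Finite := by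
  refine finite_convWord (vertexFun K) (fun a => if_neg (not_isVertex_one a)) (fun u => ?_) x
  refine Set.Subsingleton.finite fun a ha b hb => ?_
  have h : ∀ {c}, vertexFun K c u ≠ 0 → IsVertex c u := fun h => by
    by_contra hc
    exact h (if_neg hc)
  exact (h ha).unique (h hb)

/-- The homomorphism of bialgebras from `K[T(A)]` to the shuffle algebra given by the vertex
functionals. -/
noncomputable def toShuffle (deg : A → ℕ) : KT K A →ₐc[K] Shuffle K A deg :=
  RenHopf.toShuffle (vertexLin K) (finite_convWord_vertex K) deg
    fun a => isInfinitesimal_linLift (vertexFun_mul K a)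

variable {K}

theorem card_linExt_of_isEmpty {U : ForestPoset A} (h : IsEmpty U.V) :
    Nat.card {l : LinExt U // l.1.map U.label = []} = 1 := by
  rw [Nat.card_eq_one_iff_unique]
  refine ⟨⟨fun l m => Subtype.ext (Subtype.ext ?_)⟩, ⟨⟨⟨[], by simp, h.elim, by simp⟩, rfl⟩⟩⟩
  rw [List.map_eq_nil_iff.1 l.2, List.map_eq_nil_iff.1 m.2]

/-- The linear extensions that start with a letter `a`, by the set of the remaining vertices. -/
theorem card_linExt_cons (U : ForestPoset A) (a : A) (w : List A) :
    Nat.card {l : LinExt U // l.1.map U.label = a :: w} =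
      Nat.card (Σ s : {s : Set U.V // IsLowerSet s}, {l : LinExt (U.restrict s.1) //
        IsVertex a (mk (U.restrict s.1ᶜ)) ∧ l.1.map (U.restrict s.1).label = w}) := by
  symm
  let S := Σ s : {s : Set U.V // IsLowerSet s}, {l : LinExt (U.restrict s.1) //
    IsVertex a (mk (U.restrict s.1ᶜ)) ∧ l.1.map (U.restrict s.1).label = w}
  -- `x` is the only vertex outside the lower set `s`. It becomes the first, that is largest, vertex
  -- of the linear extension.
  choose x hx hl using fun (s : Set U.V) (h : IsVertex a (mk (U.restrict sᶜ))) =>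
    show ∃ x : U.V, (x ∉ s ∧ ∀ y ∉ s, y = x) ∧ U.label x = a from by
      obtain ⟨x, hx, hl⟩ := isVertex_mk.1 h
      exact ⟨x.1, ⟨x.2, fun y hy => congrArg Subtype.val (hx ⟨y, hy⟩)⟩, hl⟩
  have hmem : ∀ (q : S) (y : U.V), y ∈ q.2.1.1.map Subtype.val ↔ y ∈ q.1.1 := fun q y =>
    ⟨fun h => by
      obtain ⟨z, -, rfl⟩ := List.mem_map.1 h
      exact z.2, fun h => List.mem_map.2 ⟨⟨y, h⟩, q.2.1.2.2.1 _, rfl⟩⟩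
  let G : S → {l : LinExt U // l.1.map U.label = a :: w} := fun q =>
    ⟨⟨x q.1.1 q.2.2.1 :: q.2.1.1.map Subtype.val, by
      refine ⟨List.nodup_cons.2 ⟨?_, q.2.1.2.1.map Subtype.val_injective⟩, fun y => ?_,
        List.pairwise_cons.2 ⟨fun y hy hlt => ?_, ?_⟩⟩
      · rw [hmem]
        exact (hx _ q.2.2.1).1
      · by_cases hy : y ∈ q.1.1
        · exact List.mem_cons_of_mem _ ((hmem q y).2 hy)
        · rw [(hx _ q.2.2.1).2 y hy]
          exact List.mem_cons_self
      · exact (hx _ q.2.2.1).1 (q.1.2 hlt.le ((hmem q y).1 hy))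
      · exact List.pairwise_map.2 (q.2.1.2.2.2.imp fun h => h)⟩, by
      change U.label (x q.1.1 q.2.2.1) :: List.map U.label (List.map Subtype.val q.2.1.1) = _
      exact congrArg₂ List.cons (hl _ q.2.2.1) ((List.map_map (l := q.2.1.1)).trans q.2.2.2)⟩
  refine Nat.card_congr (Equiv.ofBijective G ⟨fun q q' h => ?_, fun l => ?_⟩)
  · have h1 : (G q).1.1 = (G q').1.1 := congrArg (fun l => l.1.1) h
    have h2 := List.tail_eq_of_cons_eq h1
    -- The lower set is recovered as the set of vertices in the tail of the list.
    have h3 : q.1 = q'.1 := Subtype.ext (Set.ext fun y => by rw [← hmem, ← hmem, h2])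
    obtain ⟨s, l, hs⟩ := q
    obtain ⟨s', l', hs'⟩ := q'
    obtain rfl : s = s' := h3
    have h4 : l = l' := Subtype.ext (List.map_injective_iff.2 Subtype.val_injective h2)
    subst h4
    rfl
  · obtain ⟨⟨l, hnd, hall, hp⟩, hw⟩ := l
    rcases l with _ | ⟨y, l⟩
    · simp at hw
    change U.label y :: l.map U.label = a :: w at hw
    obtain ⟨hy, hw⟩ := List.cons_eq_cons.1 hw
    obtain ⟨hyl, hnd⟩ := List.nodup_cons.1 hnd
    obtain ⟨hpy, hp⟩ := List.pairwise_cons.1 hp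
    have hcompl : ∀ z, z ∉ {z | z ∈ l} → z = y := fun z hz =>
      (List.mem_cons.1 (hall z)).resolve_right hz
    -- A vertex below a tail vertex is in the tail too: the only other candidate is the head `y`,
    -- which is below no vertex of the tail.
    have hlow : IsLowerSet {z | z ∈ l} := fun z z' hle hz => by
      by_contra hz'
      rw [hcompl z' hz'] at hle
      exact hpy z hz (lt_of_le_of_ne hle fun h => hyl (h ▸ hz))
    have hv : IsVertex a (mk (U.restrict {z | z ∈ l}ᶜ)) :=
      ⟨⟨y, hyl⟩, fun z => Subtype.ext (hcompl z.1 z.2), hy⟩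
    refine ⟨⟨⟨{z | z ∈ l}, hlow⟩, ⟨⟨l.attach, List.nodup_attach.2 hnd, fun z => List.mem_attach l z,
      ?_⟩, hv, ?_⟩⟩, Subtype.ext (Subtype.ext ?_)⟩
    · rw [← List.attach_map_subtype_val l, List.pairwise_map] at hp
      exact hp
    · rw [← hw]
      conv_rhs => rw [← List.attach_map_subtype_val l, List.map_map]
      rfl
    · exact congrArg₂ List.cons (hcompl _ (hx _ hv).1) (List.attach_map_subtype_val l)

/-- Splitting off the first letter in the convolution picks the decompositions whose upper part is
one vertex with that label. Removing the largest vertex from a linear extension is the same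
recursion, by `card_linExt_cons`. -/
theorem convWord_vertex (w : List A) (U : ForestPoset A) :
    (convWord (vertexLin K) w).ofConv (SplitAlgebra.of K (mk U)) =
      (Nat.card {l : LinExt U // l.1.map U.label = w} : K) := by
  classical
  induction w generalizing U with
  | nil =>
    rw [convWord_nil, SplitAlgebra.counit_of]
    by_cases h : IsEmpty U.V
    · rw [if_pos (mk_eq_one.2 h), card_linExt_of_isEmpty h, Nat.cast_one]
    · rw [if_neg (fun h' => h (mk_eq_one.1 h')), Nat.card_eq_zero.2 (Or.inl ⟨fun l => h ⟨fun x => ?_⟩⟩),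
        Nat.cast_zero]
      have := l.1.2.2.1 x
      rw [List.map_eq_nil_iff.1 l.2] at this
      simp at this
  | cons a w ih =>
    let _ := Fintype.ofFinite {s : Set U.V // IsLowerSet s}
    rw [card_linExt_cons, Nat.card_sigma, Nat.cast_sum]
    refine (convWord_cons_of (vertexFun K) a w (mk U)).trans ?_
    rw [split_mk, splitPoset, map_family, sum_family]
    refine Finset.sum_congr rfl fun s _ => ?_
    refine (congrArg (vertexFun K a _ * ·) (ih (U.restrict s.1))).trans ?_
    by_cases h : IsVertex a (mk (U.restrict s.1ᶜ))
    · simp [vertexFun, h]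
    · simp [vertexFun, h]

theorem piMap_apply (x : KT K A) (w : List A) :
    piMap K A x w = (convWord (vertexLin K) w).ofConv x := by
  classical
  have : Finsupp.lapply w ∘ₗ piMap K A = (convWord (vertexLin K) w).ofConv := by
    refine LinearMap.ext_on_range SplitAlgebra.span_of fun u => ?_
    obtain ⟨U⟩ := u
    refine Eq.trans ?_ (convWord_vertex w U).symm
    change (Finsupp.lapply w ∘ₗ piMap K A) (SplitAlgebra.of K (mk U)) = _
    rw [LinearMap.comp_apply, piMap, SplitAlgebra.linLift_of]
    change Finsupp.lapply w (((wordsPoset U).map fun w => Finsupp.single w (1 : K)).sum) = _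
    let _ := Fintype.ofFinite (LinExt U)
    rw [wordsPoset, map_family, sum_family, map_sum, Nat.card_eq_fintype_card, Fintype.card_subtype,
      Finset.card_filter, Nat.cast_sum]
    refine Finset.sum_congr rfl fun l _ => ?_
    simp [Finsupp.single_apply]
  exact LinearMap.congr_fun this x

/-- The two maps have the same coefficients by `piMap_apply`, and differ only in the structure put
on the space of words. This identifies the kernel of the homomorphism with `I`. -/
theorem toShuffle_eq_zero_iff (deg : A → ℕ) (x : KT K A) :
    toShuffle K deg x = 0 ↔ piMap K A x = 0 := by
  constructor
  · intro h
    ext w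
    rw [piMap_apply, ← coeff_toShuffle (vertexLin K) (finite_convWord_vertex K) deg]
    exact congrArg (Shuffle.coeff K w) h
  · intro h
    refine Shuffle.coeff_ext fun w => ?_
    rw [map_zero]
    exact (piMap_apply x w).symm.trans (by rw [h]; rfl)

/-- The linearly ordered forest with labels `w`, from top to bottom. -/
def ladder (w : List A) : ForestPoset A where
  V := (Fin w.length)ᵒᵈ
  label i := w.get (OrderDual.ofDual i)
  chain _ y z _ _ := le_total y z

theorem toShuffle_ladder (deg : A → ℕ) (w : List A) :
    toShuffle K deg (SplitAlgebra.of K (mk (ladder w))) = QSh.word K _ w := by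
  classical
  -- A total order has only one linear extension: the list is sorted, without repetitions, and
  -- contains every index. In the dual order, index `0` is the largest vertex and is read first.
  have hl : ∀ l : LinExt (ladder w), l.1 = List.finRange w.length := by
    intro l
    obtain ⟨l, hnd, hall, hp⟩ := l
    have hp' : List.Pairwise (α := Fin w.length) (fun i j => ¬ j < i) l := hp
    exact (((List.perm_ext_iff_of_nodup hnd (List.nodup_finRange _)).2 fun i =>
      iff_of_true (hall i) (List.mem_finRange i) : List.Perm (α := Fin w.length) _ _)).eq_of_pairwise
        (le := fun i j : Fin w.length => i ≤ j) (fun i j _ _ => le_antisymm)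
        (hp'.imp fun h => not_lt.1 h) ((List.pairwise_lt_finRange _).imp le_of_lt)
  have hm : (List.finRange w.length).map w.get = w := List.map_get_finRange w
  let l₀ : LinExt (ladder w) := ⟨List.finRange w.length, List.nodup_finRange _, List.mem_finRange,
    (List.pairwise_lt_finRange _).imp fun h h' => lt_asymm h h'⟩
  refine Shuffle.coeff_ext fun v => ?_
  refine (convWord_vertex v (ladder w)).trans ?_
  rw [Shuffle.coeff_word]
  split_ifs with h
  · rw [Nat.card_eq_one_iff_unique.2, Nat.cast_one]
    refine ⟨⟨fun l m => Subtype.ext (Subtype.ext ((hl _).trans (hl _).symm))⟩, ⟨⟨l₀, ?_⟩⟩⟩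
    exact hm.trans h
  · rw [Nat.card_eq_zero.2 (Or.inl ⟨fun l => h ?_⟩), Nat.cast_zero]
    rw [← l.2, hl l.1]
    exact hm.symm

theorem toShuffle_surjective (deg : A → ℕ) : Function.Surjective (toShuffle K deg) := by
  have h : LinearMap.range (toShuffle K deg : KT K A →ₗ[K] Shuffle K A deg) = ⊤ := by
    rw [eq_top_iff, ← QSh.span_word, Submodule.span_le]
    rintro _ ⟨w, rfl⟩
    exact ⟨_, toShuffle_ladder deg w⟩
  exact LinearMap.range_eq_top.1 h

end Forest

/-! ### Colours of intervals. -/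

namespace IntervalClass

variable {A : Type u}

/-- The relation between the least and the greatest element has the colour `a`. -/
def HasColour (a : A) (c : IntervalClass A) : Prop :=
  Quotient.lift (fun X : LInterval A => X.colour X.bot X.top a) (fun X Y h => by
    obtain ⟨e, he⟩ := h
    have hb : e X.bot = Y.bot := le_antisymm (by
      have := e.monotone (X.bot_le (e.symm Y.bot)); simpa using this) (Y.bot_le _)
    have ht : e X.top = Y.top := le_antisymm (Y.le_top _) (by
      have := e.monotone (X.le_top (e.symm Y.top)); simpa using this)
    have h := he X.bot X.top a
    rw [hb, ht] at h
    exact propext h.symm) c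

theorem not_hasColour_one (a : A) : ¬ HasColour a (1 : IntervalClass A) := id

/-- A coloured relation in a product moves only one coordinate. If it joins the least to the
greatest element, then these coincide in the other factor, which is a point. -/
theorem hasColour_mul {a : A} {c d : IntervalClass A} :
    HasColour a (c * d) ↔ (HasColour a c ∧ d = 1) ∨ (c = 1 ∧ HasColour a d) := by
  obtain ⟨X⟩ := c
  obtain ⟨Y⟩ := d
  exact or_congr (and_congr Iff.rfl mk_eq_one.symm) (and_congr mk_eq_one.symm Iff.rfl)

/-- The colours of an interval of `Π_NAP(I)` are labels of elements of the finite set `I`. For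
arbitrary coloured intervals finiteness can fail, hence the restriction to `napMonoid A`. -/
theorem finite_hasColour {c : IntervalClass A} (hc : c ∈ napMonoid A) : {a | HasColour a c}.Finite := by
  induction hc using Submonoid.closure_induction with
  | mem c hc =>
    obtain ⟨I, _, l, x, y, h, rfl⟩ := hc
    refine (Set.finite_range l).subset ?_
    rintro a ⟨r, s, -, rfl⟩
    exact ⟨r, rfl⟩
  | one => exact Set.finite_empty.subset fun a ha => not_hasColour_one a ha
  | mul c d _ _ hc hd =>
    refine (hc.union hd).subset fun a ha => ?_
    exact (hasColour_mul.1 ha).imp And.left And.right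

end IntervalClass

/-! ### The homomorphism from `H_NAP(A)` to the shuffle algebra. -/

namespace HNAP

open IntervalClass

variable (K : Type*) [CommRing K] {A : Type u}

open Classical in
/-- The functional that picks out the intervals that consist of one relation of colour `a`. -/
noncomputable def colourFun (a : A) (c : napMonoid A) : K := if HasColour a c.1 then 1 else 0

open Classical in
theorem colourFun_mul (a : A) (c d : napMonoid A) : colourFun K a (c * d) =
    colourFun K a c * (if d = 1 then 1 else 0) + (if c = 1 then 1 else 0) * colourFun K a d := by
  have h : ∀ c : napMonoid A, c = 1 ↔ c.1 = 1 := fun c => Subtype.ext_iff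
  simp only [colourFun, Submonoid.coe_mul, hasColour_mul, h]
  by_cases hc : c.1 = 1 <;> by_cases hd : d.1 = 1 <;> simp [hc, hd, not_hasColour_one]

/-- The colour functionals, extended linearly. -/
noncomputable def colourLin (a : A) : HNAP K A →ₗ[K] K := SplitAlgebra.linLift (colourFun K a)

theorem colourFun_one (a : A) : colourFun K a 1 = 0 := if_neg (not_hasColour_one a)

theorem finite_convWord_colour (x : HNAP K A) :
    {w | (convWord (colourLin K (A := A)) w).ofConv x ≠ 0}.Finite := by
  refine finite_convWord (colourFun K) (colourFun_one K) (fun c => ?_) x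
  refine (finite_hasColour c.2).subset fun a ha => ?_
  by_contra hc
  exact ha (if_neg hc)

theorem isInfinitesimal_colourLin (a : A) : IsInfinitesimal (colourLin K a) :=
  isInfinitesimal_linLift fun c d => by
    rw [colourFun_mul]
    congr

/-- The homomorphism of bialgebras from `H_NAP(A)` to the shuffle algebra that sends an interval to
the sum of the words of colours along its maximal chains. -/
noncomputable def toShuffle (deg : A → ℕ) : HNAP K A →ₐc[K] Shuffle K A deg :=
  RenHopf.toShuffle (colourLin K) (finite_convWord_colour K) deg (isInfinitesimal_colourLin K)

/-- The class of an interval of `Π_NAP(I)`. -/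
def ofInterval {I : Type} [Finite I] (l : I → A) (x y : NapForest I) (h : x ≤ y) : napMonoid A :=
  ⟨mk (napInterval l x y h), Submonoid.subset_closure ⟨I, ‹_›, l, x, y, h, rfl⟩⟩

theorem ofInterval_eq_one {I : Type} [Finite I] (l : I → A) (x y : NapForest I) (h : x ≤ y) :
    ofInterval l x y h = 1 ↔ x = y :=
  Subtype.ext_iff.trans (mk_eq_one.trans Subtype.ext_iff)

/-- The decompositions in the submonoid are inherited from all interval classes, so the equality can
be checked after the injective coercion. There, a subinterval of an interval of `Π_NAP(I)` is again
such an interval. -/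
theorem split_ofInterval {I : Type} [Finite I] (l : I → A) (x y : NapForest I) (h : x ≤ y) :
    SplitMonoid.split (ofInterval l x y h) = family fun z : {z : NapForest I // x ≤ z ∧ z ≤ y} =>
      (ofInterval l x z.1 z.2.1, ofInterval l z.1 y z.2.2) := by
  have hinj : Function.Injective (Multiset.map (Prod.map (Subtype.val : napMonoid A → _)
      (Subtype.val : napMonoid A → _))) :=
    Multiset.map_injective (Prod.map_injective.2 ⟨Subtype.val_injective, Subtype.val_injective⟩)
  have hsp : ∀ c : napMonoid A, (SplitMonoid.split c).map (Prod.map Subtype.val Subtype.val) =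
      SplitMonoid.split c.1 := fun c => by
    change Multiset.map _ ((SplitMonoid.split c.1).pmap _ _) = _
    simp only [Multiset.map_pmap, Prod.map_apply, Multiset.pmap_eq_map, Multiset.map_id']
  apply hinj
  rw [hsp, map_family]
  have key : ∀ (a b : (napInterval l x y h).P) (hab : a ≤ b),
      mk (napInterval l a.1 b.1 hab) = mk ((napInterval l x y h).sub a b hab) := fun a b hab =>
    (sound (X := (napInterval l x y h).sub a b hab) (Y := napInterval l a.1 b.1 hab)
      ⟨fun p => ⟨p.1.1, p.2⟩, fun p => ⟨⟨p.1, a.2.1.trans p.2.1, p.2.2.trans b.2.2⟩, p.2⟩,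
        fun _ => rfl, fun _ => rfl⟩ (fun _ _ => Iff.rfl) fun _ _ _ => Iff.rfl).symm
  refine family_congr_equiv (Equiv.refl {z : NapForest I // x ≤ z ∧ z ≤ y}) fun z => ?_
  exact Prod.ext (key ⟨x, le_rfl, h⟩ z z.2.1) (key z ⟨y, h, le_rfl⟩ z.2.2)

end HNAP

/-! ### Intervals of `Π_NAP` that are chains. -/

namespace NapForest

variable {I : Type}

/-- Graftings preserve the relations between vertices. -/
theorem le_mono {x y : NapForest I} (h : x ≤ y) {v w : I} (hvw : x.le v w) : y.le v w := by
  induction h with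
  | refl => exact hvw
  | tail _ hs ih =>
    obtain ⟨r, s, hs⟩ := hs
    exact hs.le_le ih

/-- Graftings do not insert vertices between two comparable vertices. -/
theorem le_of_le_of_le {x y : NapForest I} (h : x ≤ y) {v u w : I} (hvw : x.le v w)
    (hvu : y.le v u) (huw : y.le u w) : x.le v u ∧ x.le u w := by
  induction h with
  | refl => exact ⟨hvu, huw⟩
  | @tail y z hxy hyz ih =>
    obtain ⟨r, s, hg⟩ := hyz
    -- Distinct roots have no common vertex above them, as the vertices below a given one form a
    -- chain.
    have hrs : ∀ {b}, y.le r b → y.le s b → False := fun {b} h1 h2 => by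
      rcases y.chain b r s h1 h2 with h | h
      · exact hg.2.2.1 (hg.2.1 r h)
      · exact hg.2.2.1 (hg.1 s h).symm
    have hvw' := le_mono hxy hvw
    have h1 : y.le v u := by
      rcases (hg.2.2.2 v u).1 hvu with h1 | ⟨rfl, h1⟩
      · exact h1
      · rcases (hg.2.2.2 u w).1 huw with h2 | ⟨rfl, h2⟩
        · exact (hrs (y.le_trans _ _ _ h1 h2) hvw').elim
        · exact y.le_refl _
    refine ih h1 ?_
    rcases (hg.2.2.2 u w).1 huw with h2 | ⟨rfl, h2⟩
    · exact h2
    · obtain rfl := hg.2.1 v h1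
      exact hvw'

/-- Graftings do not add vertices above a vertex that is not a root. -/
theorem le_of_not_root {x y : NapForest I} (h : x ≤ y) {v w u : I} (hvw : x.le v w) (hne : v ≠ w)
    (hwu : y.le w u) : x.le w u := by
  induction h with
  | refl => exact hwu
  | @tail y z hxy hyz ih =>
    obtain ⟨r, s, hg⟩ := hyz
    rcases (hg.2.2.2 w u).1 hwu with h | ⟨rfl, -⟩
    · exact ih h
    -- New vertices above `w` would require `w` to be the root that receives the graft, but `v` lies
    -- strictly below it.
    · exact absurd (hg.2.1 v (le_mono hxy hvw)) hne

/-- The vertices from `k` on form a chain with root `k`, the other ones are isolated. -/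
def rung (n k : ℕ) : NapForest (Fin (n + 1)) where
  le v w := v = w ∨ (k ≤ v.1 ∧ v ≤ w)
  le_refl _ := Or.inl rfl
  le_trans v w z := by
    rintro (rfl | ⟨h1, h2⟩) (rfl | ⟨h3, h4⟩)
    · exact Or.inl rfl
    · exact Or.inr ⟨h3, h4⟩
    · exact Or.inr ⟨h1, h2⟩
    · exact Or.inr ⟨h1, h2.trans h4⟩
  le_antisymm v w := by
    rintro (rfl | ⟨-, h1⟩) (h | ⟨-, h2⟩)
    · rfl
    · rfl
    · exact h.symm
    · exact h1.antisymm h2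
  chain v w z := by
    rintro (rfl | ⟨h1, h2⟩) (rfl | ⟨h3, h4⟩)
    · exact Or.inl (Or.inl rfl)
    · exact Or.inr (Or.inr ⟨h3, h4⟩)
    · exact Or.inl (Or.inr ⟨h1, h2⟩)
    · rcases le_total w z with h | h
      · exact Or.inl (Or.inr ⟨h1, h⟩)
      · exact Or.inr (Or.inr ⟨h3, h⟩)

theorem isRoot_rung {n k : ℕ} {r : Fin (n + 1)} (hk : k ≤ n) : (rung n k).IsRoot r ↔ r.1 ≤ k := by
  constructor
  · intro h
    by_contra hr
    have := h ⟨k, by omega⟩ (Or.inr ⟨le_rfl, Fin.le_def.2 (by simp; omega)⟩)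
    rw [← this] at hr
    simp at hr
  · rintro h v (rfl | ⟨h1, h2⟩)
    · rfl
    · have := Fin.le_def.1 h2
      exact Fin.ext (by omega)

/-- The vertex `k` is isolated in the smaller forest, so grafting the root `k + 1` of the chain to
it extends the chain downwards by one vertex. -/
theorem graft_rung {n k : ℕ} (hk : k + 1 ≤ n) :
    Graft (rung n (k + 1)) (rung n k) ⟨k + 1, by omega⟩ ⟨k, by omega⟩ := by
  refine ⟨(isRoot_rung hk).2 le_rfl, (isRoot_rung hk).2 (by simp), by simp, fun v w => ?_⟩
  constructor
  · rintro (rfl | ⟨h1, h2⟩)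
    · exact Or.inl (Or.inl rfl)
    · rcases Nat.eq_or_lt_of_le h1 with h | h
      · have hv : v = ⟨k, by omega⟩ := Fin.ext h.symm
        rcases eq_or_lt_of_le h2 with rfl | h3
        · exact Or.inl (Or.inl rfl)
        · refine Or.inr ⟨hv, Or.inr ⟨le_rfl, Fin.le_def.2 ?_⟩⟩
          have := Fin.lt_def.1 h3
          simp only
          omega
      · exact Or.inl (Or.inr ⟨h, h2⟩)
  · rintro ((rfl | ⟨h1, h2⟩) | ⟨rfl, (rfl | ⟨-, h2⟩)⟩)
    · exact Or.inl rfl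
    · exact Or.inr ⟨by omega, h2⟩
    · exact Or.inr ⟨le_rfl, Fin.le_def.2 (by simp)⟩
    · have := Fin.le_def.1 h2
      simp only at this
      exact Or.inr ⟨le_rfl, Fin.le_def.2 (by simp only; omega)⟩

theorem rung_le {n k : ℕ} (hk : k ≤ n) : rung n k ≤ rung n 0 := by
  induction k with
  | zero => exact le_rfl
  | succ k ih => exact (graft_rung hk).lt.le.trans (ih (by omega))

theorem rung_ne {n k : ℕ} (hk : k + 1 ≤ n) : rung n (k + 1) ≠ rung n 0 := fun h => by
  have h1 : (rung n 0).le ⟨0, by omega⟩ ⟨1, by omega⟩ := Or.inr ⟨le_rfl, Fin.le_def.2 (by simp)⟩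
  rw [← h] at h1
  rcases h1 with h1 | ⟨h1, -⟩ <;> simp at h1

/-- The only way to continue from a rung towards the chain on all vertices. -/
theorem graft_rung_unique {n k : ℕ} (hk : k + 1 ≤ n) {y : NapForest (Fin (n + 1))}
    {r s : Fin (n + 1)} (hg : Graft (rung n (k + 1)) y r s) (hy : y ≤ rung n 0) :
    y = rung n k ∧ r.1 = k + 1 := by
  have hr : r.1 ≤ k + 1 := (isRoot_rung hk).1 hg.1
  have hs : s.1 ≤ k + 1 := (isRoot_rung hk).1 hg.2.1
  have hsr : y.le s r := (hg.2.2.2 s r).2 (Or.inr ⟨rfl, Or.inl rfl⟩)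
  have hlt : s.1 < r.1 := by
    rcases le_mono hy hsr with h | ⟨-, h⟩
    · exact absurd h.symm hg.2.2.1
    · exact Nat.lt_of_le_of_ne (Fin.le_def.1 h) fun h => hg.2.2.1 (Fin.ext h.symm)
  have hzero : ∀ v w : Fin (n + 1), v.1 ≤ w.1 → (rung n 0).le v w := fun v w h =>
    Or.inr ⟨Nat.zero_le _, Fin.le_def.2 h⟩
  -- After the graft `r` is no longer a root, so everything that ends up above it is there already.
  -- In the final chain `k + 1` is above `r`, but the graft provides this relation only if `r` is `k
  -- + 1` itself.
  have hr' : r.1 = k + 1 := by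
    by_contra hne
    have h1 := le_of_not_root hy hsr (Ne.symm hg.2.2.1)
      (hzero r ⟨k + 1, by omega⟩ hr)
    rcases (hg.2.2.2 _ _).1 h1 with (h | ⟨h, -⟩) | ⟨h, -⟩
    · exact hne (congrArg Fin.val h)
    · omega
    · exact hg.2.2.1 h
  -- In the final chain `k` lies between `s` and `r`. As nothing is inserted later between
  -- comparable vertices, `s` is below `k` right after the graft, which forces `s = k`.
  have hs' : s.1 = k := by
    by_contra hne
    have h1 := (le_of_le_of_le hy hsr (hzero s ⟨k, by omega⟩ (by simp; omega))
      (hzero ⟨k, by omega⟩ r (by simp; omega))).1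
    rcases (hg.2.2.2 _ _).1 h1 with (h | ⟨h, -⟩) | ⟨-, (h | ⟨-, h⟩)⟩
    · exact hne (congrArg Fin.val h)
    · omega
    · have := congrArg Fin.val h
      simp only at this
      omega
    · have := Fin.le_def.1 h
      simp only at this
      omega
  refine ⟨?_, hr'⟩
  have hr2 : r = ⟨k + 1, Nat.lt_succ_of_le hk⟩ := Fin.ext hr'
  have hs2 : s = ⟨k, Nat.lt_succ_of_lt hk⟩ := Fin.ext hs'
  rw [hr2, hs2] at hg
  ext v w
  exact (hg.2.2.2 v w).trans ((graft_rung hk).2.2.2 v w).symm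

end NapForest

/-! ### Surjectivity of the homomorphism from `H_NAP(A)`. -/

namespace HNAP

open IntervalClass NapForest

variable {K : Type*} [CommRing K] {A : Type u}

/-- The word of the labels of the vertices `k, …, 2, 1`. -/
def rungWord (l : ℕ → A) : ℕ → List A
  | 0 => []
  | k + 1 => l (k + 1) :: rungWord l k

-- By `graft_rung_unique` the interval can be left from its bottom in only one way: a single term of
-- the coproduct survives, with the label of the vertex `k + 1` as its colour. So the image is one
-- word, read upwards along the interval.
open Classical in
theorem convWord_rung (l : ℕ → A) {n k : ℕ} (hk : k ≤ n) (w : List A) :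
    (convWord (colourLin K) w).ofConv (SplitAlgebra.of K
      (ofInterval (fun i : Fin (n + 1) => l i.1) (rung n k) (rung n 0) (rung_le hk))) =
      if rungWord l k = w then 1 else 0 := by
  induction k generalizing w with
  | zero =>
    rw [(ofInterval_eq_one _ _ _ _).2 rfl, map_one]
    rcases w with _ | ⟨a, w⟩
    · rw [convWord_nil, Bialgebra.counit_one, rungWord, if_pos rfl]
    · rw [convWord_cons_one _ (isInfinitesimal_colourLin K), if_neg (by simp [rungWord])]
  | succ k ih =>
    rcases w with _ | ⟨a, w⟩
    · rw [convWord_nil, SplitAlgebra.counit_of, if_neg, if_neg (by simp [rungWord])]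
      rw [ofInterval_eq_one]
      exact rung_ne hk
    · refine (convWord_cons_of (colourFun K) a w _).trans ?_
      rw [split_ofInterval, map_family]
      let _ := Fintype.ofFinite {z : NapForest (Fin (n + 1)) // rung n (k + 1) ≤ z ∧ z ≤ rung n 0}
      rw [sum_family, Finset.sum_eq_single
        ⟨rung n k, (graft_rung hk).lt.le, rung_le ((Nat.le_succ k).trans hk)⟩]
      · refine (congrArg (_ * ·) (ih ((Nat.le_succ k).trans hk) w)).trans ?_
        have hcol : HasColour a (ofInterval (fun i : Fin (n + 1) => l i.1) (rung n (k + 1)) (rung n k)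
            (graft_rung hk).lt.le).1 ↔ l (k + 1) = a := by
          constructor
          · rintro ⟨r, s, hg, rfl⟩
            exact congrArg l (graft_rung_unique hk hg (rung_le ((Nat.le_succ k).trans hk))).2.symm
          · rintro rfl
            exact ⟨_, _, graft_rung hk, rfl⟩
        simp only [colourFun, hcol, rungWord, List.cons.injEq]
        split_ifs <;> simp_all
      · rintro ⟨z, hz1, hz2⟩ - hne
        have : ¬ HasColour a (ofInterval (fun i : Fin (n + 1) => l i.1) (rung n (k + 1)) z hz1).1 := by
          rintro ⟨r, s, hg, -⟩
          exact hne (Subtype.ext (graft_rung_unique hk hg hz2).1)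
        simp [colourFun, this]
      · simp

theorem exists_rungWord (w : List A) (h : w ≠ []) : ∃ l : ℕ → A, rungWord l w.length = w := by
  -- Some letter is needed as a default value for `l`; the label of the vertex `0` never occurs in
  -- the word.
  obtain ⟨a, -⟩ := List.exists_mem_of_ne_nil w h
  clear h
  -- The strengthened claim says that only the values up to `w.length` matter, so that changing `l`
  -- at the next index keeps the word built so far.
  suffices ∀ w : List A, ∃ l : ℕ → A, ∀ l' : ℕ → A, (∀ i ≤ w.length, l' i = l i) →
      rungWord l' w.length = w from (this w).imp fun l hl => hl l fun _ _ => rfl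
  intro w
  induction w with
  | nil => exact ⟨fun _ => a, fun _ _ => rfl⟩
  | cons b w ih =>
    obtain ⟨l, hl⟩ := ih
    refine ⟨Function.update l (w.length + 1) b, fun l' hl' => ?_⟩
    rw [List.length_cons, rungWord, hl' (w.length + 1) le_rfl, Function.update_self, hl l']
    intro i hi
    rw [hl' i (by simp; omega), Function.update_of_ne (by omega)]

theorem toShuffle_surjective (deg : A → ℕ) : Function.Surjective (toShuffle K (A := A) deg) := by
  classical
  have h : LinearMap.range (toShuffle K deg : HNAP K A →ₗ[K] Shuffle K A deg) = ⊤ := by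
    rw [eq_top_iff, ← QSh.span_word, Submodule.span_le]
    rintro _ ⟨w, rfl⟩
    -- The empty word is treated apart, since there may be no letter to label a vertex with.
    by_cases hw : w = []
    · subst hw
      exact ⟨1, map_one (toShuffle K deg)⟩
    · obtain ⟨l, hl⟩ := exists_rungWord w hw
      -- The interval runs from the forest without edges to the chain on `w.length + 1` vertices: a
      -- word of length `n` needs `n` graftings.
      refine ⟨SplitAlgebra.of K (ofInterval (fun i : Fin (w.length + 1) => l i.1) (rung w.length w.length)
        (rung w.length 0) (rung_le le_rfl)), Shuffle.coeff_ext fun v => ?_⟩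
      refine (convWord_rung l le_rfl v).trans ?_
      rw [hl, Shuffle.coeff_word]
  exact LinearMap.range_eq_top.1 h

end HNAP

/-! ### Unitriangular maps and binomial polynomials. -/

/-- `T` sends a basis vector to itself plus a combination of strictly shorter ones. The lengths in a
given vector are bounded, so descending induction on the bound works even though the basis may be
infinite. -/
theorem bijective_of_unitriangular {K ι : Type*} [CommRing K] (len : ι → ℕ)
    (T : (ι →₀ K) →ₗ[K] (ι →₀ K))
    (h1 : ∀ v, T (Finsupp.single v 1) v = 1)
    (h2 : ∀ v w, v ≠ w → len v ≤ len w → T (Finsupp.single v 1) w = 0) :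
    Function.Bijective T := by
  have hsup : ∀ x : ι →₀ K, ∃ n, ∀ w, n ≤ len w → x w = 0 := fun x => by
    refine ⟨x.support.sup len + 1, fun w hw => ?_⟩
    by_contra h
    have := Finset.le_sup (f := len) (Finsupp.mem_support_iff.2 h)
    omega
  -- On vectors supported in length at most `n`, `T` changes only the coefficients in length less
  -- than `n`.
  have key : ∀ n (x : ι →₀ K), (∀ w, n + 1 ≤ len w → x w = 0) → ∀ w, n ≤ len w → T x w = x w := by
    intro n x hx w hw
    have hx' : x ∈ Finsupp.supported K K {w | len w ≤ n} :=
      (Finsupp.mem_supported' K x).2 fun v hv => hx v (Nat.lt_of_not_le hv)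
    rw [Finsupp.supported_eq_span_single] at hx'
    clear hx
    induction hx' using Submodule.span_induction with
    | mem x hx =>
      obtain ⟨v, hv, rfl⟩ := hx
      by_cases hvw : v = w
      · subst hvw
        rw [h1, Finsupp.single_eq_same]
      · rw [h2 v w hvw (le_trans hv hw), Finsupp.single_eq_of_ne' hvw]
    | zero => simp
    | add x y _ _ hx hy => rw [map_add, Finsupp.add_apply, Finsupp.add_apply, hx, hy]
    | smul c x _ hx => rw [map_smul, Finsupp.smul_apply, Finsupp.smul_apply, hx]
  constructor
  · refine (injective_iff_map_eq_zero T).2 fun x hx => ?_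
    have : ∀ n, (∀ w, n ≤ len w → x w = 0) → x = 0 := by
      intro n
      induction n with
      | zero => exact fun h => Finsupp.ext fun w => h w (Nat.zero_le _)
      | succ n ih =>
        intro h
        refine ih fun w hw => ?_
        rw [← key n x h w hw, hx, Finsupp.zero_apply]
    obtain ⟨n, hn⟩ := hsup x
    exact this n hn
  -- The error `y - T y` is supported in smaller length; a preimage of it, added to `y`, is a
  -- preimage of `y`.
  · have : ∀ n (y : ι →₀ K), (∀ w, n ≤ len w → y w = 0) → ∃ x, T x = y := by
      intro n
      induction n with
      | zero => exact fun y h => ⟨0, by rw [map_zero]; exact (Finsupp.ext fun w => h w (Nat.zero_le _)).symm⟩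
      | succ n ih =>
        intro y h
        obtain ⟨x, hx⟩ := ih (y - T y) fun w hw => by
          rw [Finsupp.sub_apply, key n y h w hw, sub_self]
        exact ⟨x + y, by rw [map_add, hx, sub_add_cancel]⟩
    intro y
    obtain ⟨n, hn⟩ := hsup y
    exact this n y hn

section BinomialPolynomial

open Polynomial

variable (K : Type*) [Field K]

/-- The binomial polynomial `X (X - 1) ⋯ (X - n + 1) / n!`. -/
noncomputable def binomPoly (n : ℕ) : K[X] := C ((n.factorial : K)⁻¹) * descPochhammer K n

/-- Characteristic `0` makes `n!` invertible. The natural numbers are then infinitely many points of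
`K`, so that these values determine the polynomial. -/
theorem eval_binomPoly [CharZero K] (n x : ℕ) : (binomPoly K n).eval (x : K) = x.choose n := by
  rw [binomPoly, eval_C_mul, descPochhammer_eval_eq_descFactorial, Nat.descFactorial_eq_factorial_mul_choose,
    Nat.cast_mul, inv_mul_cancel_left₀ (Nat.cast_ne_zero.2 n.factorial_ne_zero)]

theorem coeff_zero_binomPoly_succ [CharZero K] (n : ℕ) : (binomPoly K (n + 1)).coeff 0 = 0 := by
  have := eval_binomPoly K (n + 1) 0
  rw [coeff_zero_eq_eval_zero]
  simpa using this

theorem coeff_one_binomPoly_one : (binomPoly K 1).coeff 1 = 1 := by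
  simp [binomPoly]

theorem eq_of_eval_natCast [CharZero K] {p q : K[X]} (h : ∀ x : ℕ, p.eval (x : K) = q.eval (x : K)) : p = q :=
  eq_of_infinite_eval_eq p q <| (Set.infinite_range_of_injective (Nat.cast_injective (R := K))).mono <| by
    rintro _ ⟨x, rfl⟩
    exact h x

end BinomialPolynomial

/-! ### Products of letters under a Hoffman pairing. -/

namespace HoffmanPairing

variable {A : Type u} {deg : A → ℕ} (br : HoffmanPairing A deg)

/-- The letters and `0`, as a semigroup. -/
def Letters (_ : HoffmanPairing A deg) : Type u := WithZero A

instance : CommSemigroup br.Letters where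
  mul := br.op
  mul_assoc := br.op_assoc
  mul_comm := br.op_comm

/-- A letter or `0`, in the monoid obtained by adjoining a unit. -/
def letter (a : WithZero A) : WithOne br.Letters := ((show br.Letters from a) : WithOne br.Letters)

theorem letter_mul (a b : WithZero A) : br.letter a * br.letter b = br.letter (br.op a b) := rfl

theorem letter_injective : Function.Injective br.letter := fun _ _ h => WithOne.coe_inj.1 h

theorem letter_ne_one (a : WithZero A) : br.letter a ≠ 1 := WithOne.coe_ne_one

/-- The zero stays absorbing after a unit is adjoined. Thus if a product of letters is not `0`,
neither is any partial product, which passes the hypothesis of `QSh.chooseLin_word_mul` on to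
shorter words. -/
theorem mul_letter_zero (m : WithOne br.Letters) : m * br.letter 0 = br.letter 0 := by
  induction m with
  | one => exact one_mul _
  | coe m => exact congrArg br.letter (br.op_zero m)

/-- The product of the letters of a word. -/
def total (w : List A) : WithOne br.Letters := (w.map fun a : A => br.letter a).prod

theorem total_nil : br.total [] = 1 := rfl

theorem total_cons (a : A) (w : List A) : br.total (a :: w) = br.letter a * br.total w := by
  simp [total]

end HoffmanPairing

/-! ### Hoffman's logarithm: quasi-shuffle and shuffle algebras are isomorphic. -/

namespace QSh

open Polynomial

variable {K : Type*} [Field K] {A : Type u} {deg : A → ℕ} {br : HoffmanPairing A deg}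

/-- For `b = 0` the image is `0`, which lies in every span; otherwise the new letter multiplies the
product of the letters. -/
theorem consMap_mem_span (b : WithZero A) (m : WithOne br.Letters) {x : QSh K br}
    (hx : x ∈ Submodule.span K (word K br '' {w | br.total w = m})) :
    consMap K br b x ∈ Submodule.span K (word K br '' {w | br.total w = br.letter b * m}) := by
  induction b with
  | zero => rw [consMap_zero]; exact Submodule.zero_mem _
  | coe b =>
  have h := Submodule.mem_map_of_mem (f := consMap K br b) hx
  rw [Submodule.map_span] at h
  refine Submodule.span_mono ?_ h
  rintro _ ⟨_, ⟨w, rfl, rfl⟩, rfl⟩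
  exact ⟨b :: w, br.total_cons b w, (consMap_coe K br b w).symm⟩

/-- The words that occur in a product have the same product of letters. -/
theorem word_mul_mem_span (u v : List A) : word K br u * word K br v ∈
    Submodule.span K (word K br '' {w | br.total w = br.total u * br.total v}) := by
  induction hn : u.length + v.length using Nat.strong_induction_on generalizing u v with
  | _ n ih =>
  rcases u with _ | ⟨a, u⟩
  · rw [← one_def, one_mul, HoffmanPairing.total_nil, one_mul]
    exact Submodule.subset_span ⟨v, rfl, rfl⟩
  rcases v with _ | ⟨b, v⟩
  · rw [← one_def, mul_one, HoffmanPairing.total_nil, mul_one]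
    exact Submodule.subset_span ⟨a :: u, rfl, rfl⟩
  simp only [List.length_cons] at hn
  have h1 := consMap_mem_span (a : WithZero A) _ (ih _ (by simp only [List.length_cons]; omega) u (b :: v) rfl)
  have h2 := consMap_mem_span (b : WithZero A) _ (ih _ (by simp only [List.length_cons]; omega) (a :: u) v rfl)
  have h3 := consMap_mem_span (br.op a b) _ (ih _ (by omega) u v rfl)
  simp only [HoffmanPairing.total_cons] at h1 h2 h3 ⊢
  -- By commutativity and associativity of the pairing, the three terms of the recursion have the
  -- same product of letters.
  rw [← mul_assoc] at h1
  rw [mul_left_comm] at h2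
  rw [← HoffmanPairing.letter_mul, mul_mul_mul_comm] at h3
  rw [← consMap_coe, ← consMap_coe, cons_mul_cons]
  rw [← consMap_coe] at h1 h2
  exact Submodule.add_mem _ (Submodule.add_mem _ h1 h2) h3

/-- The words of length `n` go to the value of the `n`-th binomial coefficient at `x`. -/
noncomputable def chooseLin (K : Type*) [Field K] (br : HoffmanPairing A deg) (x : ℕ) :
    QSh K br →ₗ[K] K :=
  linLift fun w => (x.choose w.length : K)

theorem chooseLin_zero_cons (b : WithZero A) (y : QSh K br) : chooseLin K br 0 (consMap K br b y) = 0 := by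
  induction b with
  | zero => simp
  | coe b =>
  have : chooseLin K br 0 ∘ₗ consMap K br b = 0 := lin_ext fun w => by simp [chooseLin]
  exact LinearMap.congr_fun this y

/-- Pascal's rule. It needs `b ≠ 0`, because putting `0` in front of a word annihilates it, while
the term without the letter remains. -/
theorem chooseLin_succ_cons (x : ℕ) {b : WithZero A} (hb : b ≠ 0) (y : QSh K br) :
    chooseLin K br (x + 1) (consMap K br b y) =
      chooseLin K br x y + chooseLin K br x (consMap K br b y) := by
  induction b with
  | zero => exact absurd rfl hb
  | coe b =>
  have : chooseLin K br (x + 1) ∘ₗ consMap K br b =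
      chooseLin K br x + chooseLin K br x ∘ₗ consMap K br b := lin_ext fun w => by
    simp [chooseLin, Nat.choose_succ_succ]
  exact LinearMap.congr_fun this y

/-- `(x choose m) (x choose n)` counts pairs of subsets of an `x`-element chain; such a pair amounts
to its union together with a quasi-shuffle of words of lengths `m` and `n`. No quasi-shuffle is lost
when the product of all letters is not `0`. The proof replaces this count by Pascal's rule and
induction on `x`. -/
theorem chooseLin_word_mul (x : ℕ) (u v : List A) (h : br.total u * br.total v ≠ br.letter 0) :
    chooseLin K br x (word K br u * word K br v) =
      chooseLin K br x (word K br u) * chooseLin K br x (word K br v) := by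
  have hone : ∀ x, chooseLin K br x 1 = 1 := fun x => by rw [one_def]; simp [chooseLin]
  induction x generalizing u v with
  | zero =>
    rcases u with _ | ⟨a, u⟩
    · rw [← one_def, one_mul, hone, one_mul]
    rcases v with _ | ⟨b, v⟩
    · rw [← one_def, mul_one, hone, mul_one]
    simp only [← consMap_coe, cons_mul_cons, map_add, chooseLin_zero_cons]
    simp
  | succ x ih =>
    rcases u with _ | ⟨a, u⟩
    · rw [← one_def, one_mul, hone, one_mul]
    rcases v with _ | ⟨b, v⟩
    · rw [← one_def, mul_one, hone, mul_one]
    rw [HoffmanPairing.total_cons, HoffmanPairing.total_cons] at h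
    -- The merged letter divides the product of all letters, so it is not `0` and Pascal's rule
    -- applies to the third term too.
    have h0 : br.op a b ≠ 0 := fun h0 => h (by
      rw [mul_mul_mul_comm, HoffmanPairing.letter_mul, h0, mul_comm, HoffmanPairing.mul_letter_zero])
    have e := ih (a :: u) (b :: v) (by
      rwa [HoffmanPairing.total_cons, HoffmanPairing.total_cons])
    have e1 := ih u (b :: v) (fun h1 => h (by
      rw [mul_assoc, ← br.total_cons b v, h1, HoffmanPairing.mul_letter_zero]))
    have e2 := ih (a :: u) v (fun h1 => h (by
      rw [mul_left_comm, ← br.total_cons a u, h1, HoffmanPairing.mul_letter_zero]))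
    have e3 := ih u v (fun h1 => h (by
      rw [mul_mul_mul_comm, h1, HoffmanPairing.mul_letter_zero]))
    simp only [← consMap_coe] at e e1 e2 ⊢
    rw [cons_mul_cons, map_add, map_add] at e
    rw [cons_mul_cons, map_add, map_add, chooseLin_succ_cons x WithZero.coe_ne_zero,
      chooseLin_succ_cons x WithZero.coe_ne_zero, chooseLin_succ_cons x h0,
      chooseLin_succ_cons x WithZero.coe_ne_zero, chooseLin_succ_cons x WithZero.coe_ne_zero, e1, e2, e3]
    -- The terms that keep all first letters add up to the product at `x` by `e`; with the other
    -- three terms they factor as the product of the two Pascal sums.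
    linear_combination e

/-- The words of length `n` go to the `n`-th binomial polynomial. -/
noncomputable def binomLin (K : Type*) [Field K] (br : HoffmanPairing A deg) : QSh K br →ₗ[K] K[X] :=
  linLift fun w => binomPoly K w.length

theorem binomLin_word (w : List A) : binomLin K br (word K br w) = binomPoly K w.length :=
  linLift_word K br _ w

/-- An identity of polynomials may be tested at the natural numbers, where it is
`chooseLin_word_mul`. -/
theorem binomLin_word_mul [CharZero K] (u v : List A) (h : br.total u * br.total v ≠ br.letter 0) :
    binomLin K br (word K br u * word K br v) = binomPoly K u.length * binomPoly K v.length := by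
  have he : ∀ (x : ℕ) (y : QSh K br), (binomLin K br y).eval (x : K) = chooseLin K br x y := fun x y => by
    have : Polynomial.leval (x : K) ∘ₗ binomLin K br = chooseLin K br x := lin_ext fun w => by
      simp [chooseLin, binomLin_word, eval_binomPoly, Polynomial.leval]
    exact LinearMap.congr_fun this y
  refine eq_of_eval_natCast K fun x => ?_
  rw [eval_mul, he, chooseLin_word_mul x u v h, ← he, ← he, binomLin_word, binomLin_word]

open Classical in
/-- The linear coefficient of the binomial polynomial on the words with product of letters `a`. -/
noncomputable def logFun (K : Type*) [Field K] (br : HoffmanPairing A deg) (a : A) : QSh K br →ₗ[K] K :=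
  linLift fun w => if br.total w = br.letter a then (binomPoly K w.length).coeff 1 else 0

open Classical in
theorem logFun_word (a : A) (w : List A) : logFun K br a (word K br w) =
    if br.total w = br.letter a then (binomPoly K w.length).coeff 1 else 0 := linLift_word K br _ w

theorem logFun_one (a : A) : logFun K br a 1 = 0 := by
  rw [one_def, logFun_word, if_neg]
  rw [HoffmanPairing.total_nil]
  exact (br.letter_ne_one a).symm

theorem counit_word_cons (a : A) (w : List A) :
    Coalgebra.counit (R := K) (word K br (a :: w)) = 0 := by
  rw [← consMap_coe]
  exact counit_cons K br a (word K br w)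

theorem logFun_of_mem_span (a : A) {m : WithOne br.Letters} (hm : m ≠ br.letter a) {x : QSh K br}
    (hx : x ∈ Submodule.span K (word K br '' {w | br.total w = m})) : logFun K br a x = 0 := by
  induction hx using Submodule.span_induction with
  | mem x hx =>
    obtain ⟨w, rfl, rfl⟩ := hx
    rw [logFun_word, if_neg hm]
  | zero => simp
  | add x y _ _ hx hy => rw [map_add, hx, hy, add_zero]
  | smul c x _ hx => rw [map_smul, hx, smul_zero]

theorem logFun_eq_coeff (a : A) {x : QSh K br}
    (hx : x ∈ Submodule.span K (word K br '' {w | br.total w = br.letter a})) :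
    logFun K br a x = (binomLin K br x).coeff 1 := by
  induction hx using Submodule.span_induction with
  | mem x hx =>
    obtain ⟨w, hw : br.total w = br.letter a, rfl⟩ := hx
    rw [logFun_word, if_pos hw, binomLin_word]
  | zero => simp
  | add x y _ _ hx hy => rw [map_add, map_add, coeff_add, hx, hy]
  | smul c x _ hx => rw [map_smul, map_smul, coeff_smul, hx]

/-- On non-empty words the functional must vanish on products. If the product of all letters is not
`a`, no word of the result counts. If it is `a`, which is not `0`, the value is the linear
coefficient of a product of two polynomials without constant term. -/
theorem isInfinitesimal_logFun [CharZero K] (a : A) : IsInfinitesimal (logFun K br a) := by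
  intro x y
  have h : (mulLin K br).compr₂ (logFun K br a) =
      (LinearMap.mul K K).compl₁₂ (logFun K br a) Coalgebra.counit +
        (LinearMap.mul K K).compl₁₂ Coalgebra.counit (logFun K br a) := by
    refine lin_ext fun u => lin_ext fun v => ?_
    change logFun K br a (word K br u * word K br v) =
      logFun K br a (word K br u) * Coalgebra.counit (R := K) (word K br v) +
        Coalgebra.counit (R := K) (word K br u) * logFun K br a (word K br v)
    rcases u with _ | ⟨b, u⟩
    · rw [← one_def, one_mul, logFun_one, Bialgebra.counit_one]; simp
    rcases v with _ | ⟨c, v⟩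
    · rw [← one_def, mul_one, logFun_one, Bialgebra.counit_one]; simp
    rw [counit_word_cons, counit_word_cons, mul_zero, zero_mul, add_zero]
    have hmem := word_mul_mem_span (K := K) (br := br) (b :: u) (c :: v)
    by_cases ht : br.total (b :: u) * br.total (c :: v) = br.letter a
    · rw [ht] at hmem
      rw [logFun_eq_coeff a hmem, binomLin_word_mul, mul_coeff_one, List.length_cons, List.length_cons,
        coeff_zero_binomPoly_succ, coeff_zero_binomPoly_succ, zero_mul, mul_zero, add_zero]
      rw [ht]
      exact fun h => WithZero.coe_ne_zero (br.letter_injective h)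
    · exact logFun_of_mem_span a ht hmem
  exact LinearMap.congr_fun₂ h x y

theorem convWord_logFun_cons (a : A) (w v : List A) :
    (convWord (logFun K br) (a :: w)).ofConv (word K br v) = ∑ i ∈ Finset.range (v.length + 1),
      logFun K br a (word K br (v.take i)) * (convWord (logFun K br) w).ofConv (word K br (v.drop i)) := by
  rw [convWord_cons, comul_word, map_sum, map_sum]
  rfl

/-- The empty prefix contributes nothing, and each other prefix of `v` admits at most one letter,
its product under the pairing; what remains is shorter. -/
theorem finite_convWord_logFun (x : QSh K br) :
    {w | (convWord (logFun K br) w).ofConv x ≠ 0}.Finite := by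
  refine finite_convWord_of_span (span_word K br) ?_ x
  rintro _ ⟨v, rfl⟩
  induction hn : v.length using Nat.strong_induction_on generalizing v with
  | _ n ih =>
  have hsub : {w | (convWord (logFun K br) w).ofConv (word K br v) ≠ 0} ⊆ {[]} ∪
      ⋃ i ∈ Finset.Icc 1 v.length, Set.image2 List.cons {a | br.total (v.take i) = br.letter (a : A)}
        {w | (convWord (logFun K br) w).ofConv (word K br (v.drop i)) ≠ 0} := by
    rintro (_ | ⟨a, w⟩) hw
    · exact Or.inl rfl
    · rw [Set.mem_ofPred_eq, convWord_logFun_cons] at hw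
      obtain ⟨i, hi, hne⟩ := Finset.exists_ne_zero_of_sum_ne_zero hw
      have hi0 : i ≠ 0 := by
        rintro rfl
        exact hne (by rw [List.take_zero, ← one_def, logFun_one, zero_mul])
      have ht : br.total (v.take i) = br.letter a := by
        by_contra ht
        exact left_ne_zero_of_mul hne (by rw [logFun_word, if_neg ht])
      rw [Finset.mem_range] at hi
      exact Or.inr (Set.mem_biUnion (x := i) (Finset.mem_coe.2 (Finset.mem_Icc.2 ⟨by omega, by omega⟩))
        ⟨a, ht, w, right_ne_zero_of_mul hne, rfl⟩)
  refine ((Set.finite_singleton _).union (Set.Finite.biUnion (Finset.finite_toSet _)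
    fun i hi => ?_)).subset hsub
  rw [Finset.mem_coe, Finset.mem_Icc] at hi
  refine Set.Finite.image2 _ (Set.Subsingleton.finite fun a ha b hb => ?_)
    (ih (v.drop i).length (by rw [List.length_drop]; omega) (v.drop i) rfl)
  exact WithZero.coe_injective (br.letter_injective (ha.symm.trans hb))

-- Every letter of `w` has to consume at least one letter of `v`. If `v` is not longer than `w`,
-- only prefixes of length `1` are affordable, and on these the functional compares two letters.
open Classical in
theorem convWord_logFun_of_length_le [CharZero K] (w v : List A) (h : v.length ≤ w.length) :
    (convWord (logFun K br) w).ofConv (word K br v) = if v = w then 1 else 0 := by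
  induction w generalizing v with
  | nil =>
    obtain rfl := List.length_eq_zero_iff.1 (Nat.le_zero.1 h)
    rw [convWord_nil, ← one_def, Bialgebra.counit_one, if_pos rfl]
  | cons a w ih =>
    rcases v with _ | ⟨b, v⟩
    · rw [← one_def, convWord_cons_one _ isInfinitesimal_logFun, if_neg (by simp)]
    · simp only [List.length_cons, Nat.add_le_add_iff_right] at h
      rw [convWord_logFun_cons, Finset.sum_eq_single 1]
      · have h1 : logFun K br a (word K br [b]) = if b = a then 1 else 0 := by
          rw [logFun_word, HoffmanPairing.total_cons, HoffmanPairing.total_nil, mul_one,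
            List.length_singleton, coeff_one_binomPoly_one]
          congr 1
          rw [br.letter_injective.eq_iff, WithZero.coe_inj]
        simp only [List.take_succ_cons, List.take_zero, List.drop_succ_cons, List.drop_zero, h1,
          ih v h, List.cons.injEq]
        split_ifs <;> simp_all
      · intro i hi hne
        rw [Finset.mem_range, List.length_cons] at hi
        rcases i with _ | _ | i
        · rw [List.take_zero, ← one_def, logFun_one, zero_mul]
        · exact absurd rfl hne
        -- A prefix of two or more letters leaves fewer letters than the rest of `w` requires.
        · have hlt : ((b :: v).drop (i + 2)).length < w.length := by
            rw [List.length_drop, List.length_cons]; omega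
          rw [ih _ hlt.le, if_neg (fun h => hlt.ne (congrArg List.length h)), mul_zero]
      · intro h
        simp at h

/-- The isomorphism of a quasi-shuffle algebra with the shuffle algebra. -/
noncomputable def toShuffle (K : Type*) [Field K] [CharZero K] (br : HoffmanPairing A deg) :
    QSh K br →ₐc[K] Shuffle K A deg :=
  RenHopf.toShuffle (logFun K br) finite_convWord_logFun deg isInfinitesimal_logFun

/-- A word goes to itself plus strictly shorter words, the result of merging blocks of consecutive
letters. -/
theorem toShuffle_bijective [CharZero K] : Function.Bijective (toShuffle K br) := by
  classical
  exact bijective_of_unitriangular (K := K) List.length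
    ((toShuffle K br : QSh K br →ₗ[K] Shuffle K A deg))
    (fun v => (convWord_logFun_of_length_le v v le_rfl).trans (if_pos rfl))
    (fun v w hvw hle => (convWord_logFun_of_length_le w v hle).trans (if_neg hvw))

end QSh

/-! ### Assembly of the isomorphisms. -/

/-- The isomorphism of `H_CK(A)` with `K[T(A)]`. -/
noncomputable def HCK.bialgEquivKT (K : Type*) [CommRing K] (A : Type u) : HCK K A ≃ₐc[K] KT K A :=
  .ofAlgEquiv (HCK.equivKT K A) (HCK.counit_comp K A) (HCK.map_comulHom K A)

/-- The isomorphism of `H_U` with the shuffle algebra. -/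
noncomputable def HU.bialgEquivShuffle (K : Type*) [CommRing K] :
    HU K ≃ₐc[K] Shuffle K ℕ+ fun n => (n : ℕ) :=
  .ofAlgEquiv (HU.toShAlg K)
    (AlgHom.ext fun f => HU.counit_eq_coeff K (HU.toSh K f))
    (AlgHom.ext (HU.map_comulLin K))

end RenHopf

theorem corollary4p16 {K : Type*} [Field K] [CharZero K] {A : Type*} [LinearOrder A] (deg : A → ℕ)
    (hpos : ∀ a, 1 ≤ deg a) (hfin : ∀ n, {a : A | deg a = n}.Finite)
    (br : RenHopf.HoffmanPairing A deg) :
    (∃ (I : Ideal (RenHopf.KT K A)) (_ : I.IsHopfIdeal K)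
      (J₁ : Ideal (RenHopf.HCK K A)) (_ : J₁.IsHopfIdeal K)
      (J₂ : Ideal (RenHopf.HNAP K A)) (_ : J₂.IsHopfIdeal K),
      (∀ x, x ∈ I ↔ RenHopf.piMap K A x = 0) ∧
      Nonempty (RenHopf.QSh K br ≃ₐc[K] RenHopf.KT K A ⧸ I) ∧
      Nonempty ((RenHopf.KT K A ⧸ I) ≃ₐc[K] RenHopf.HCK K A ⧸ J₁) ∧
      Nonempty ((RenHopf.HCK K A ⧸ J₁) ≃ₐc[K] RenHopf.HNAP K A ⧸ J₂)) ∧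
    (∃ (J : Ideal (RenHopf.HNAP K ℕ+)) (_ : J.IsHopfIdeal K),
      Nonempty (RenHopf.HU K ≃ₐc[K] RenHopf.HNAP K ℕ+ ⧸ J)) := by
  constructor
  · obtain ⟨hI, ⟨e⟩⟩ := RenHopf.exists_quotient_equiv (RenHopf.Forest.toShuffle K deg)
      (RenHopf.Forest.toShuffle_surjective deg)
    -- The surjection from `H_CK(A)` is the one from `K[T(A)]`, composed with the isomorphism of the
    -- two.
    obtain ⟨hJ₁, ⟨e₁⟩⟩ := RenHopf.exists_quotient_equiv
      ((RenHopf.Forest.toShuffle K deg).comp (RenHopf.HCK.bialgEquivKT K A).toBialgHom)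
      ((RenHopf.Forest.toShuffle_surjective deg).comp (RenHopf.HCK.equivKT K A).surjective)
    obtain ⟨hJ₂, ⟨e₂⟩⟩ := RenHopf.exists_quotient_equiv (RenHopf.HNAP.toShuffle K deg)
      (RenHopf.HNAP.toShuffle_surjective (A := A) deg)
    -- All the isomorphisms pass through the common target, the shuffle algebra on `A`.
    exact ⟨_, hI, _, hJ₁, _, hJ₂, RenHopf.Forest.toShuffle_eq_zero_iff deg,
      ⟨(BialgEquiv.ofBijective (RenHopf.QSh.toShuffle K br)
        RenHopf.QSh.toShuffle_bijective).trans e.symm⟩, ⟨e.trans e₁.symm⟩, ⟨e₁.trans e₂.symm⟩⟩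
  · obtain ⟨hJ, ⟨e⟩⟩ := RenHopf.exists_quotient_equiv
      (RenHopf.HNAP.toShuffle K fun n : ℕ+ => (n : ℕ)) (RenHopf.HNAP.toShuffle_surjective _)
    exact ⟨_, hJ, ⟨(RenHopf.HU.bialgEquivShuffle K).trans e.symm⟩⟩
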